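/- Let $n,N\ge 1$, let $\kappa_{abc}$ (indices running from $1$ to $N$) be a real totally symmetric tensor (for a Calabi--Yau threefold: its intersection numbers) and write $(klr)=\kappa_{abc}k^al^br^c$. Let $t\in\mathbb R^N$ and let $p_1,\dots,p_n\in\mathbb R^N$ be such that $(p_it^2)>0$ for all $i$. On $(\mathbb R^N)^n$ put $\boldsymbol x\cdot\boldsymbol y=\sum_i(p_ix_iy_i)$ and $$(\boldsymbol v_{ij})_k^a=\delta_{ki}p_j^a-\delta_{kj}p_i^a,\qquad (\boldsymbol u_{ij})_k^a=\delta_{ki}(p_jt^2)t^a-\delta_{kj}(p_it^2)t^a .$$ For an edge $e$, oriented arbitrarily from $s(e)$ to $t(e)$, of a tree $\mathcal T$ with vertex set $\{1,\dots,n\}$, let $\mathcal T_e^s,\mathcal T_e^t$ be the components of $\mathcal T\setminus e$ that contain $s(e)$, $t(e)$, and let $\boldsymbol u_e=\sum_{i\in \mathcal T_e^s}\sum_{j\in \mathcal T_e^t}\boldsymbol u_{ij}$. Let $$\widetilde\Phi_n(\boldsymbol x)=\frac1{2^{n-1}n!}\sum_{\mathcal T}\Big[\prod_{e\in E_{\mathcal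 T}}\mathcal D(\boldsymbol v_{s(e)t(e)})\Big]\Phi^E_{n-1}(\{\boldsymbol u_e\};\boldsymbol x),\qquad \mathcal D(\boldsymbol v)=\boldsymbol v\cdot\Big(\boldsymbol x+\frac1{2\pi}\partial_{\boldsymbol x}\Big),$$ where the sum is over all $n^{n-2}$ unrooted labelled trees. Here $\Phi^E_{m}(\mathcal V;\boldsymbol x)=E_m(\mathcal B\cdot\mathcal V;\mathcal B\cdot\boldsymbol x)$, the rows of $\mathcal B$ being an orthonormal basis of the positive definite space spanned by the $m$ vectors $\mathcal V$, and $E_m(\mathcal M;\mathbb u)=\int_{\mathbb R^m}e^{-\pi|\mathbb u-\mathbb u'|^2}\prod_i\mathrm{sgn}((\mathcal M^{\rm tr}\mathbb u')_i)\,d\mathbb u'$. For a non-empty proper subset $I$ of $\{1,\dots,n\}$ let $\boldsymbol u_I=\sum_{i\in I}\sum_{j\notin I}\boldsymbol u_{ij}$; the walls are the hyperplanes $\boldsymbol u_I\cdot\boldsymbol x=0$. Then $\widetilde\Phi_n$ has a large-$\boldsymbol x$ limit: there is a function $\widetilde\Phi^{(0)}_n$, unique off the walls, which is polynomial on each chamber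 of the complement of the walls and such that, for every $\epsilon>0$, $\widetilde\Phi_n(\boldsymbol x)-\widetilde\Phi^{(0)}_n(\boldsymbol x)\to0$ as $\boldsymbol x\to\infty$ with $|\boldsymbol u_I\cdot\boldsymbol x|\ge\epsilon\|\boldsymbol x\|$ for all $I$. Let moreover $\beta\in\mathbb R^N$ (the $B$-field), $\tau_2>0$, and $q_1,\dots,q_n\in\mathbb R^N$; assume that all matrices $\kappa_{i,ac}=\kappa_{acd}p_i^d$ are invertible and that all DSZ products $\gamma_{ij}=\langle\gamma_i,\gamma_j\rangle$ of $\gamma_i=(p_i,q_i)$ are integers, where $\langle(p,q),(p',q')\rangle=q_ap'^a-q'_ap^a$. Let $Z_{(p,q)}=-\frac12(pt^2)+\mathrm i\,(q_at^a+(p\beta t))$ be the leading large volume central charge, $c_i=\mathrm{Im}[Z_{\gamma_i}\bar Z_{\gamma_1+\cdots+\gamma_n}]$, and assume that no non-empty proper subset of $\{c_i\}$ sums up to zero. Let $\boldsymbol x$ be the point $x_i^a=\sqrt{2\tau_2}\,(\kappa_i^{ac}q_{i,c}+\beta^a)$, $\kappa_i^{ac}$ being the inverse of $\kappa_{i,ac}$.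 Then $$G_n:=\frac{(-1)^{\sum_{i<j}\gamma_{ij}}}{(\sqrt{2\tau_2})^{n-1}}\,\widetilde\Phi_n^{(0)}(\boldsymbol x) =\frac{(-1)^{n-1+\sum_{i<j}\gamma_{ij}}}{2^{n-1}n!}\sum_{m=0}^{[(n-1)/2]}\frac{(-1)^m}{(4\pi\tau_2)^m}\sum_{\mathcal T\in\mathbb T^\ell_{n-2m,m}}\ \prod_{\mathfrak v\in V_{\mathcal T}}\mathcal P_{m_{\mathfrak v}}(\{p_{\mathfrak v,s}\})\prod_{e\in E_{\mathcal T}}\gamma_{s(e)t(e)}\,\mathrm{sgn}(S_e).$$ Here $\mathbb T^\ell_{n-2m,m}$ is the set of unrooted trees with $n-2m$ vertices and $m$ marks on the vertices, together with a distribution of $\gamma_1,\dots,\gamma_n$ over the vertices such that a vertex $\mathfrak v$ with $m_{\mathfrak v}$ marks carries $1+2m_{\mathfrak v}$ charges $\gamma_{\mathfrak v,s}=(p_{\mathfrak v,s},q_{\mathfrak v,s})$; $\gamma_{\mathfrak v}=\sum_s\gamma_{\mathfrak v,s}$ and $\gamma_{s(e)t(e)}=\langle\gamma_{s(e)},\gamma_{t(e)}\rangle$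 (with any orientation of the edges); and, with $i,j$ running over the charges carried by the two components of $\mathcal T\setminus e$, $$S_e=\sum_{i\in\mathcal T_e^s}c_i=\sum_{i\in\mathcal T_e^s}\sum_{j\in\mathcal T_e^t}\mathrm{Im}[Z_{\gamma_i}\bar Z_{\gamma_j}].$$ Finally $$\mathcal P_m(\{p_s\})=\sum_T\frac1{T!}\prod_{v\in V_T}(p_{d_1(v)}p_{d_2(v)}p_{d_3(v)}),\qquad T!=\prod_{v\in V_T}n_v(T),$$ the sum being over the unordered full rooted ternary trees with $2m+1$ leaves labelled by the $p_s$; $V_T$ is the set of vertices other than the leaves, $d_1(v),d_2(v),d_3(v)$ are the children of $v$, $p_v=p_{d_1(v)}+p_{d_2(v)}+p_{d_3(v)}$, and $n_v(T)$ is the number of non-leaf vertices of the subtree of $T$ rooted at $v$. -/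

import Mathlib

open scoped Matrix

namespace BPSTree

noncomputable section

/-! ## The cubic form, the bilinear form and the charges -/

/-- `(k l r) = κ_{abc} k^a l^b r^c`. -/
def cubic {b : ℕ} (κ : Fin b → Fin b → Fin b → ℝ) (k l r : Fin b → ℝ) : ℝ :=
  ∑ a, ∑ c, ∑ d, κ a c d * k a * l c * r d

/-- `κ` is totally symmetric (invariant under the two adjacent transpositions). -/
def IsSymmetricCubic {b : ℕ} (κ : Fin b → Fin b → Fin b → ℝ) : Prop :=
  ∀ a c d, κ a c d = κ c a d ∧ κ a c d = κ a d c

/-- The matrix `κ_{abc} p^c` of the quadratic form attached to a D4-charge `p`. -/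
def quadForm {b : ℕ} (κ : Fin b → Fin b → Fin b → ℝ) (p : Fin b → ℝ) :
    Matrix (Fin b) (Fin b) ℝ :=
  Matrix.of fun a c => ∑ d, κ a c d * p d

/-- The ambient space `⊕_{i=1}^n ℝ^b`; `x i a` is the component `x_i^a`. -/
abbrev Space (n b : ℕ) : Type := Fin n → Fin b → ℝ

/-- The bilinear form `x · y = ∑_i (p_i x_i y_i)`. -/
def bilin {n b : ℕ} (κ : Fin b → Fin b → Fin b → ℝ) (p : Fin n → Fin b → ℝ)
    (x y : Space n b) : ℝ :=
  ∑ i, cubic κ (p i) (x i) (y i)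

/-- The vector `v_{ij}`, with `(v_{ij})_k^a = δ_{ki} p_j^a - δ_{kj} p_i^a`. -/
def vVec {n b : ℕ} (p : Fin n → Fin b → ℝ) (i j : Fin n) : Space n b :=
  fun k a => (if k = i then p j a else 0) - (if k = j then p i a else 0)

/-- The vector `u_{ij}`, with `(u_{ij})_k^a = δ_{ki} (p_j t²) t^a - δ_{kj} (p_i t²) t^a`. -/
def uVec {n b : ℕ} (κ : Fin b → Fin b → Fin b → ℝ) (p : Fin n → Fin b → ℝ)
    (t : Fin b → ℝ) (i j : Fin n) : Space n b :=
  fun k a => (if k = i then cubic κ (p j) t t * t a else 0)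
    - (if k = j then cubic κ (p i) t t * t a else 0)

/-- The DSZ product `⟨γ, γ'⟩ = q_a p'^a - q'_a p^a` of `γ = (p, q)` and `γ' = (p', q')`. -/
def dsz {b : ℕ} (p q p' q' : Fin b → ℝ) : ℝ :=
  ∑ a, (q a * p' a - q' a * p a)

/-- The leading large volume central charge
`Z_γ = -(p t²)/2 + i (q_a t^a + (p b t))`, for the Kähler moduli `bf + i t`. -/
def centralCharge {b : ℕ} (κ : Fin b → Fin b → Fin b → ℝ) (bf t : Fin b → ℝ)
    (p q : Fin b → ℝ) : ℂ :=
  ⟨-(1 / 2) * cubic κ p t t, (∑ a, q a * t a) + cubic κ p bf t⟩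

/-- `Im [Z_{γ₁} \bar Z_{γ₂}]`. -/
def imZZ {b : ℕ} (κ : Fin b → Fin b → Fin b → ℝ) (bf t : Fin b → ℝ)
    (p₁ q₁ p₂ q₂ : Fin b → ℝ) : ℝ :=
  (centralCharge κ bf t p₁ q₁ * starRingEnd ℂ (centralCharge κ bf t p₂ q₂)).im

/-- The stability parameter `c_i = Im [Z_{γ_i} \bar Z_γ]`, where `γ = γ_1 + ⋯ + γ_n`. -/
def stab {n b : ℕ} (κ : Fin b → Fin b → Fin b → ℝ) (bf t : Fin b → ℝ)
    (p q : Fin n → Fin b → ℝ) (i : Fin n) : ℝ :=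
  imZZ κ bf t (p i) (q i) (∑ j, p j) (∑ j, q j)

/-- The point `x_i^a = √(2τ₂) (κ_i^{ab} q_{i,b} + b^a)` attached to the charges `(p_i, q_i)`;
`κ_i^{ab}` is the inverse of the matrix `κ_{abc} p_i^c`. -/
def chargePoint {n b : ℕ} (κ : Fin b → Fin b → Fin b → ℝ) (bf : Fin b → ℝ)
    (p q : Fin n → Fin b → ℝ) (τ₂ : ℝ) : Space n b :=
  fun i a => Real.sqrt (2 * τ₂) * (((quadForm κ (p i))⁻¹ *ᵥ q i) a + bf a)

/-! ## Generalized error functions -/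

/-- The generalized error function
`E(M; u) = ∫ du' exp(-π (u-u')ᵗ(u-u')) ∏_i sgn((Mᵗ u')_i)`. -/
def genErr {ι : Type} [Fintype ι] (M : Matrix ι ι ℝ) (u : ι → ℝ) : ℝ :=
  ∫ u' : ι → ℝ, Real.exp (-Real.pi * ((u - u') ⬝ᵥ (u - u'))) * ∏ i, Real.sign ((Mᵀ *ᵥ u') i)

/-- `B` is an orthonormal basis, for the form `Q`, of the span of the vectors `V`. -/
def IsOrthonormalBasisOfSpan {ι X : Type} [AddCommGroup X] [Module ℝ X]
    (Q : X → X → ℝ) (V B : ι → X) : Prop :=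
  (∀ i, Q (B i) (B i) = 1) ∧ (∀ i j, i ≠ j → Q (B i) (B j) = 0) ∧
    Submodule.span ℝ (Set.range B) = Submodule.span ℝ (Set.range V)

open Classical in
/-- The boosted generalized error function `Φ^E(V; x) = E(B·V; B·x)`, where the rows of `B` form
an orthonormal basis of the (positive definite) span of the vectors `V`. -/
def boostedErr {ι X : Type} [Fintype ι] [AddCommGroup X] [Module ℝ X]
    (Q : X → X → ℝ) (V : ι → X) (x : X) : ℝ :=
  if h : ∃ B : ι → X, IsOrthonormalBasisOfSpan Q V B then
    genErr (Matrix.of fun i j => Q (h.choose i) (V j)) (fun i => Q (h.choose i) x)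
  else 0

/-- The operator `𝒟(v) = v · (x + ∂_x / (2π))`. -/
def covDeriv {n b : ℕ} (κ : Fin b → Fin b → Fin b → ℝ) (p : Fin n → Fin b → ℝ)
    (v : Space n b) (f : Space n b → ℝ) : Space n b → ℝ :=
  fun x => bilin κ p v x * f x + 1 / (2 * Real.pi) * fderiv ℝ f x v

/-- The uplifted boosted error function `[∏_e 𝒟(ṽ_e)] Φ^E(V; x)`, the product of (commuting)
operators being taken as a composition along an enumeration of the index type. -/
def upliftedErr {n b : ℕ} {ι : Type} [Fintype ι] (κ : Fin b → Fin b → Fin b → ℝ)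
    (p : Fin n → Fin b → ℝ) (V Vt : ι → Space n b) : Space n b → ℝ :=
  (Finset.univ : Finset ι).toList.foldr (fun e f => covDeriv κ p (Vt e) f)
    (boostedErr (bilin κ p) V)

/-! ## Unrooted labelled trees -/

/-- `o` picks for every unordered pair its source `(o e).1` and its target `(o e).2`. -/
def IsOrientation {V : Type} (o : Sym2 V → V × V) : Prop :=
  ∀ e, s((o e).1, (o e).2) = e

open Classical in
/-- The unrooted trees on the vertex set `V`. -/
def trees (V : Type) [Fintype V] : Finset (SimpleGraph V) :=
  Finset.univ.filter fun T => T.IsTree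

open Classical in
/-- The vertices that can be reached from `v` once the edge `e` is removed from `T`. For an edge
of a tree and an end `v` of it this is the one of the two subtrees that contains `v`. -/
def side {V : Type} [Fintype V] (T : SimpleGraph V) (e : Sym2 V) (v : V) : Finset V :=
  Finset.univ.filter fun w => (T.deleteEdges {e}).Reachable v w

/-- `u_e = ∑_{i ∈ T_e^s} ∑_{j ∈ T_e^t} u_{ij}`. -/
def uEdge {n b : ℕ} (κ : Fin b → Fin b → Fin b → ℝ) (p : Fin n → Fin b → ℝ) (t : Fin b → ℝ)
    (o : Sym2 (Fin n) → Fin n × Fin n) (T : SimpleGraph (Fin n)) (e : Sym2 (Fin n)) :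
    Space n b :=
  ∑ i ∈ side T e (o e).1, ∑ j ∈ side T e (o e).2, uVec κ p t i j

open Classical in
/-- The tree sum
`Φ̃_n(x) = 1/(2^{n-1} n!) ∑_T Φ̃^E_{n-1}({u_e}, {v_{s(e)t(e)}}; x)`
over the unrooted labelled trees with `n` vertices. -/
def treeKernel {n b : ℕ} (κ : Fin b → Fin b → Fin b → ℝ) (p : Fin n → Fin b → ℝ) (t : Fin b → ℝ)
    (o : SimpleGraph (Fin n) → Sym2 (Fin n) → Fin n × Fin n) (x : Space n b) : ℝ :=
  1 / (2 ^ (n - 1) * (n.factorial : ℝ)) *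
    ∑ T ∈ trees (Fin n),
      upliftedErr (ι := T.edgeSet) κ p
        (fun e => uEdge κ p t (o T) T e)
        (fun e => vVec p (o T e).1 (o T e).2) x

/-! ## The large `x` limit -/

/-- The vector `u_I = ∑_{i ∈ I} ∑_{j ∉ I} u_{ij}`. The vectors `u_e` of the trees are the `u_I`
for the non-empty proper subsets `I`. -/
def uSet {n b : ℕ} (κ : Fin b → Fin b → Fin b → ℝ) (p : Fin n → Fin b → ℝ) (t : Fin b → ℝ)
    (I : Finset (Fin n)) : Space n b :=
  ∑ i ∈ I, ∑ j ∈ Iᶜ, uVec κ p t i j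

/-- `I` is neither empty nor everything. -/
def IsProper {n : ℕ} (I : Finset (Fin n)) : Prop := I.Nonempty ∧ I ≠ Finset.univ

/-- `x` lies on none of the walls `u_I · x = 0`. -/
def OffWalls {n b : ℕ} (κ : Fin b → Fin b → Fin b → ℝ) (p : Fin n → Fin b → ℝ) (t : Fin b → ℝ)
    (x : Space n b) : Prop :=
  ∀ I : Finset (Fin n), IsProper I → bilin κ p (uSet κ p t I) x ≠ 0

/-- `Φ₀` is the large `x` limit of `Φ`: on each chamber of the complement of the walls it is a
polynomial, and `Φ - Φ₀` tends to zero as `x → ∞` in every closed cone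
`{x | |u_I · x| ≥ ε ‖x‖ for all I}` that stays away from the walls. Since `Φ` grows, the limit is
a function of `x`; these two properties determine it off the walls. -/
def IsLargeLimit {n b : ℕ} (κ : Fin b → Fin b → Fin b → ℝ) (p : Fin n → Fin b → ℝ)
    (t : Fin b → ℝ) (Φ Φ₀ : Space n b → ℝ) : Prop :=
  (∀ x₀, OffWalls κ p t x₀ → ∃ P : MvPolynomial (Fin n × Fin b) ℝ, ∀ x : Space n b,
    (∀ I : Finset (Fin n), IsProper I →
      Real.sign (bilin κ p (uSet κ p t I) x) = Real.sign (bilin κ p (uSet κ p t I) x₀)) →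
    Φ₀ x = MvPolynomial.eval (fun k => x k.1 k.2) P) ∧
  ∀ ε : ℝ, 0 < ε →
    Filter.Tendsto (fun x => Φ x - Φ₀ x)
      (Bornology.cobounded (Space n b) ⊓
        Filter.principal {x | ∀ I : Finset (Fin n), IsProper I →
          ε * ‖x‖ ≤ |bilin κ p (uSet κ p t I) x|})
      (nhds 0)

/-- `G_n = (-1)^{∑_{i<j} γ_{ij}} (√(2τ₂))^{-(n-1)} Φ₀(x)`, where `g i j` is the integer `γ_{ij}`
and `Φ₀` is the large `x` limit. -/
def rescaledLimit {n b : ℕ} (g : Fin n → Fin n → ℤ) (τ₂ : ℝ) (Φ₀ : Space n b → ℝ)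
    (x : Space n b) : ℝ :=
  (-1 : ℝ) ^ (∑ i, ∑ j ∈ Finset.Ioi i, g i j) / Real.sqrt (2 * τ₂) ^ (n - 1) * Φ₀ x

/-! ## Rooted ternary trees and the weights of the marks -/

/-- Full rooted ternary trees with labelled leaves. -/
inductive TernaryTree (ι : Type) : Type
  | leaf : ι → TernaryTree ι
  | node : TernaryTree ι → TernaryTree ι → TernaryTree ι → TernaryTree ι

namespace TernaryTree

/-- The labels of the leaves, with multiplicity. -/
def leaves {ι : Type} : TernaryTree ι → Multiset ι
  | leaf i => {i}
  | node t₁ t₂ t₃ => t₁.leaves + t₂.leaves + t₃.leaves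

/-- The smallest label of a leaf. -/
def minLeaf {ι : Type} [LinearOrder ι] : TernaryTree ι → ι
  | leaf i => i
  | node t₁ t₂ t₃ => min t₁.minLeaf (min t₂.minLeaf t₃.minLeaf)

/-- At every vertex the three children are listed by increasing smallest leaf. When the labels of
the leaves are pairwise distinct, each tree has exactly one such representative modulo the
permutations of the children of its vertices. -/
def Sorted {ι : Type} [LinearOrder ι] : TernaryTree ι → Prop
  | leaf _ => True
  | node t₁ t₂ t₃ => t₁.minLeaf < t₂.minLeaf ∧ t₂.minLeaf < t₃.minLeaf ∧
      t₁.Sorted ∧ t₂.Sorted ∧ t₃.Sorted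

/-- The number of vertices, not counting the leaves. -/
def numVertices {ι : Type} : TernaryTree ι → ℕ
  | leaf _ => 0
  | node t₁ t₂ t₃ => 1 + t₁.numVertices + t₂.numVertices + t₃.numVertices

/-- The tree factorial `T! = ∏_v n_v(T)`, where `v` runs over the vertices other than the leaves
and `n_v(T)` is the number of those in the subtree rooted at `v`. -/
def factorial {ι : Type} : TernaryTree ι → ℕ
  | leaf _ => 1
  | node t₁ t₂ t₃ =>
      (node t₁ t₂ t₃).numVertices * (t₁.factorial * t₂.factorial * t₃.factorial)

/-- The charge of the root: each vertex carries the sum of the charges of its children. -/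
def charge {ι : Type} {b : ℕ} (p : ι → Fin b → ℝ) : TernaryTree ι → Fin b → ℝ
  | leaf i => p i
  | node t₁ t₂ t₃ => t₁.charge p + t₂.charge p + t₃.charge p

/-- The product `∏_v (p_{d₁(v)} p_{d₂(v)} p_{d₃(v)})` over the vertices other than the leaves. -/
def weight {ι : Type} {b : ℕ} (κ : Fin b → Fin b → Fin b → ℝ) (p : ι → Fin b → ℝ) :
    TernaryTree ι → ℝ
  | leaf _ => 1
  | node t₁ t₂ t₃ => cubic κ (t₁.charge p) (t₂.charge p) (t₃.charge p) *
      (t₁.weight κ p * t₂.weight κ p * t₃.weight κ p)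

theorem card_leaves_pos {ι : Type} (t : TernaryTree ι) : 0 < t.leaves.card := by
  cases t with
  | leaf i => simp [leaves]
  | node t₁ t₂ t₃ =>
    have := card_leaves_pos t₁
    simp only [leaves, Multiset.card_add]
    omega

theorem finite_card_leaves_le {ι : Type} [Finite ι] (k : ℕ) :
    {t : TernaryTree ι | t.leaves.card ≤ k}.Finite := by
  induction k with
  | zero =>
    refine Set.Finite.subset Set.finite_empty ?_
    intro t ht
    have := card_leaves_pos t
    simp only [Set.mem_ofPred_eq] at ht
    omega
  | succ k ih =>
    refine Set.Finite.subset ((Set.finite_range (leaf (ι := ι))).union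
      ((ih.prod (ih.prod ih)).image fun s => node s.1 s.2.1 s.2.2)) ?_
    intro t ht
    cases t with
    | leaf i => exact Or.inl ⟨i, rfl⟩
    | node t₁ t₂ t₃ =>
      have h₁ := card_leaves_pos t₁
      have h₂ := card_leaves_pos t₂
      have h₃ := card_leaves_pos t₃
      simp only [Set.mem_ofPred_eq, leaves, Multiset.card_add] at ht
      refine Or.inr ⟨(t₁, t₂, t₃), ⟨?_, ?_, ?_⟩, rfl⟩ <;>
        · simp only [Set.mem_ofPred_eq]
          omega

end TernaryTree

/-- The unordered full rooted ternary trees whose leaves are labelled bijectively by `A`. -/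
def ternaryTreeSet {n : ℕ} (A : Finset (Fin n)) : Set (TernaryTree (Fin n)) :=
  {t | t.leaves = A.val ∧ t.Sorted}

theorem finite_ternaryTreeSet {n : ℕ} (A : Finset (Fin n)) : (ternaryTreeSet A).Finite := by
  refine (TernaryTree.finite_card_leaves_le A.card).subset ?_
  rintro t ⟨ht, -⟩
  simp [ht]

/-- The weight `𝒫_m({p_s}_{s ∈ A})`, `|A| = 2m+1`, of a vertex that carries the charges in `A`:
the sum of `(1/T!) ∏_v (p_{d₁(v)} p_{d₂(v)} p_{d₃(v)})` over the unordered rooted ternary trees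
with leaves `A`. -/
def markWeight {n b : ℕ} (κ : Fin b → Fin b → Fin b → ℝ) (p : Fin n → Fin b → ℝ)
    (A : Finset (Fin n)) : ℝ :=
  ∑ T ∈ (finite_ternaryTreeSet A).toFinset, 1 / (T.factorial : ℝ) * T.weight κ p

/-! ## Marked trees -/

/-- The ways to distribute `γ_1, …, γ_n` over the vertices of a marked tree with `m` marks and
`n - 2m` vertices. A vertex is identified with the set `A` of the charges that it carries; it has
`m_A` marks, where `|A| = 1 + 2 m_A`. -/
def markedVertexSets (n m : ℕ) : Finset (Finpartition (Finset.univ : Finset (Fin n))) :=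
  Finset.univ.filter fun π => π.parts.card + 2 * m = n ∧ ∀ A ∈ π.parts, Odd A.card

/-- `∑_{i ∈ V_{T'}} f_i` over all charges carried by the vertices in the set `W`. -/
def sumOver {n : ℕ} {π : Finpartition (Finset.univ : Finset (Fin n))} {M : Type} [AddCommMonoid M]
    (W : Finset π.parts) (f : Fin n → M) : M :=
  ∑ A ∈ W, ∑ i ∈ (A : Finset (Fin n)), f i

/-- `S_e = ∑_{i ∈ T_e^s} c_i` for an edge `e` of a marked tree. -/
def edgeStab {n : ℕ} {π : Finpartition (Finset.univ : Finset (Fin n))}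
    (c : Fin n → ℝ) (o : Sym2 π.parts → π.parts × π.parts) (T : SimpleGraph π.parts)
    (e : Sym2 π.parts) : ℝ :=
  sumOver (side T e (o e).1) c

/-- `γ_{s(e)t(e)}`, the DSZ product of the total charges of the two ends of an edge of a marked
tree. -/
def edgeDSZ {n b : ℕ} {π : Finpartition (Finset.univ : Finset (Fin n))}
    (p q : Fin n → Fin b → ℝ) (o : Sym2 π.parts → π.parts × π.parts) (e : Sym2 π.parts) : ℝ :=
  dsz (∑ i ∈ ((o e).1 : Finset (Fin n)), p i) (∑ i ∈ ((o e).1 : Finset (Fin n)), q i)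
    (∑ i ∈ ((o e).2 : Finset (Fin n)), p i) (∑ i ∈ ((o e).2 : Finset (Fin n)), q i)

open Classical in
/-- The sum over the marked unrooted labelled trees with `n - 2m` vertices and `m` marks of
`∏_v 𝒫_{m_v}({p_{v,s}}) ∏_e γ_{s(e)t(e)} sgn(S_e)`. -/
def markedTreeSum {n b : ℕ} (κ : Fin b → Fin b → Fin b → ℝ) (p q : Fin n → Fin b → ℝ)
    (c : Fin n → ℝ)
    (o : (π : Finpartition (Finset.univ : Finset (Fin n))) → SimpleGraph π.parts →
      Sym2 π.parts → π.parts × π.parts)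
    (m : ℕ) : ℝ :=
  ∑ π ∈ markedVertexSets n m, ∑ T ∈ trees π.parts,
    (∏ A : π.parts, markWeight κ p A) *
      ∏ e ∈ T.edgeFinset, edgeDSZ p q (o π T) e * Real.sign (edgeStab c (o π T) T e)

end

end BPSTree

/-! Large argument. For one tree, the boosted error function is a Gaussian average, centred at x, of
a product of signs. Deep inside a chamber that product equals the constant ∏ sgn(u_e·x), up to a
function that vanishes on the sign cell of x. The operators 𝒟(v) keep the average of the latter
within sums of (temperate function) × (Gaussian average of a function vanishing on the cell), and
these decay like exp(-c‖x‖²) in closed cones off the walls (`tendsto_foldr_raiseOp_genErr`). What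
survives is ∏ sgn(u_e·x) times the polynomial ∏ 𝒟(v_e) 1. Two candidates for the limit agree on a
chamber because their difference is a polynomial that tends to zero along a ray
(`IsLargeLimit.eq_of_offWalls`).

Heat operator. From [Δ, v] = 2∂_v one gets ∏ 𝒟(v_e) 1 = exp(Δ/4π) ∏ (v_e·x) (`heat_linPoly_mul`,
`foldr_covDeriv_one`). At the charge point the limit is therefore, up to a sign and a prefactor,
exp(Δ/4π) applied to the signed tree sum ∑_T ∏ sgn(S_e) v_e.

Contraction. Disjoint edges are orthogonal and v_ij·v_ik = (p_i p_j p_k), so Δ removes two adjacent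
edges ij, ik of a tree. The remaining forest has i, j, k in three components whose sums of the c's
are nonzero and add up to zero. The same forest arises from three trees, with i, j or k in the
middle, all with the same tensor factor; their signs add up to s_j s_k + s_k s_i + s_i s_j = -1.
Hence Δ turns a tree sum into -1/3 times the sum of the tree sums in which three classes are
identified (`lap_forestSum`). This is proved for trees over an arbitrary equivalence relation, so
that it can be iterated.

Marks. After m contractions of the singletons one has partitions into n-2m odd blocks. The weights 𝒫
count the histories of a block: as the root factor of T! cancels, 6·((|B|-1)/2)·𝒫(B) is the sum over
ordered splittings of B into three parts (`markWeight_recursion`). Since the numbers (|B|-1)/2 add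
up to m, induction gives 6^m m! times the sum over partitions of ∏ 𝒫 (`iterate_mergeSum_bot`). The
constants are (-1/3)^m 6^m m! = (-2)^m m!; the factor 1/(m! (4π)^m) of the exponential and the 2m
missing factors √(2τ₂) turn this into (-1)^m/(4πτ₂)^m.

Charges. At the charge point v_ij·x = √(2τ₂) γ_ij and u_I·x = -2√(2τ₂) ∑_{i∈I} c_i, so genericity
puts the point off the walls and the n-1 edges give (-1)^(n-1). -/

namespace BPSTree

/-! ### Gaussian averages: differentiation and decay. -/

section Gaussian

open MeasureTheory

variable {ι : Type} [Fintype ι] {E : Type} [NormedAddCommGroup E] [NormedSpace ℝ E]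

/-- Completing the square, A|u| ≤ A²/(2a) + (a/2)u², leaves half of the Gaussian. Functions of this
form dominate the integrands below. -/
theorem integrable_exp_neg_sq_add_abs {a : ℝ} (ha : 0 < a) (A : ℝ) :
    Integrable fun u : ι → ℝ => Real.exp (-a * ∑ i, u i ^ 2 + A * ∑ i, |u i|) := by
  have h1 : Integrable fun u : ℝ => Real.exp (-a * u ^ 2 + A * |u|) := by
    refine Integrable.mono' (g := fun u => Real.exp (A ^ 2 / (2 * a)) * Real.exp (-(a / 2) * u ^ 2))
      ((integrable_exp_neg_mul_sq (by positivity)).const_mul _)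
      (Continuous.aestronglyMeasurable (by fun_prop)) (Filter.Eventually.of_forall fun u => ?_)
    rw [Real.norm_eq_abs, Real.abs_exp, ← Real.exp_add]
    apply Real.exp_le_exp.2
    have h2 : 0 ≤ (A - a * |u|) ^ 2 / (2 * a) := by positivity
    have h3 : (A - a * |u|) ^ 2 / (2 * a) = A ^ 2 / (2 * a) - A * |u| + a / 2 * u ^ 2 := by
      rw [← sq_abs u]; field_simp; ring
    linarith
  have h := Integrable.fintype_prod (ι := ι) (f := fun _ u => Real.exp (-a * u ^ 2 + A * |u|))
    (μ := fun _ => volume) fun _ => h1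
  refine h.congr (Filter.Eventually.of_forall fun u => ?_)
  simp only
  rw [← Real.exp_sum, Finset.sum_add_distrib, Finset.mul_sum, Finset.mul_sum]

/-- Measurable functions of at most exponential growth that vanish on `Ω`. -/
def ExpGrowth (Ω : Set (ι → ℝ)) (h : (ι → ℝ) → ℝ) : Prop :=
  Measurable h ∧ (∀ u ∈ Ω, h u = 0) ∧
    ∃ C A : ℝ, 0 ≤ A ∧ ∀ u, |h u| ≤ C * Real.exp (A * ∑ i, |u i|)

/-- Differentiating the Gaussian kernel brings down coordinates of u. The class absorbs them, with
the same Ω, at the price of one unit in the exponent. -/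
theorem ExpGrowth.coord_mul {Ω : Set (ι → ℝ)} {h : (ι → ℝ) → ℝ} (hh : ExpGrowth Ω h) (i : ι) :
    ExpGrowth Ω fun u => u i * h u := by
  obtain ⟨hm, h0, C, A, hA, hb⟩ := hh
  refine ⟨by fun_prop, fun u hu => by simp [h0 u hu], C, A + 1, by linarith, fun u => ?_⟩
  have h1 : |u i| ≤ Real.exp (∑ i, |u i|) := by
    have := Finset.single_le_sum (f := fun i => |u i|) (fun j _ => abs_nonneg (u j))
      (Finset.mem_univ i)
    have := Real.add_one_le_exp (∑ i, |u i|)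
    linarith
  calc |u i * h u| = |u i| * |h u| := abs_mul _ _
    _ ≤ Real.exp (∑ i, |u i|) * (C * Real.exp (A * ∑ i, |u i|)) := by
        gcongr; exact hb u
    _ = _ := by rw [add_mul, one_mul, Real.exp_add]; ring

/-- The Gaussian average of `h` around `L x`. -/
noncomputable def gaussAvg (L : E →L[ℝ] (ι → ℝ)) (h : (ι → ℝ) → ℝ) (x : E) : ℝ :=
  ∫ u : ι → ℝ, Real.exp (-Real.pi * ((L x - u) ⬝ᵥ (L x - u))) * h u

/-- This is (2y - u)² ≥ 0 in each coordinate. Half of the Gaussian in u survives uniformly for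
bounded y, which is what differentiation under the integral needs. -/
theorem neg_pi_dist_le (y u : ι → ℝ) {R : ℝ} (hR : ∀ i, |y i| ≤ R) :
    -Real.pi * ((y - u) ⬝ᵥ (y - u)) ≤
      Real.pi * (Fintype.card ι * R ^ 2) + -(Real.pi / 2) * ∑ i, u i ^ 2 := by
  have h1 : (1 / 2) * ∑ i, u i ^ 2 - Fintype.card ι * R ^ 2 ≤ (y - u) ⬝ᵥ (y - u) := by
    have : (Fintype.card ι : ℝ) * R ^ 2 = ∑ i : ι, R ^ 2 := by simp
    rw [this, dotProduct, Finset.mul_sum, ← Finset.sum_sub_distrib]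
    refine Finset.sum_le_sum fun i _ => ?_
    have h2 : y i ^ 2 ≤ R ^ 2 := sq_le_sq' (by linarith [neg_abs_le (y i), hR i])
      (by linarith [le_abs_self (y i), hR i])
    simp only [Pi.sub_apply]
    nlinarith [sq_nonneg (2 * y i - u i)]
  nlinarith [Real.pi_pos]

theorem integrable_gauss_mul {Ω : Set (ι → ℝ)} {h : (ι → ℝ) → ℝ} (hh : ExpGrowth Ω h)
    (y : ι → ℝ) :
    Integrable fun u : ι → ℝ => Real.exp (-Real.pi * ((y - u) ⬝ᵥ (y - u))) * h u := by
  obtain ⟨hm, -, C, A, hA, hb⟩ := hh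
  refine Integrable.mono' ((integrable_exp_neg_sq_add_abs (ι := ι)
    (half_pos Real.pi_pos) A).const_mul (Real.exp (Real.pi * (Fintype.card ι * ‖y‖ ^ 2)) * C)) ?_
    (Filter.Eventually.of_forall fun u => ?_)
  · refine Measurable.aestronglyMeasurable (Measurable.mul ?_ hm)
    unfold dotProduct
    fun_prop
  · rw [Real.norm_eq_abs, abs_mul, Real.abs_exp]
    have h1 := Real.exp_le_exp.2 (neg_pi_dist_le y u (R := ‖y‖) fun i => norm_le_pi_norm y i)
    rw [Real.exp_add] at h1
    calc _ ≤ (Real.exp (Real.pi * (Fintype.card ι * ‖y‖ ^ 2)) *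
            Real.exp (-(Real.pi / 2) * ∑ i, u i ^ 2)) * (C * Real.exp (A * ∑ i, |u i|)) := by
          gcongr; exact hb u
      _ = _ := by rw [Real.exp_add]; ring

/-- The derivative of exp(-π|Lx - u|²) along v is 2π ∑ (u_i - (Lx)_i)(Lv)_i times the kernel, so the
derivative of an average is again built from averages. -/
theorem hasFDerivAt_gaussAvg {Ω : Set (ι → ℝ)} {h : (ι → ℝ) → ℝ} (hh : ExpGrowth Ω h)
    (L : E →L[ℝ] (ι → ℝ)) (x : E) :
    HasFDerivAt (gaussAvg L h)
      (∑ i, (2 * Real.pi * (gaussAvg L (fun u => u i * h u) x - L x i * gaussAvg L h x)) •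
        (ContinuousLinearMap.proj i ∘L L : E →L[ℝ] ℝ)) x := by
  classical
  set pr : ι → E →L[ℝ] ℝ := fun i => ContinuousLinearMap.proj i ∘L L with hpr
  set F : E → (ι → ℝ) → ℝ := fun x u =>
    Real.exp (-Real.pi * ((L x - u) ⬝ᵥ (L x - u))) * h u with hF
  set F' : E → (ι → ℝ) → E →L[ℝ] ℝ := fun x u =>
    ∑ i, (2 * Real.pi * (Real.exp (-Real.pi * ((L x - u) ⬝ᵥ (L x - u))) * (u i * h u) -
      L x i * (Real.exp (-Real.pi * ((L x - u) ⬝ᵥ (L x - u))) * h u))) • pr i with hF'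
  have hm := hh.1
  obtain ⟨-, -, C, A, hA, hb⟩ := id hh
  have hC : 0 ≤ C := by
    have := hb 0
    simp at this
    exact (abs_nonneg _).trans this
  have hint : ∀ i, Integrable fun u : ι → ℝ =>
      2 * Real.pi * (Real.exp (-Real.pi * ((L x - u) ⬝ᵥ (L x - u))) * (u i * h u) -
      L x i * (Real.exp (-Real.pi * ((L x - u) ⬝ᵥ (L x - u))) * h u)) := fun i =>
    (((integrable_gauss_mul (hh.coord_mul i) (L x))).sub
      ((integrable_gauss_mul hh (L x)).const_mul _)).const_mul _
  have hval : ∫ u, F' x u = ∑ i, (2 * Real.pi * (gaussAvg L (fun u => u i * h u) x -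
      L x i * gaussAvg L h x)) • pr i := by
    simp only [hF']
    rw [integral_finsetSum _ fun i _ => (hint i).smul_const _]
    refine Finset.sum_congr rfl fun i _ => ?_
    rw [integral_smul_const, integral_const_mul, integral_sub
      (integrable_gauss_mul (hh.coord_mul i) (L x))
      ((integrable_gauss_mul hh (L x)).const_mul _), integral_const_mul]
    rfl
  rw [← hval]
  -- A common bound for the coordinates of `L z` on the unit ball around `x`, the neighbourhood on
  -- which the derivative is dominated.
  set R : ℝ := ‖L‖ * (‖x‖ + 1) with hR
  have hLR : ∀ z ∈ Metric.ball x 1, ∀ i, |L z i| ≤ R := by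
    intro z hz i
    refine (norm_le_pi_norm (L z) i).trans ((L.le_opNorm z).trans ?_)
    have : ‖z‖ ≤ ‖x‖ + 1 := by
      have h1 : ‖z - x‖ < 1 := by simpa [dist_eq_norm] using hz
      have h2 := norm_add_le (z - x) x
      simp at h2
      linarith
    exact mul_le_mul_of_nonneg_left this (norm_nonneg _)
  have hR0 : 0 ≤ R := by positivity
  refine hasFDerivAt_integral_of_dominated_of_fderiv_le (F := F) (F' := F')
    (bound := fun u => (∑ i, 2 * Real.pi * ‖pr i‖) *
      (Real.exp (Real.pi * (Fintype.card ι * R ^ 2)) * C * Real.exp R) *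
      Real.exp (-(Real.pi / 2) * ∑ i, u i ^ 2 + (A + 1) * ∑ i, |u i|))
    (s := Metric.ball x 1) (Metric.ball_mem_nhds x one_pos)
    (Filter.Eventually.of_forall fun z => (integrable_gauss_mul hh (L z)).1)
    (integrable_gauss_mul hh (L x)) ?_ ?_ ?_ ?_
  · exact (integrable_finsetSum _ fun i _ => (hint i).smul_const (pr i)).1
  · refine Filter.Eventually.of_forall fun u z hz => ?_
    simp only [hF']
    refine (norm_sum_le _ _).trans ?_
    rw [Finset.sum_mul, Finset.sum_mul]
    refine Finset.sum_le_sum fun i _ => ?_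
    rw [norm_smul, Real.norm_eq_abs, abs_mul, abs_of_pos Real.two_pi_pos]
    have h1 := Real.exp_le_exp.2 (neg_pi_dist_le (L z) u (R := R) (hLR z hz))
    rw [Real.exp_add] at h1
    have h2 : |u i - L z i| ≤ Real.exp R * Real.exp (∑ i, |u i|) := by
      rw [← Real.exp_add]
      have h3 := Finset.single_le_sum (f := fun i => |u i|) (fun j _ => abs_nonneg (u j))
        (Finset.mem_univ i)
      have h4 := Real.add_one_le_exp (R + ∑ i, |u i|)
      have h5 := abs_sub (u i) (L z i)
      have h6 := hLR z hz i
      linarith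
    have h7 : Real.exp (-Real.pi * ((L z - u) ⬝ᵥ (L z - u))) * (u i * h u) -
      L z i * (Real.exp (-Real.pi * ((L z - u) ⬝ᵥ (L z - u))) * h u) =
      Real.exp (-Real.pi * ((L z - u) ⬝ᵥ (L z - u))) * (h u * (u i - L z i)) := by ring
    rw [h7, abs_mul, abs_mul, Real.abs_exp]
    calc 2 * Real.pi * (Real.exp (-Real.pi * ((L z - u) ⬝ᵥ (L z - u))) *
          (|h u| * |u i - L z i|)) * ‖pr i‖
        ≤ 2 * Real.pi * ((Real.exp (Real.pi * (Fintype.card ι * R ^ 2)) *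
          Real.exp (-(Real.pi / 2) * ∑ i, u i ^ 2)) * ((C * Real.exp (A * ∑ i, |u i|)) *
            (Real.exp R * Real.exp (∑ i, |u i|)))) * ‖pr i‖ := by
          gcongr
          exact hb u
      _ = _ := by rw [add_mul, one_mul, Real.exp_add, Real.exp_add]; ring
  · exact (integrable_exp_neg_sq_add_abs (half_pos Real.pi_pos) _).const_mul _
  · refine Filter.Eventually.of_forall fun u z hz => ?_
    have hL : ∀ i, HasFDerivAt (fun z => L z i) (pr i) z := fun i => (pr i).hasFDerivAt
    have h1 : HasFDerivAt (fun z => (L z - u) ⬝ᵥ (L z - u))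
        (∑ i, (2 * (L z i - u i)) • pr i) z := by
      unfold dotProduct
      refine HasFDerivAt.fun_sum fun i _ => ?_
      have h2 := ((hL i).sub_const (u i)).mul ((hL i).sub_const (u i))
      refine h2.congr_fderiv ?_
      ext v
      simp
      ring
    have h3 := ((h1.const_mul (-Real.pi)).exp).mul_const (h u)
    refine h3.congr_fderiv ?_
    ext v
    simp only [hF', smul_apply, sum_apply, smul_eq_mul,
      Finset.mul_sum]
    refine Finset.sum_congr rfl fun i _ => ?_
    ring

/-- The span of the products of a function of temperate growth and of a Gaussian average of a
function that vanishes on `Ω`. -/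
def gaussSpan (L : E →L[ℝ] (ι → ℝ)) (Ω : Set (ι → ℝ)) : Submodule ℝ (E → ℝ) :=
  Submodule.span ℝ {F | ∃ (a : E → ℝ) (h : (ι → ℝ) → ℝ), a.HasTemperateGrowth ∧ ExpGrowth Ω h ∧
    F = fun x => a x * gaussAvg L h x}

theorem differentiable_of_mem_gaussSpan {L : E →L[ℝ] (ι → ℝ)} {Ω : Set (ι → ℝ)} {F : E → ℝ}
    (hF : F ∈ gaussSpan L Ω) : Differentiable ℝ F := by
  induction hF using Submodule.span_induction with
  | mem F h =>
    obtain ⟨a, h, ha, hh, rfl⟩ := h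
    exact (ha.1.differentiable (by simp)).mul
      fun x => (hasFDerivAt_gaussAvg hh L x).differentiableAt
  | zero => exact differentiable_const 0
  | add F G _ _ h1 h2 => exact h1.add h2
  | smul c F _ h => exact h.const_smul c

/-- The operator `f ↦ ℓ f + ∂_v f / (2π)`. -/
noncomputable def raiseOp (ℓ : E →L[ℝ] ℝ) (v : E) (f : E → ℝ) : E → ℝ :=
  fun x => ℓ x * f x + 1 / (2 * Real.pi) * fderiv ℝ f x v

theorem raiseOp_add (ℓ : E →L[ℝ] ℝ) (v : E) {f g : E → ℝ} (hf : Differentiable ℝ f)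
    (hg : Differentiable ℝ g) : raiseOp ℓ v (f + g) = raiseOp ℓ v f + raiseOp ℓ v g := by
  ext x
  simp only [raiseOp, Pi.add_apply]
  rw [fderiv_add (hf x) (hg x), add_apply]
  ring

theorem raiseOp_smul (ℓ : E →L[ℝ] ℝ) (v : E) {f : E → ℝ} (hf : Differentiable ℝ f) (c : ℝ) :
    raiseOp ℓ v (c • f) = c • raiseOp ℓ v f := by
  ext x
  simp only [raiseOp, Pi.smul_apply, smul_eq_mul]
  rw [fderiv_const_smul (hf x), smul_apply, smul_eq_mul]
  ring

theorem hasTemperateGrowth_fderiv_apply {a : E → ℝ} (ha : a.HasTemperateGrowth) (v : E) :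
    (fun x => fderiv ℝ a x v).HasTemperateGrowth := by
  have h1 : (fderiv ℝ a).HasTemperateGrowth := by
    refine ⟨ha.1.fderiv_right (by simp), fun n => ?_⟩
    obtain ⟨k, C, h⟩ := ha.2 (n + 1)
    exact ⟨k, C, fun x => by rw [norm_iteratedFDeriv_fderiv]; exact h x⟩
  exact (ContinuousLinearMap.apply ℝ ℝ v).hasTemperateGrowth.comp h1

theorem raiseOp_hasTemperateGrowth (ℓ : E →L[ℝ] ℝ) (v : E) {a : E → ℝ}
    (ha : a.HasTemperateGrowth) : (raiseOp ℓ v a).HasTemperateGrowth := by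
  have h1 := hasTemperateGrowth_fderiv_apply ha v
  unfold raiseOp
  have h2 := ℓ.hasTemperateGrowth
  fun_prop

/-- By the product rule, either the temperate coefficient is raised, or the kernel is
differentiated, where 1/(2π) cancels the 2π. The new factors `L x i` are temperate and the new
functions u_i h still vanish on `Ω`, so any number of operators may be applied. -/
theorem raiseOp_mem_gaussSpan {L : E →L[ℝ] (ι → ℝ)} {Ω : Set (ι → ℝ)} (ℓ : E →L[ℝ] ℝ) (v : E)
    {F : E → ℝ} (hF : F ∈ gaussSpan L Ω) : raiseOp ℓ v F ∈ gaussSpan L Ω := by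
  induction hF using Submodule.span_induction with
  | mem F h =>
    obtain ⟨a, h, ha, hh, rfl⟩ := h
    have key : raiseOp ℓ v (fun x => a x * gaussAvg L h x) =
        (fun x => raiseOp ℓ v a x * gaussAvg L h x) +
        ∑ i, ((L v i) • (fun x => a x * gaussAvg L (fun u => u i * h u) x) +
          (- L v i) • (fun x => (a x * L x i) * gaussAvg L h x)) := by
      ext x
      have h1 := (hasFDerivAt_gaussAvg hh L x)
      have h2 := (ha.1.differentiable (by simp) x).hasFDerivAt.mul h1
      simp only [raiseOp, Pi.add_apply, Finset.sum_apply, Pi.smul_apply, smul_eq_mul]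
      erw [h2.fderiv]
      simp only [add_apply, smul_apply, sum_apply, smul_eq_mul, ContinuousLinearMap.comp_apply,
        ContinuousLinearMap.proj_apply]
      have h3 : ∑ i, (2 * Real.pi * (gaussAvg L (fun u => u i * h u) x -
          L x i * gaussAvg L h x)) * L v i = 2 * Real.pi *
          ∑ i, (gaussAvg L (fun u => u i * h u) x - L x i * gaussAvg L h x) * L v i := by
        rw [Finset.mul_sum]
        exact Finset.sum_congr rfl fun i _ => by ring
      have h4 : ∑ i, (L v i * (a x * gaussAvg L (fun u => u i * h u) x) +
          -L v i * (a x * L x i * gaussAvg L h x)) = a x *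
          ∑ i, (gaussAvg L (fun u => u i * h u) x - L x i * gaussAvg L h x) * L v i := by
        rw [Finset.mul_sum]
        exact Finset.sum_congr rfl fun i _ => by ring
      rw [h3, h4]
      have := Real.pi_ne_zero
      field_simp
      ring
    rw [key]
    refine add_mem (Submodule.subset_span ⟨_, h, raiseOp_hasTemperateGrowth ℓ v ha, hh, rfl⟩)
      (sum_mem fun i _ => add_mem (Submodule.smul_mem _ _ (Submodule.subset_span
        ⟨_, _, ha, hh.coord_mul i, rfl⟩)) (Submodule.smul_mem _ _ (Submodule.subset_span
        ⟨_, h, ?_, hh, rfl⟩)))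
    have h2 := (ContinuousLinearMap.proj i ∘L L : E →L[ℝ] ℝ).hasTemperateGrowth
    exact ha.mul h2
  | zero =>
    have : raiseOp ℓ v (0 : E → ℝ) = 0 := by
      ext x
      simp [raiseOp]
    rw [this]
    exact zero_mem _
  | add F G hF hG h1 h2 =>
    rw [raiseOp_add ℓ v (differentiable_of_mem_gaussSpan hF) (differentiable_of_mem_gaussSpan hG)]
    exact add_mem h1 h2
  | smul c F hF h =>
    rw [raiseOp_smul ℓ v (differentiable_of_mem_gaussSpan hF)]
    exact Submodule.smul_mem _ c h

/-- Only the `u` outside `Ω` contribute, and these are at distance at least c‖x‖ from Lx. Half of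
the exponent pays for this distance, the other half keeps the integral finite; the growth of `h`
around Lx costs only exp(B‖x‖). -/
theorem abs_gaussAvg_le {L : E →L[ℝ] (ι → ℝ)} {Ω : Set (ι → ℝ)} {h : (ι → ℝ) → ℝ}
    (hh : ExpGrowth Ω h) {c : ℝ} (hc : 0 ≤ c) :
    ∃ K B : ℝ, 0 ≤ K ∧ ∀ x, (∀ u ∉ Ω, c * ‖x‖ ≤ ‖L x - u‖) →
      |gaussAvg L h x| ≤ K * Real.exp (B * ‖x‖ - Real.pi / 2 * c ^ 2 * ‖x‖ ^ 2) := by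
  obtain ⟨hm, h0, C, A, hA, hb⟩ := id hh
  have hC : 0 ≤ C := by
    have := hb 0
    simp at this
    exact (abs_nonneg _).trans this
  set J : ℝ := ∫ z : ι → ℝ, Real.exp (-(Real.pi / 2) * ∑ i, z i ^ 2 + A * ∑ i, |z i|) with hJ
  have hJ0 : 0 ≤ J := integral_nonneg fun _ => (Real.exp_pos _).le
  refine ⟨C * J, A * (Fintype.card ι * ‖L‖), by positivity, fun x hx => ?_⟩
  have hi := integrable_exp_neg_sq_add_abs (ι := ι) (half_pos Real.pi_pos) A
  have hi2 := (hi.comp_sub_left (L x)).const_mul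
    (C * Real.exp (A * (Fintype.card ι * ‖L‖) * ‖x‖ - Real.pi / 2 * c ^ 2 * ‖x‖ ^ 2))
  have hle := norm_integral_le_of_norm_le hi2 (f := fun u : ι → ℝ =>
    Real.exp (-Real.pi * ((L x - u) ⬝ᵥ (L x - u))) * h u)
    (Filter.Eventually.of_forall fun u => ?_)
  · rw [integral_const_mul, integral_sub_left_eq_self
      (fun z : ι → ℝ => Real.exp (-(Real.pi / 2) * ∑ i, z i ^ 2 + A * ∑ i, |z i|))] at hle
    refine hle.trans (le_of_eq ?_)
    ring
  · by_cases hu : u ∈ Ω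
    · rw [h0 u hu]
      simp only [mul_zero, norm_zero]
      positivity
    · rw [Real.norm_eq_abs, abs_mul, Real.abs_exp]
      have h1 : (L x - u) ⬝ᵥ (L x - u) = ∑ i, (L x - u) i ^ 2 := by
        simp [dotProduct, sq]
      have h2 : (c * ‖x‖) ^ 2 ≤ ∑ i, (L x - u) i ^ 2 := by
        refine (pow_le_pow_left₀ (by positivity) (hx u hu) 2).trans ?_
        have h3 : ‖L x - u‖ ≤ Real.sqrt (∑ i, (L x - u) i ^ 2) := by
          refine (pi_norm_le_iff_of_nonneg (Real.sqrt_nonneg _)).2 fun i => ?_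
          rw [Real.norm_eq_abs]
          refine Real.abs_le_sqrt ?_
          exact Finset.single_le_sum (f := fun i => (L x - u) i ^ 2) (fun j _ => sq_nonneg _)
            (Finset.mem_univ i)
        calc _ ≤ Real.sqrt (∑ i, (L x - u) i ^ 2) ^ 2 := by gcongr
          _ = _ := Real.sq_sqrt (Finset.sum_nonneg fun i _ => sq_nonneg _)
      have h4 : ∑ i, |u i| ≤ ∑ i, |(L x - u) i| + Fintype.card ι * ‖L‖ * ‖x‖ := by
        have : (Fintype.card ι * ‖L‖ * ‖x‖ : ℝ) = ∑ _i : ι, ‖L‖ * ‖x‖ := by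
          simp [mul_assoc]
        rw [this, ← Finset.sum_add_distrib]
        refine Finset.sum_le_sum fun i _ => ?_
        have h5 : |L x i| ≤ ‖L‖ * ‖x‖ := (norm_le_pi_norm (L x) i).trans (L.le_opNorm x)
        have h6 := abs_sub (L x i) (L x i - u i)
        simp only [sub_sub_cancel] at h6
        simp only [Pi.sub_apply]
        linarith
      calc _ ≤ Real.exp (-Real.pi * ((L x - u) ⬝ᵥ (L x - u))) *
            (C * Real.exp (A * ∑ i, |u i|)) := by gcongr; exact hb u
        _ = C * Real.exp (-Real.pi * (∑ i, (L x - u) i ^ 2) + A * ∑ i, |u i|) := by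
          rw [h1, Real.exp_add]; ring
        _ ≤ C * Real.exp ((A * (Fintype.card ι * ‖L‖) * ‖x‖ - Real.pi / 2 * c ^ 2 * ‖x‖ ^ 2) +
            (-(Real.pi / 2) * ∑ i, (L x - u) i ^ 2 + A * ∑ i, |(L x - u) i|)) := by
          refine mul_le_mul_of_nonneg_left (Real.exp_le_exp.2 ?_) hC
          have h7 := mul_le_mul_of_nonneg_left h4 hA
          have h8 := mul_le_mul_of_nonneg_left h2 (half_pos Real.pi_pos).le
          nlinarith
        _ = _ := by rw [Real.exp_add]; ring

theorem tendsto_exp_sub_sq (B : ℝ) {d : ℝ} (hd : 0 < d) :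
    Filter.Tendsto (fun r : ℝ => Real.exp (B * r - d * r ^ 2)) Filter.atTop (nhds 0) := by
  refine Real.tendsto_exp_atBot.comp ?_
  have h1 : Filter.Tendsto (fun r : ℝ => B + -(d * r)) Filter.atTop Filter.atBot :=
    Filter.tendsto_atBot_add_const_left _ _
      (Filter.tendsto_neg_atTop_atBot.comp (Filter.tendsto_id.const_mul_atTop hd))
  refine (Filter.tendsto_id.atTop_mul_atBot₀ h1).congr fun r => ?_
  simp only [id]
  ring

/-- The polynomial bound on the temperate coefficient is absorbed in exp(k‖x‖), which loses against
the Gaussian decay. -/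
theorem tendsto_of_mem_gaussSpan {L : E →L[ℝ] (ι → ℝ)} {Ω : Set (ι → ℝ)} {F : E → ℝ}
    (hF : F ∈ gaussSpan L Ω) {S : Set E} {c : ℝ} (hc : 0 < c)
    (hS : ∀ x ∈ S, ∀ u ∉ Ω, c * ‖x‖ ≤ ‖L x - u‖) :
    Filter.Tendsto F (Bornology.cobounded E ⊓ Filter.principal S) (nhds 0) := by
  induction hF using Submodule.span_induction with
  | mem F h =>
    obtain ⟨a, h, ha, hh, rfl⟩ := h
    obtain ⟨K, B, hK, hb⟩ := abs_gaussAvg_le (L := L) hh hc.le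
    obtain ⟨k, C, ha2⟩ := ha.2 0
    simp only [norm_iteratedFDeriv_zero, Real.norm_eq_abs] at ha2
    have ht := (((tendsto_exp_sub_sq (B + k) (d := Real.pi / 2 * c ^ 2) (by positivity)).comp
      tendsto_norm_cobounded_atTop).mono_left
      (inf_le_left : Bornology.cobounded E ⊓ Filter.principal S ≤ _)).const_mul (C * K)
    rw [mul_zero] at ht
    refine squeeze_zero_norm' ?_ ht
    rw [Filter.eventually_inf_principal]
    refine Filter.Eventually.of_forall fun x hx => ?_
    rw [Real.norm_eq_abs, abs_mul]
    have hC : 0 ≤ C := by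
      have := ha2 0
      simp at this
      exact (abs_nonneg _).trans this
    have h1 : (1 + ‖x‖) ^ k ≤ Real.exp (k * ‖x‖) := by
      rw [Real.exp_nat_mul]
      gcongr
      linarith [Real.add_one_le_exp ‖x‖]
    calc |a x| * |gaussAvg L h x| ≤ (C * (1 + ‖x‖) ^ k) *
          (K * Real.exp (B * ‖x‖ - Real.pi / 2 * c ^ 2 * ‖x‖ ^ 2)) := by
          gcongr
          · exact ha2 x
          · exact hb x (hS x hx)
      _ ≤ (C * Real.exp (k * ‖x‖)) *
          (K * Real.exp (B * ‖x‖ - Real.pi / 2 * c ^ 2 * ‖x‖ ^ 2)) := by gcongr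
      _ = C * K * (Real.exp (k * ‖x‖) *
          Real.exp (B * ‖x‖ - Real.pi / 2 * c ^ 2 * ‖x‖ ^ 2)) := by ring
      _ = _ := by
          rw [← Real.exp_add]
          simp only [Function.comp_apply]
          congr 2
          ring
  | zero => exact tendsto_const_nhds
  | add F G _ _ h1 h2 => rw [← add_zero (0 : ℝ)]; exact h1.add h2
  | smul r F _ h => rw [← smul_zero r]; exact h.const_smul r

end Gaussian

end BPSTree

namespace BPSTree

/-! ### Generalized error functions far from the walls. -/

section BoostedLimit

open MeasureTheory

theorem real_sign_eq_coe (r : ℝ) : Real.sign r = (SignType.sign r : ℝ) := by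
  rcases lt_trichotomy r 0 with h | h | h
  · simp [Real.sign_of_neg h, sign_neg h]
  · simp [h]
  · simp [Real.sign_of_pos h, sign_pos h]

theorem measurable_real_sign : Measurable Real.sign := by
  have : Real.sign = fun r => if r < 0 then -1 else if 0 < r then 1 else 0 := by
    ext r; rfl
  rw [this]
  exact Measurable.ite measurableSet_Iio measurable_const
    (Measurable.ite measurableSet_Ioi measurable_const measurable_const)

theorem abs_real_sign_le (r : ℝ) : |Real.sign r| ≤ 1 := by
  rcases Real.sign_apply_eq r with h | h | h <;> simp [h]

variable {ι : Type} [Fintype ι] {E : Type} [NormedAddCommGroup E] [NormedSpace ℝ E]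

theorem integral_gauss_eq_one (y : ι → ℝ) :
    ∫ u : ι → ℝ, Real.exp (-Real.pi * ((y - u) ⬝ᵥ (y - u))) = 1 := by
  rw [integral_sub_left_eq_self (fun z : ι → ℝ => Real.exp (-Real.pi * (z ⬝ᵥ z)))]
  have h : ∀ z : ι → ℝ, Real.exp (-Real.pi * (z ⬝ᵥ z)) = ∏ i, Real.exp (-Real.pi * z i ^ 2) := by
    intro z
    rw [← Real.exp_sum, ← Finset.mul_sum]
    simp [dotProduct, sq]
  simp_rw [h]
  rw [integral_fintype_prod_volume_eq_prod (fun _ : ι => fun r : ℝ => Real.exp (-Real.pi * r ^ 2))]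
  refine Finset.prod_eq_one fun i _ => ?_
  rw [integral_gaussian, div_self Real.pi_ne_zero, Real.sqrt_one]

/-- The vectors on which the linear forms given by the columns of `M` have the signs `σ`. -/
def signCell (M : Matrix ι ι ℝ) (σ : ι → SignType) : Set (ι → ℝ) :=
  {u | ∀ j, SignType.sign ((Mᵀ *ᵥ u) j) = σ j}

theorem expGrowth_sign_sub (M : Matrix ι ι ℝ) (σ : ι → SignType) :
    ExpGrowth (signCell M σ) fun u => ∏ i, Real.sign ((Mᵀ *ᵥ u) i) - ∏ i, (σ i : ℝ) := by
  refine ⟨?_, fun u hu => ?_, 2, 0, le_rfl, fun u => ?_⟩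
  · refine Measurable.sub_const (Finset.measurable_prod _ fun i _ =>
      measurable_real_sign.comp ?_) _
    unfold Matrix.mulVec dotProduct
    fun_prop
  · have hu' : ∀ i, SignType.sign ((Mᵀ *ᵥ u) i) = σ i := hu
    simp only [real_sign_eq_coe, hu', sub_self]
  · have h1 : ∀ f : ι → ℝ, |∏ i, Real.sign (f i)| ≤ 1 := fun f => by
      rw [Finset.abs_prod]
      exact Finset.prod_le_one (fun _ _ => abs_nonneg _) fun i _ => abs_real_sign_le _
    have h2 : |∏ i, (σ i : ℝ)| ≤ 1 := by
      rw [Finset.abs_prod]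
      refine Finset.prod_le_one (fun _ _ => abs_nonneg _) fun i _ => ?_
      rcases σ i with _ | _ | _ <;> simp
    have := abs_sub (∏ i, Real.sign ((Mᵀ *ᵥ u) i)) (∏ i, (σ i : ℝ))
    simp only [zero_mul, Real.exp_zero, mul_one]
    linarith [h1 fun i => (Mᵀ *ᵥ u) i]

/-- As the Gaussian has mass one, any constant can be split off. The identity holds for every sign
pattern `σ`, but the remainder is small only where `L x` lies in the cell of `σ`. -/
theorem genErr_eq_add (M : Matrix ι ι ℝ) (L : E →L[ℝ] (ι → ℝ)) (σ : ι → SignType) :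
    (fun x => genErr M (L x)) = (fun _ => ∏ i, (σ i : ℝ)) +
      gaussAvg L fun u => ∏ i, Real.sign ((Mᵀ *ᵥ u) i) - ∏ i, (σ i : ℝ) := by
  ext x
  have hint := integrable_gauss_mul (expGrowth_sign_sub M σ) (L x)
  have h1 : Integrable fun u : ι → ℝ => Real.exp (-Real.pi * ((L x - u) ⬝ᵥ (L x - u))) := by
    have h : ExpGrowth (∅ : Set (ι → ℝ)) fun _ => 1 :=
      ⟨measurable_const, by simp, 1, 0, le_rfl, by simp⟩
    simpa using integrable_gauss_mul h (L x)
  have h2 : ∏ i, (σ i : ℝ) = ∫ u : ι → ℝ, (∏ i, (σ i : ℝ)) *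
      Real.exp (-Real.pi * ((L x - u) ⬝ᵥ (L x - u))) := by
    rw [integral_const_mul, integral_gauss_eq_one, mul_one]
  have h3 : genErr M (L x) = ∫ u : ι → ℝ, ((∏ i, (σ i : ℝ)) *
      Real.exp (-Real.pi * ((L x - u) ⬝ᵥ (L x - u))) +
      Real.exp (-Real.pi * ((L x - u) ⬝ᵥ (L x - u))) *
        (∏ i, Real.sign ((Mᵀ *ᵥ u) i) - ∏ i, (σ i : ℝ))) := by
    unfold genErr
    congr 1
    ext u
    ring
  rw [h3, integral_add (h1.const_mul _) hint, ← h2]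
  rfl

theorem foldr_raiseOp_hasTemperateGrowth {α : Type} (l : List α) (ℓ : α → E →L[ℝ] ℝ) (w : α → E)
    {a : E → ℝ} (ha : a.HasTemperateGrowth) :
    (l.foldr (fun e f => raiseOp (ℓ e) (w e) f) a).HasTemperateGrowth := by
  induction l with
  | nil => exact ha
  | cons e l ih => exact raiseOp_hasTemperateGrowth _ _ ih

theorem foldr_raiseOp_mem {α : Type} (l : List α) (ℓ : α → E →L[ℝ] ℝ) (w : α → E)
    {L : E →L[ℝ] (ι → ℝ)} {Ω : Set (ι → ℝ)} {F : E → ℝ} (hF : F ∈ gaussSpan L Ω) :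
    l.foldr (fun e f => raiseOp (ℓ e) (w e) f) F ∈ gaussSpan L Ω := by
  induction l with
  | nil => exact hF
  | cons e l ih => exact raiseOp_mem_gaussSpan _ _ ih

theorem foldr_raiseOp_add {α : Type} (l : List α) (ℓ : α → E →L[ℝ] ℝ) (w : α → E)
    {L : E →L[ℝ] (ι → ℝ)} {Ω : Set (ι → ℝ)} {a F : E → ℝ} (ha : a.HasTemperateGrowth)
    (hF : F ∈ gaussSpan L Ω) :
    l.foldr (fun e f => raiseOp (ℓ e) (w e) f) (a + F) =
      l.foldr (fun e f => raiseOp (ℓ e) (w e) f) a +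
        l.foldr (fun e f => raiseOp (ℓ e) (w e) f) F := by
  induction l with
  | nil => rfl
  | cons e l ih =>
    simp only [List.foldr_cons]
    rw [ih, raiseOp_add _ _ ((foldr_raiseOp_hasTemperateGrowth l ℓ w ha).1.differentiable (by simp))
      (differentiable_of_mem_gaussSpan (foldr_raiseOp_mem l ℓ w hF))]

theorem foldr_raiseOp_smul {α : Type} (l : List α) (ℓ : α → E →L[ℝ] ℝ) (w : α → E)
    {a : E → ℝ} (ha : a.HasTemperateGrowth) (c : ℝ) :
    l.foldr (fun e f => raiseOp (ℓ e) (w e) f) (c • a) =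
      c • l.foldr (fun e f => raiseOp (ℓ e) (w e) f) a := by
  induction l with
  | nil => rfl
  | cons e l ih =>
    simp only [List.foldr_cons]
    rw [ih, raiseOp_smul _ _ ((foldr_raiseOp_hasTemperateGrowth l ℓ w ha).1.differentiable
      (by simp))]

/-- A path from a to a number of another sign passes through zero. This bounds from below the
distance of a point to the complement of its sign cell. -/
theorem abs_le_abs_sub_of_sign_ne {a b : ℝ} (h : SignType.sign b ≠ SignType.sign a) :
    |a| ≤ |a - b| := by
  rcases lt_trichotomy a 0 with ha | ha | ha
  · have hb : 0 ≤ b := by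
      by_contra hb
      exact h (by rw [sign_neg ha, sign_neg (not_le.1 hb)])
    rw [abs_of_neg ha, abs_of_neg (by linarith)]
    linarith
  · simp [ha]
  · have hb : b ≤ 0 := by
      by_contra hb
      exact h (by rw [sign_pos ha, sign_pos (not_le.1 hb)])
    rw [abs_of_pos ha, abs_of_pos (by linarith)]
    linarith

/-- For each of the finitely many sign patterns the constant is split off and the remainder decays
on the part of `S` with that pattern; a point of `S` then uses its own pattern. -/
theorem tendsto_foldr_raiseOp_genErr {α : Type} (l : List α) (ℓ : α → E →L[ℝ] ℝ) (w : α → E)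
    (M : Matrix ι ι ℝ) (L : E →L[ℝ] (ι → ℝ)) {S : Set E} {ε : ℝ} (hε : 0 < ε)
    (hS : ∀ x ∈ S, ∀ j, ε * ‖x‖ ≤ |(Mᵀ *ᵥ L x) j|) :
    Filter.Tendsto (fun x => l.foldr (fun e f => raiseOp (ℓ e) (w e) f)
        (fun x => genErr M (L x)) x -
          (∏ j, Real.sign ((Mᵀ *ᵥ L x) j)) *
            l.foldr (fun e f => raiseOp (ℓ e) (w e) f) (fun _ => 1) x)
      (Bornology.cobounded E ⊓ Filter.principal S) (nhds 0) := by
  obtain ⟨D, hD⟩ : ∃ D : (E → ℝ) → E → ℝ, ∀ f,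
      l.foldr (fun e f => raiseOp (ℓ e) (w e) f) f = D f := ⟨_, fun _ => rfl⟩
  simp only [hD]
  set G : (ι → SignType) → E → ℝ := fun σ =>
    gaussAvg L fun u => ∏ i, Real.sign ((Mᵀ *ᵥ u) i) - ∏ i, (σ i : ℝ) with hG
  have hGm : ∀ σ, G σ ∈ gaussSpan L (signCell M σ) := fun σ =>
    Submodule.subset_span ⟨fun _ => 1, _, .const 1, expGrowth_sign_sub M σ, by simp [hG]⟩
  have hDσ : ∀ σ x, D (fun x => genErr M (L x)) x = (∏ i, (σ i : ℝ)) * D (fun _ => 1) x +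
      D (G σ) x := by
    intro σ x
    rw [genErr_eq_add M L σ, ← hD, foldr_raiseOp_add l ℓ w (.const _) (hGm σ)]
    have : (fun _ : E => ∏ i, (σ i : ℝ)) = (∏ i, (σ i : ℝ)) • fun _ => (1 : ℝ) := by
      ext; simp
    rw [this, foldr_raiseOp_smul l ℓ w (.const _), hD, hD]
    rfl
  -- A Lipschitz constant for all the linear forms of `M`; the summand 1 keeps it positive even when
  -- `M` vanishes or `ι` is empty.
  set C : ℝ := 1 + ∑ j, ∑ i, |M i j| with hC
  have hC0 : 0 < C := by positivity
  have hdecay : ∀ σ, Filter.Tendsto (D (G σ)) (Bornology.cobounded E ⊓ Filter.principal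
      {x | x ∈ S ∧ L x ∈ signCell M σ}) (nhds 0) := by
    intro σ
    refine tendsto_of_mem_gaussSpan (hD (G σ) ▸ foldr_raiseOp_mem l ℓ w (hGm σ)) (div_pos hε hC0) ?_
    rintro x ⟨hxS, hxσ⟩ u hu
    obtain ⟨j, hj⟩ : ∃ j, SignType.sign ((Mᵀ *ᵥ u) j) ≠ σ j := by
      by_contra h
      push Not at h
      exact hu h
    have hxj : SignType.sign ((Mᵀ *ᵥ L x) j) = σ j := hxσ j
    rw [← hxj] at hj
    have h1 := (hS x hxS j).trans (abs_le_abs_sub_of_sign_ne hj)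
    have h2 : |(Mᵀ *ᵥ L x) j - (Mᵀ *ᵥ u) j| ≤ C * ‖L x - u‖ := by
      rw [← Pi.sub_apply, ← Matrix.mulVec_sub]
      simp only [Matrix.mulVec, dotProduct, Matrix.transpose_apply]
      refine (Finset.abs_sum_le_sum_abs _ _).trans ?_
      calc ∑ i, |M i j * (L x - u) i| ≤ ∑ i, |M i j| * ‖L x - u‖ := by
            refine Finset.sum_le_sum fun i _ => ?_
            rw [abs_mul]
            exact mul_le_mul_of_nonneg_left (norm_le_pi_norm (L x - u) i) (abs_nonneg _)
        _ = (∑ i, |M i j|) * ‖L x - u‖ := (Finset.sum_mul _ _ _).symm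
        _ ≤ C * ‖L x - u‖ := by
            gcongr
            have := Finset.single_le_sum (f := fun j => ∑ i, |M i j|)
              (fun j _ => Finset.sum_nonneg fun i _ => abs_nonneg _) (Finset.mem_univ j)
            linarith
    rw [div_mul_eq_mul_div, div_le_iff₀ hC0]
    linarith
  rw [Metric.tendsto_nhds]
  intro η hη
  have hall : ∀ᶠ x in Bornology.cobounded E, ∀ σ : ι → SignType,
      (x ∈ S ∧ L x ∈ signCell M σ) → dist (D (G σ) x) 0 < η := by
    classical
    rw [Filter.eventually_all]
    intro σ
    have := (Metric.tendsto_nhds.1 (hdecay σ)) η hη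
    rwa [Filter.eventually_inf_principal] at this
  rw [Filter.eventually_inf_principal]
  filter_upwards [hall] with x hx hxS
  have h3 := hx (fun j => SignType.sign ((Mᵀ *ᵥ L x) j)) ⟨hxS, fun j => rfl⟩
  have h4 := hDσ (fun j => SignType.sign ((Mᵀ *ᵥ L x) j)) x
  simp only [real_sign_eq_coe]
  rw [h4]
  simpa using h3

end BoostedLimit

end BPSTree

namespace BPSTree

/-! ### The form x·y, its positive part along t, and the limit of an uplifted error function. -/

section Forms

variable {n b : ℕ} {κ : Fin b → Fin b → Fin b → ℝ}

theorem cubic_add_left (k k' l r : Fin b → ℝ) :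
    cubic κ (k + k') l r = cubic κ k l r + cubic κ k' l r := by
  simp only [cubic, ← Finset.sum_add_distrib, Pi.add_apply]
  exact Finset.sum_congr rfl fun a _ => Finset.sum_congr rfl fun c _ =>
    Finset.sum_congr rfl fun d _ => by ring

theorem cubic_smul_left (s : ℝ) (k l r : Fin b → ℝ) :
    cubic κ (s • k) l r = s * cubic κ k l r := by
  simp only [cubic, Finset.mul_sum, Pi.smul_apply, smul_eq_mul]
  exact Finset.sum_congr rfl fun a _ => Finset.sum_congr rfl fun c _ =>
    Finset.sum_congr rfl fun d _ => by ring

theorem cubic_swap_left (hκ : IsSymmetricCubic κ) (k l r : Fin b → ℝ) :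
    cubic κ k l r = cubic κ l k r := by
  simp only [cubic]
  rw [Finset.sum_comm]
  refine Finset.sum_congr rfl fun a _ => Finset.sum_congr rfl fun c _ =>
    Finset.sum_congr rfl fun d _ => ?_
  rw [(hκ c a d).1]
  ring

theorem cubic_swap_right (hκ : IsSymmetricCubic κ) (k l r : Fin b → ℝ) :
    cubic κ k l r = cubic κ k r l := by
  simp only [cubic]
  refine Finset.sum_congr rfl fun a _ => ?_
  rw [Finset.sum_comm]
  refine Finset.sum_congr rfl fun c _ => Finset.sum_congr rfl fun d _ => ?_
  rw [(hκ a d c).2]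
  ring

/-- The cubic form as a linear map in its first argument. -/
def cubicLeft (κ : Fin b → Fin b → Fin b → ℝ) (l r : Fin b → ℝ) : (Fin b → ℝ) →ₗ[ℝ] ℝ where
  toFun k := cubic κ k l r
  map_add' k k' := cubic_add_left k k' l r
  map_smul' s k := cubic_smul_left s k l r

theorem cubic_sum_left {α : Type} (s : Finset α) (f : α → Fin b → ℝ) (l r : Fin b → ℝ) :
    cubic κ (∑ i ∈ s, f i) l r = ∑ i ∈ s, cubic κ (f i) l r :=
  map_sum (cubicLeft κ l r) f s

theorem cubic_sum_mid (hκ : IsSymmetricCubic κ) {α : Type} (s : Finset α) (f : α → Fin b → ℝ)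
    (k r : Fin b → ℝ) : cubic κ k (∑ i ∈ s, f i) r = ∑ i ∈ s, cubic κ k (f i) r := by
  simp only [cubic_swap_left hκ k, cubic_sum_left]

theorem cubic_sum_right (hκ : IsSymmetricCubic κ) {α : Type} (s : Finset α) (f : α → Fin b → ℝ)
    (k l : Fin b → ℝ) : cubic κ k l (∑ i ∈ s, f i) = ∑ i ∈ s, cubic κ k l (f i) := by
  simp only [cubic_swap_right hκ k l, cubic_sum_mid hκ]

theorem cubic_add_mid (hκ : IsSymmetricCubic κ) (k l l' r : Fin b → ℝ) :
    cubic κ k (l + l') r = cubic κ k l r + cubic κ k l' r := by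
  simp only [cubic_swap_left hκ k, cubic_add_left]

theorem cubic_smul_mid (hκ : IsSymmetricCubic κ) (s : ℝ) (k l r : Fin b → ℝ) :
    cubic κ k (s • l) r = s * cubic κ k l r := by
  simp only [cubic_swap_left hκ k, cubic_smul_left]

theorem cubic_add_right (hκ : IsSymmetricCubic κ) (k l r r' : Fin b → ℝ) :
    cubic κ k l (r + r') = cubic κ k l r + cubic κ k l r' := by
  simp only [cubic_swap_right hκ k l, cubic_add_mid hκ]

theorem cubic_smul_right (hκ : IsSymmetricCubic κ) (s : ℝ) (k l r : Fin b → ℝ) :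
    cubic κ k l (s • r) = s * cubic κ k l r := by
  simp only [cubic_swap_right hκ k l, cubic_smul_mid hκ]

theorem bilin_comm (hκ : IsSymmetricCubic κ) (p : Fin n → Fin b → ℝ) (x y : Space n b) :
    bilin κ p x y = bilin κ p y x :=
  Finset.sum_congr rfl fun _ _ => cubic_swap_right hκ _ _ _

/-- The form `x · y` as a bilinear map. -/
def bilinMap (hκ : IsSymmetricCubic κ) (p : Fin n → Fin b → ℝ) :
    Space n b →ₗ[ℝ] Space n b →ₗ[ℝ] ℝ :=
  LinearMap.mk₂ ℝ (bilin κ p)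
    (fun x x' y => by
      simp only [bilin, Pi.add_apply, cubic_add_mid hκ, Finset.sum_add_distrib])
    (fun s x y => by
      simp only [bilin, Pi.smul_apply, cubic_smul_mid hκ, Finset.mul_sum, smul_eq_mul])
    (fun x y y' => by
      simp only [bilin, Pi.add_apply, cubic_add_right hκ, Finset.sum_add_distrib])
    (fun s x y => by
      simp only [bilin, Pi.smul_apply, cubic_smul_right hκ, Finset.mul_sum, smul_eq_mul])

@[simp]
theorem bilinMap_apply (hκ : IsSymmetricCubic κ) (p : Fin n → Fin b → ℝ) (x y : Space n b) :
    bilinMap hκ p x y = bilin κ p x y := rfl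

/-- The linear form `x ↦ v · x`. -/
noncomputable def bilinForm (hκ : IsSymmetricCubic κ) (p : Fin n → Fin b → ℝ) (v : Space n b) :
    Space n b →L[ℝ] ℝ :=
  LinearMap.toContinuousLinearMap (bilinMap hκ p v)

@[simp]
theorem bilinForm_apply (hκ : IsSymmetricCubic κ) (p : Fin n → Fin b → ℝ) (x y : Space n b) :
    bilinForm hκ p x y = bilin κ p x y := rfl

theorem covDeriv_eq_raiseOp (hκ : IsSymmetricCubic κ) (p : Fin n → Fin b → ℝ) (v : Space n b) :
    covDeriv κ p v = raiseOp (bilinForm hκ p v) v := rfl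

/-- The isometric embedding of a Euclidean space as the vectors with all components
proportional to `t`. -/
noncomputable def alongMap (κ : Fin b → Fin b → Fin b → ℝ) (p : Fin n → Fin b → ℝ)
    (t : Fin b → ℝ) : EuclideanSpace ℝ (Fin n) →ₗ[ℝ] Space n b where
  toFun y := fun k => (y k / Real.sqrt (cubic κ (p k) t t)) • t
  map_add' y z := by
    ext k a
    simp [add_div, add_mul]
  map_smul' s y := by
    ext k a
    simp [mul_div_assoc, mul_assoc]

theorem bilin_alongMap (hκ : IsSymmetricCubic κ) {p : Fin n → Fin b → ℝ} {t : Fin b → ℝ}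
    (hp : ∀ i, 0 < cubic κ (p i) t t) (y z : EuclideanSpace ℝ (Fin n)) :
    bilin κ p (alongMap κ p t y) (alongMap κ p t z) = inner ℝ y z := by
  rw [PiLp.inner_apply]
  refine Finset.sum_congr rfl fun k _ => ?_
  have h1 := Real.sq_sqrt (hp k).le
  have h2 := Real.sqrt_pos.2 (hp k)
  simp only [alongMap, LinearMap.coe_mk, AddHom.coe_mk, cubic_smul_mid hκ, cubic_smul_right hκ]
  simp only [RCLike.inner_apply, conj_trivial]
  rw [← h1]
  simp only [Real.sqrt_sq h2.le]
  field_simp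

/-- The form may be indefinite on the whole space, but on vectors with all components along t it is
a Euclidean inner product. The basis is taken in `EuclideanSpace` and transported; independence
makes its size the size of `ι`. -/
theorem exists_isOrthonormalBasisOfSpan (hκ : IsSymmetricCubic κ) {p : Fin n → Fin b → ℝ}
    {t : Fin b → ℝ} (hp : ∀ i, 0 < cubic κ (p i) t t) {ι : Type} [Fintype ι]
    {y : ι → EuclideanSpace ℝ (Fin n)} (hy : LinearIndependent ℝ y) {V : ι → Space n b}
    (hV : ∀ e, V e = alongMap κ p t (y e)) :
    ∃ B : ι → Space n b, IsOrthonormalBasisOfSpan (bilin κ p) V B := by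
  classical
  set U := Submodule.span ℝ (Set.range y) with hU
  have hcard : Module.finrank ℝ U = Fintype.card ι := finrank_span_eq_card hy
  set β := (stdOrthonormalBasis ℝ U).reindex ((Fintype.equivFinOfCardEq hcard.symm).symm) with hβ
  have hon := orthonormal_iff_ite.1 β.orthonormal
  have hVr : Set.range V = alongMap κ p t '' Set.range y := by
    rw [← Set.range_comp]
    congr 1
    ext1 e
    exact hV e
  refine ⟨fun e => alongMap κ p t (β e), fun i => ?_, fun i j hij => ?_, ?_⟩
  · rw [bilin_alongMap hκ hp]
    have h := hon i i
    rwa [if_pos rfl] at h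
  · rw [bilin_alongMap hκ hp]
    have h := hon i j
    rwa [if_neg hij] at h
  · have h1 : Submodule.span ℝ (Set.range fun e => (β e : EuclideanSpace ℝ (Fin n))) = U := by
      have h2 := β.toBasis.span_eq
      have h3 := congrArg (Submodule.map U.subtype) h2
      rw [Submodule.map_span, Submodule.map_top, Submodule.range_subtype, ← Set.range_comp] at h3
      refine Eq.trans ?_ h3
      congr 2
    have h4 : Set.range (fun e => alongMap κ p t (β e)) =
        alongMap κ p t '' Set.range fun e => (β e : EuclideanSpace ℝ (Fin n)) := by
      rw [← Set.range_comp]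
      rfl
    rw [h4, ← Submodule.map_span, h1, hVr, ← Submodule.map_span]

/-- Only `v` has to lie in the span: the expansion of `v` in the basis is paired with an arbitrary
`x`, so no definiteness outside the span is needed. -/
theorem bilin_eq_sum_of_mem_span (hκ : IsSymmetricCubic κ) (p : Fin n → Fin b → ℝ)
    {ι : Type} [Fintype ι] {V B : ι → Space n b} (hB : IsOrthonormalBasisOfSpan (bilin κ p) V B)
    {v : Space n b} (hv : v ∈ Submodule.span ℝ (Set.range V)) (x : Space n b) :
    bilin κ p v x = ∑ i, bilin κ p (B i) v * bilin κ p (B i) x := by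
  classical
  rw [← hB.2.2] at hv
  simp only [← bilinMap_apply hκ p]
  induction hv using Submodule.span_induction with
  | mem v h =>
    obtain ⟨j, rfl⟩ := h
    rw [Finset.sum_eq_single j]
    · simp [hB.1 j]
    · intro i _ hij
      simp [hB.2.1 i j hij]
    · simp
  | zero => simp only [map_zero, LinearMap.zero_apply, zero_mul, Finset.sum_const_zero]
  | add v w _ _ h1 h2 => simp only [map_add, LinearMap.add_apply, h1, h2, add_mul,
      Finset.sum_add_distrib]
  | smul c v _ h => simp only [map_smul, h, LinearMap.smul_apply, smul_eq_mul, Finset.mul_sum,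
      mul_assoc]

/-- With M_ij = B_i·V_j and (Lx)_i = B_i·x one has (Mᵀ L x)_j = V_j·x, so the orthonormal basis
chosen in `boostedErr` drops out of the limit. -/
theorem tendsto_upliftedErr (hκ : IsSymmetricCubic κ) (p : Fin n → Fin b → ℝ)
    {ι : Type} [Fintype ι] {V : ι → Space n b} (Vt : ι → Space n b)
    (hV : ∃ B : ι → Space n b, IsOrthonormalBasisOfSpan (bilin κ p) V B)
    {S : Set (Space n b)} {ε : ℝ} (hε : 0 < ε)
    (hS : ∀ x ∈ S, ∀ j, ε * ‖x‖ ≤ |bilin κ p (V j) x|) :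
    Filter.Tendsto (fun x => upliftedErr κ p V Vt x - (∏ j, Real.sign (bilin κ p (V j) x)) *
        (Finset.univ : Finset ι).toList.foldr (fun e f => covDeriv κ p (Vt e) f) (fun _ => 1) x)
      (Bornology.cobounded (Space n b) ⊓ Filter.principal S) (nhds 0) := by
  classical
  set B := hV.choose with hB
  have hBs : IsOrthonormalBasisOfSpan (bilin κ p) V B := hV.choose_spec
  set L : Space n b →L[ℝ] (ι → ℝ) := ContinuousLinearMap.pi fun i => bilinForm hκ p (B i) with hL
  set M : Matrix ι ι ℝ := Matrix.of fun i j => bilin κ p (B i) (V j) with hM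
  have hML : ∀ x j, (Mᵀ *ᵥ L x) j = bilin κ p (V j) x := by
    intro x j
    rw [bilin_eq_sum_of_mem_span hκ p hBs (Submodule.subset_span ⟨j, rfl⟩) x]
    simp [Matrix.mulVec, dotProduct, hM, hL]
  have hE : boostedErr (bilin κ p) V = fun x => genErr M (L x) := by
    ext x
    rw [boostedErr, dif_pos hV]
    rfl
  have := tendsto_foldr_raiseOp_genErr (Finset.univ : Finset ι).toList
    (fun e => bilinForm hκ p (Vt e)) Vt M L hε (S := S) (fun x hx j => by
      rw [hML]; exact hS x hx j)
  simp only [hML] at this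
  simp only [upliftedErr, hE, covDeriv_eq_raiseOp hκ p]
  exact this

end Forms

/-! ### The two sides of an edge of a tree. -/

section Sides

variable {V : Type} {T : SimpleGraph V}

theorem mem_side [Fintype V] {e : Sym2 V} {v w : V} :
    w ∈ side T e v ↔ (T.deleteEdges {e}).Reachable v w := by
  simp [side]

theorem not_reachable_of_isTree (hT : T.IsTree) {i j : V} (h : s(i, j) ∈ T.edgeSet) :
    ¬ (T.deleteEdges {s(i, j)}).Reachable i j := by
  have h1 := SimpleGraph.isAcyclic_iff_forall_isBridge.1 hT.isAcyclic h
  rwa [SimpleGraph.isBridge_iff] at h1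

/-- Follow a walk in `T` from `i`. Whenever it uses the deleted edge it arrives at `i` or `j`, and
the count restarts there. -/
theorem reachable_or_reachable (hT : T.Connected) (i j w : V) :
    (T.deleteEdges {s(i, j)}).Reachable i w ∨ (T.deleteEdges {s(i, j)}).Reachable j w := by
  have h := (SimpleGraph.reachable_iff_reflTransGen _ _).1 (hT.preconnected i w)
  induction h with
  | refl => exact Or.inl (SimpleGraph.Reachable.refl _)
  | @tail w w' _ hw ih =>
    by_cases he : s(w, w') = s(i, j)
    · rcases Sym2.eq_iff.1 he with ⟨_, rfl⟩ | ⟨_, rfl⟩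
      · exact Or.inr (SimpleGraph.Reachable.refl _)
      · exact Or.inl (SimpleGraph.Reachable.refl _)
    · have hadj : (T.deleteEdges {s(i, j)}).Adj w w' := by
        rw [SimpleGraph.deleteEdges_adj]
        exact ⟨hw, by simpa using he⟩
      exact ih.imp (fun h => h.trans hadj.reachable) fun h => h.trans hadj.reachable

theorem side_compl [Fintype V] [DecidableEq V] (hT : T.IsTree) {i j : V} (h : s(i, j) ∈ T.edgeSet) :
    (side T s(i, j) i)ᶜ = side T s(i, j) j := by
  ext w
  rw [Finset.mem_compl, mem_side, mem_side]
  constructor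
  · exact (reachable_or_reachable hT.connected i j w).resolve_left
  · intro h1 h2
    exact not_reachable_of_isTree hT h (h2.trans h1.symm)

theorem mem_side_iff_of_ne [Fintype V] {e : Sym2 V} {i j : V} (h : s(i, j) ∈ T.edgeSet) (he : e ≠ s(i, j))
    (v : V) : i ∈ side T e v ↔ j ∈ side T e v := by
  have hadj : (T.deleteEdges {e}).Adj i j := by
    rw [SimpleGraph.deleteEdges_adj]
    exact ⟨h, fun h' => he (by simpa using h'.symm)⟩
  rw [mem_side, mem_side]
  exact ⟨fun h => h.trans hadj.reachable, fun h => h.trans hadj.symm.reachable⟩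

theorem mem_side_self [Fintype V] (e : Sym2 V) (v : V) : v ∈ side T e v :=
  mem_side.2 (SimpleGraph.Reachable.refl _)

theorem mem_trees {V : Type} [Fintype V] {T : SimpleGraph V} : T ∈ trees V ↔ T.IsTree := by
  simp [trees]

end Sides

/-! ### The vectors u_e: linear independence, and their identification with walls. -/

section EdgeVectors

variable {n b : ℕ} {κ : Fin b → Fin b → Fin b → ℝ}

theorem uVec_sum_apply (p : Fin n → Fin b → ℝ) (t : Fin b → ℝ) (I J : Finset (Fin n))
    (k : Fin n) : (∑ i ∈ I, ∑ j ∈ J, uVec κ p t i j) k =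
      ((if k ∈ I then ∑ j ∈ J, cubic κ (p j) t t else 0) -
        (if k ∈ J then ∑ i ∈ I, cubic κ (p i) t t else 0)) • t := by
  ext a
  simp only [Finset.sum_apply, uVec, Finset.sum_sub_distrib, Pi.smul_apply, smul_eq_mul, sub_mul]
  congr 1
  · rw [Finset.sum_congr rfl fun i _ => Finset.sum_ite_irrel _ _ _ _]
    simp only [Finset.sum_const_zero, Finset.sum_ite_eq, ite_mul, zero_mul, Finset.sum_mul]
  · rw [Finset.sum_comm, Finset.sum_congr rfl fun i _ => Finset.sum_ite_irrel _ _ _ _]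
    simp only [Finset.sum_const_zero, Finset.sum_ite_eq, ite_mul, zero_mul, Finset.sum_mul]

theorem exists_basis_uEdge (hκ : IsSymmetricCubic κ) {p : Fin n → Fin b → ℝ}
    {t : Fin b → ℝ} (hp : ∀ i, 0 < cubic κ (p i) t t) {T : SimpleGraph (Fin n)} (hT : T.IsTree)
    [Fintype T.edgeSet] {o : Sym2 (Fin n) → Fin n × Fin n} (ho : IsOrientation o) :
    ∃ B : T.edgeSet → Space n b,
      IsOrthonormalBasisOfSpan (bilin κ p) (fun e : T.edgeSet => uEdge κ p t o T e) B := by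
  classical
  set P : Finset (Fin n) → ℝ := fun I => ∑ i ∈ I, cubic κ (p i) t t with hP
  -- The square root undoes the normalisation in `alongMap`, so that `y e` is mapped to u_e.
  set y : T.edgeSet → EuclideanSpace ℝ (Fin n) := fun e => WithLp.toLp 2 fun k =>
    Real.sqrt (cubic κ (p k) t t) *
      ((if k ∈ side T e (o e).1 then P (side T e (o e).2) else 0) -
        (if k ∈ side T e (o e).2 then P (side T e (o e).1) else 0)) with hy
  refine exists_isOrthonormalBasisOfSpan hκ hp (y := y) ?_ fun e => ?_
  · rw [Fintype.linearIndependent_iff]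
    intro g hg e₀
    have hcomp : ∀ k, ∑ e : T.edgeSet, g e *
        ((if k ∈ side T e (o e).1 then P (side T e (o e).2) else 0) -
        (if k ∈ side T e (o e).2 then P (side T e (o e).1) else 0)) = 0 := by
      intro k
      have h1 := congrArg (fun z : EuclideanSpace ℝ (Fin n) => z k) hg
      simp only [hy, WithLp.ofLp_sum, WithLp.ofLp_smul, Finset.sum_apply, Pi.smul_apply, smul_eq_mul, WithLp.ofLp_zero,
        Pi.zero_apply] at h1
      have h2 := Real.sqrt_pos.2 (hp k)
      have h3 : Real.sqrt (cubic κ (p k) t t) * ∑ e : T.edgeSet, g e *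
        ((if k ∈ side T e (o e).1 then P (side T e (o e).2) else 0) -
        (if k ∈ side T e (o e).2 then P (side T e (o e).1) else 0)) = 0 := by
        refine Eq.trans ?_ h1
        rw [Finset.mul_sum]
        exact Finset.sum_congr rfl fun e _ => by ring
      exact (mul_eq_zero.1 h3).resolve_left h2.ne'
    obtain ⟨e₀, he₀⟩ := e₀
    have hoe := ho e₀
    set i := (o e₀).1 with hi
    set j := (o e₀).2 with hj
    have heT : s(i, j) ∈ T.edgeSet := by rw [hoe]; exact he₀
    have h1 := hcomp i
    have h2 := hcomp j
    -- Compare the components at the two ends of e₀. For any other edge both ends lie on the same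
    -- side and the components agree, so only e₀ is left, with the factor P(one side) + P(other
    -- side) > 0.
    have h3 : ∑ e : T.edgeSet, g e *
        (((if i ∈ side T e (o e).1 then P (side T e (o e).2) else 0) -
        (if i ∈ side T e (o e).2 then P (side T e (o e).1) else 0)) -
        ((if j ∈ side T e (o e).1 then P (side T e (o e).2) else 0) -
        (if j ∈ side T e (o e).2 then P (side T e (o e).1) else 0))) = 0 := by
      simp only [mul_sub, Finset.sum_sub_distrib] at h1 h2 ⊢
      rw [h1, h2, sub_zero]
    rw [Finset.sum_eq_single ⟨e₀, he₀⟩] at h3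
    · have hij : i ∉ side T e₀ j := by
        rw [mem_side]
        intro h
        exact not_reachable_of_isTree hT heT (by rw [hoe]; exact h.symm)
      have hji : j ∉ side T e₀ i := by
        rw [mem_side]
        intro h
        exact not_reachable_of_isTree hT heT (by rw [hoe]; exact h)
      have hPpos : ∀ v, 0 < P (side T e₀ v) := fun v =>
        Finset.sum_pos (fun i _ => hp i) ⟨v, mem_side_self _ _⟩
      simp only [← hi, ← hj, mem_side_self, hij, hji, if_true, if_false, sub_zero, zero_sub] at h3
      refine (mul_eq_zero.1 h3).resolve_right ?_
      have := hPpos i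
      have := hPpos j
      linarith
    · intro e _ hne
      have hne' : (e : Sym2 (Fin n)) ≠ s(i, j) := by
        rw [hoe]
        exact fun h => hne (Subtype.ext h)
      simp only [mem_side_iff_of_ne heT hne', sub_self, mul_zero]
    · simp
  · ext1 k
    rw [uEdge, uVec_sum_apply]
    have h2 := Real.sqrt_pos.2 (hp k)
    simp only [alongMap, hy, LinearMap.coe_mk, AddHom.coe_mk, hP]
    rw [mul_div_cancel_left₀ _ h2.ne']

theorem uEdge_eq_uSet (p : Fin n → Fin b → ℝ) (t : Fin b → ℝ) {T : SimpleGraph (Fin n)}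
    (hT : T.IsTree) {o : Sym2 (Fin n) → Fin n × Fin n} (ho : IsOrientation o) {e : Sym2 (Fin n)}
    (he : e ∈ T.edgeSet) : uEdge κ p t o T e = uSet κ p t (side T e (o e).1) := by
  have hoe := ho e
  have heT : s((o e).1, (o e).2) ∈ T.edgeSet := by rwa [hoe]
  have h := side_compl hT heT
  rw [hoe] at h
  rw [uEdge, uSet, ← h]

theorem isProper_side {T : SimpleGraph (Fin n)}
    (hT : T.IsTree) {o : Sym2 (Fin n) → Fin n × Fin n} (ho : IsOrientation o) {e : Sym2 (Fin n)}
    (he : e ∈ T.edgeSet) : IsProper (side T e (o e).1) := by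
  have hoe := ho e
  have heT : s((o e).1, (o e).2) ∈ T.edgeSet := by rwa [hoe]
  refine ⟨⟨_, mem_side_self _ _⟩, fun h => ?_⟩
  have h1 : (o e).2 ∈ side T e (o e).1 := by rw [h]; exact Finset.mem_univ _
  rw [mem_side] at h1
  exact not_reachable_of_isTree hT heT (by rw [hoe]; exact h1)

end EdgeVectors

end BPSTree

namespace BPSTree

/-! ### The Laplace and heat operators on polynomials in vectors. -/

section SymmetricAlgebra

open MvPolynomial

variable {σ : Type} [Fintype σ]

/-- The linear polynomial of a vector. -/
noncomputable def linPoly (v : σ → ℝ) : MvPolynomial σ ℝ := ∑ s, C (v s) * X s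

/-- The bilinear form with Gram matrix `g`. -/
def gramForm (g : σ → σ → ℝ) (v w : σ → ℝ) : ℝ := ∑ s, ∑ s', g s s' * v s * w s'

/-- The derivation that sends `linPoly w` to the pairing of `v` and `w`. -/
noncomputable def dirDeriv (g : σ → σ → ℝ) (v : σ → ℝ) :
    Derivation ℝ (MvPolynomial σ ℝ) (MvPolynomial σ ℝ) :=
  mkDerivation ℝ fun s' => C (∑ s, g s s' * v s)

/-- The Laplace operator of the bilinear form with Gram matrix `g`. -/
noncomputable def lap (g : σ → σ → ℝ) : MvPolynomial σ ℝ →ₗ[ℝ] MvPolynomial σ ℝ :=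
  ∑ s, ∑ s', g s s' • ((pderiv s' : Derivation ℝ (MvPolynomial σ ℝ) _).toLinearMap ∘ₗ
    (pderiv s : Derivation ℝ (MvPolynomial σ ℝ) _).toLinearMap)

theorem lap_apply (g : σ → σ → ℝ) (f : MvPolynomial σ ℝ) :
    lap g f = ∑ s, ∑ s', g s s' • pderiv s' (pderiv s f) := by
  simp [lap]

theorem pderiv_linPoly (s : σ) (v : σ → ℝ) : pderiv s (linPoly v) = C (v s) := by
  classical
  simp [linPoly, pderiv_X, Pi.single_apply]

theorem derivation_sum_apply {σ α : Type} (S : Finset α)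
    (D : α → Derivation ℝ (MvPolynomial σ ℝ) (MvPolynomial σ ℝ)) (f : MvPolynomial σ ℝ) :
    (∑ a ∈ S, D a) f = ∑ a ∈ S, D a f := by
  classical
  induction S using Finset.induction_on with
  | empty => simp
  | insert a S ha ih => rw [Finset.sum_insert ha, Finset.sum_insert ha, Derivation.add_apply, ih]

theorem derivation_prod {σ α : Type} [DecidableEq α] (S : Finset α)
    (D : Derivation ℝ (MvPolynomial σ ℝ) (MvPolynomial σ ℝ)) (f : α → MvPolynomial σ ℝ) :
    D (∏ a ∈ S, f a) = ∑ a ∈ S, (∏ a' ∈ S.erase a, f a') * D (f a) := by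
  induction S using Finset.induction_on with
  | empty => simp
  | insert a S ha ih =>
    rw [Finset.prod_insert ha, Derivation.leibniz, ih, Finset.sum_insert ha,
      Finset.erase_insert ha, smul_eq_mul, smul_eq_mul, Finset.mul_sum, add_comm]
    congr 1
    refine Finset.sum_congr rfl fun e he => ?_
    have hae : a ≠ e := fun h => ha (h ▸ he)
    rw [Finset.erase_insert_of_ne hae,
      Finset.prod_insert fun h => ha (Finset.mem_of_mem_erase h)]
    ring

theorem dirDeriv_apply (g : σ → σ → ℝ) (v : σ → ℝ) (f : MvPolynomial σ ℝ) :
    dirDeriv g v f = ∑ s', (∑ s, g s s' * v s) • pderiv s' f := by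
  classical
  have h : dirDeriv g v = ∑ s', (∑ s, g s s' * v s) • pderiv s' := by
    refine derivation_ext fun i => ?_
    rw [dirDeriv, mkDerivation_X, derivation_sum_apply]
    simp only [Derivation.smul_apply, pderiv_X, Pi.single_apply]
    refine Eq.symm ((Finset.sum_eq_single i ?_ ?_).trans ?_)
    · intro j _ hj
      simp [hj.symm]
    · simp
    · simp [smul_eq_C_mul]
  rw [h, derivation_sum_apply]
  rfl

theorem dirDeriv_linPoly (g : σ → σ → ℝ) (v w : σ → ℝ) :
    dirDeriv g v (linPoly w) = C (gramForm g v w) := by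
  rw [dirDeriv_apply, gramForm, Finset.sum_comm]
  simp only [pderiv_linPoly, smul_eq_C_mul, ← C_mul, ← map_sum, Finset.sum_mul]

theorem pderiv_pderiv_comm {σ : Type} (s s' : σ) (f : MvPolynomial σ ℝ) :
    pderiv s (pderiv s' f) = pderiv s' (pderiv s f) := by
  classical
  have h : ⁅(pderiv s : Derivation ℝ (MvPolynomial σ ℝ) (MvPolynomial σ ℝ)),
      (pderiv s' : Derivation ℝ (MvPolynomial σ ℝ) (MvPolynomial σ ℝ))⁆ = 0 := by
    refine derivation_ext fun i => ?_
    rw [Derivation.commutator_apply, pderiv_X, pderiv_X]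
    by_cases h1 : s = i <;> by_cases h2 : s' = i <;> simp [h1, h2]
  have h2 := congrArg (fun D => D f) h
  simpa [Derivation.commutator_apply, sub_eq_zero] using h2

theorem lap_dirDeriv (g : σ → σ → ℝ) (v : σ → ℝ) (f : MvPolynomial σ ℝ) :
    lap g (dirDeriv g v f) = dirDeriv g v (lap g f) := by
  have h' : ∀ (s : σ) (f : MvPolynomial σ ℝ),
      pderiv s (dirDeriv g v f) = dirDeriv g v (pderiv s f) := by
    intro s f
    simp only [dirDeriv_apply, map_sum, Derivation.map_smul, pderiv_pderiv_comm s]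
  simp only [lap_apply, h', map_sum, Derivation.map_smul]

/-- The commutator [Δ, v] = 2∂_v: the two mixed terms of the Leibniz rule coincide because `g` is
symmetric. -/
theorem lap_linPoly_mul {g : σ → σ → ℝ} (hg : ∀ s s', g s s' = g s' s) (v : σ → ℝ)
    (f : MvPolynomial σ ℝ) :
    lap g (linPoly v * f) = linPoly v * lap g f + 2 * dirDeriv g v f := by
  have h : ∀ s s', pderiv s' (pderiv s (linPoly v * f)) = linPoly v * pderiv s' (pderiv s f) +
      (v s • pderiv s' f + v s' • pderiv s f) := by
    intro s s'
    simp only [Derivation.leibniz, smul_eq_mul, map_add, pderiv_linPoly, pderiv_C,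
      smul_eq_C_mul]
    ring
  simp only [lap_apply, h, smul_add, Finset.sum_add_distrib, Finset.mul_sum, mul_smul_comm,
    smul_smul]
  congr 1
  rw [two_mul]
  simp only [dirDeriv_apply, Finset.sum_smul]
  congr 1
  · rw [Finset.sum_comm]
  · exact Finset.sum_congr rfl fun s _ => Finset.sum_congr rfl fun s' _ => by rw [hg s s']

/-- Since ∂_v commutes with Δ, each of the m+1 factors Δ contributes the same 2∂_v Δ^m. -/
theorem lap_iterate_linPoly_mul {g : σ → σ → ℝ} (hg : ∀ s s', g s s' = g s' s) (v : σ → ℝ)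
    (m : ℕ) (f : MvPolynomial σ ℝ) :
    (lap g)^[m + 1] (linPoly v * f) = linPoly v * (lap g)^[m + 1] f +
      (2 * (m + 1) : ℝ) • dirDeriv g v ((lap g)^[m] f) := by
  induction m with
  | zero =>
    have h2 : (2 : MvPolynomial σ ℝ) = C 2 := (map_ofNat C 2).symm
    simp [lap_linPoly_mul hg, smul_eq_C_mul, h2]
  | succ m ih =>
    rw [Function.iterate_succ_apply', ih, map_add, lap_linPoly_mul hg, LinearMap.map_smul,
      lap_dirDeriv, ← Function.iterate_succ_apply' (lap g) m,
      ← Function.iterate_succ_apply' (lap g) (m + 1)]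
    push_cast
    rw [add_assoc]
    congr 1
    have : (2 : MvPolynomial σ ℝ) = C 2 := (map_ofNat C 2).symm
    rw [this, ← smul_eq_C_mul, ← add_smul]
    congr 1
    ring

theorem lap_one (g : σ → σ → ℝ) : lap g 1 = 0 := by
  simp [lap_apply]

theorem lap_iterate_listProd {g : σ → σ → ℝ} (hg : ∀ s s', g s s' = g s' s)
    (l : List (σ → ℝ)) {m : ℕ} (hm : l.length < m) :
    (lap g)^[m] (l.map linPoly).prod = 0 := by
  induction l generalizing m with
  | nil =>
    obtain ⟨m, rfl⟩ : ∃ k, m = k + 1 := ⟨m - 1, by simp at hm; omega⟩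
    simp [lap_one]
  | cons v l ih =>
    obtain ⟨m, rfl⟩ : ∃ k, m = k + 1 := ⟨m - 1, by simp at hm; omega⟩
    simp only [List.length_cons] at hm
    rw [List.map_cons, List.prod_cons, lap_iterate_linPoly_mul hg, ih (by omega),
      ih (by omega)]
    simp

/-- The heat operator `exp(Δ / 4π)`, truncated after `N` terms. -/
noncomputable def heat (g : σ → σ → ℝ) (N : ℕ) (f : MvPolynomial σ ℝ) : MvPolynomial σ ℝ :=
  ∑ m ∈ Finset.range N, ((m.factorial : ℝ) * (4 * Real.pi) ^ m)⁻¹ • (lap g)^[m] f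

/-- The polynomial form of exp(Δ/4π) v = (v + ∂_v/2π) exp(Δ/4π), that is, of the action of 𝒟(v):
2(m+1)/((m+1)! (4π)^(m+1)) equals 1/(2π) times 1/(m! (4π)^m). The derivative term has used up one Δ,
hence the shorter truncation. -/
theorem heat_linPoly_mul {g : σ → σ → ℝ} (hg : ∀ s s', g s s' = g s' s) (v : σ → ℝ)
    (N : ℕ) (f : MvPolynomial σ ℝ) :
    heat g (N + 1) (linPoly v * f) = linPoly v * heat g (N + 1) f +
      (1 / (2 * Real.pi)) • dirDeriv g v (heat g N f) := by
  simp only [heat]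
  rw [Finset.sum_range_succ', Finset.sum_range_succ' _ N]
  simp only [lap_iterate_linPoly_mul hg, smul_add, Finset.sum_add_distrib, mul_add,
    Finset.mul_sum, map_sum, Finset.smul_sum, Derivation.map_smul, smul_smul, mul_smul_comm]
  simp only [Function.iterate_zero, id, pow_zero, Nat.factorial_zero]
  rw [add_right_comm]
  congr 1
  refine Finset.sum_congr rfl fun m _ => ?_
  congr 1
  have := Real.pi_ne_zero
  have h2 : (m.factorial : ℝ) ≠ 0 := by positivity
  rw [Nat.factorial_succ, pow_succ]
  push_cast
  have h3 : (m + 1 : ℝ) ≠ 0 := by positivity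
  field_simp
  ring

theorem heat_eq_of_length_lt {g : σ → σ → ℝ} (hg : ∀ s s', g s s' = g s' s)
    (l : List (σ → ℝ)) {N N' : ℕ} (hN : l.length < N) (hN' : N ≤ N') :
    heat g N' (l.map linPoly).prod = heat g N (l.map linPoly).prod := by
  symm
  refine Finset.sum_subset (fun m hm => ?_) fun m _ hm => ?_
  · simp only [Finset.mem_range] at *
    omega
  · rw [lap_iterate_listProd hg l (by simp at hm; omega), smul_zero]

/-- The sum runs over ordered pairs, so it contains the factor 2 of the commutator. -/
theorem lap_prod {g : σ → σ → ℝ} (hg : ∀ s s', g s s' = g s' s) {α : Type} [DecidableEq α]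
    (S : Finset α) (z : α → σ → ℝ) :
    lap g (∏ e ∈ S, linPoly (z e)) = ∑ e ∈ S, ∑ e' ∈ S.erase e,
      gramForm g (z e) (z e') • ∏ e'' ∈ (S.erase e).erase e', linPoly (z e'') := by
  induction S using Finset.induction_on with
  | empty => simp [lap_one]
  | insert a S ha ih =>
    have hd : ∀ S : Finset α, dirDeriv g (z a) (∏ e ∈ S, linPoly (z e)) =
        ∑ e ∈ S, gramForm g (z a) (z e) • ∏ e' ∈ S.erase e, linPoly (z e') := by
      intro S
      rw [derivation_prod]
      refine Finset.sum_congr rfl fun e _ => ?_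
      rw [dirDeriv_linPoly, smul_eq_C_mul, mul_comm]
    have hsym : ∀ v w, gramForm g v w = gramForm g w v := by
      intro v w
      rw [gramForm, gramForm, Finset.sum_comm]
      exact Finset.sum_congr rfl fun s _ => Finset.sum_congr rfl fun s' _ => by rw [hg s s']; ring
    rw [Finset.prod_insert ha, lap_linPoly_mul hg, ih, hd, Finset.sum_insert ha,
      Finset.erase_insert ha, two_mul]
    have h1 : ∀ e ∈ S, ∑ e' ∈ (insert a S).erase e, gramForm g (z e) (z e') •
        ∏ e'' ∈ ((insert a S).erase e).erase e', linPoly (z e'') =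
        gramForm g (z a) (z e) • ∏ e' ∈ S.erase e, linPoly (z e') +
        linPoly (z a) * ∑ e' ∈ S.erase e,
          gramForm g (z e) (z e') • ∏ e'' ∈ (S.erase e).erase e', linPoly (z e'') := by
      intro e he
      have hae : a ≠ e := fun h => ha (h ▸ he)
      have ha' : a ∉ S.erase e := fun h => ha (Finset.mem_of_mem_erase h)
      rw [Finset.erase_insert_of_ne hae, Finset.sum_insert ha', Finset.erase_insert ha',
        hsym, Finset.mul_sum]
      congr 1
      refine Finset.sum_congr rfl fun e' he' => ?_
      have hae' : a ≠ e' := fun h => ha' (h ▸ he')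
      have ha'' : a ∉ (S.erase e).erase e' := fun h => ha' (Finset.mem_of_mem_erase h)
      rw [Finset.erase_insert_of_ne hae', Finset.prod_insert ha'', mul_smul_comm]
    rw [Finset.sum_congr rfl h1, Finset.sum_add_distrib, ← Finset.mul_sum]
    ring

end SymmetricAlgebra

/-! ### Polynomials in vectors as functions on the ambient space. -/

section PolyFunctions

open MvPolynomial

variable {n b : ℕ} {κ : Fin b → Fin b → Fin b → ℝ}

/-- The coordinates of a vector, indexed by pairs. -/
def coords (v : Space n b) : Fin n × Fin b → ℝ := fun s => v s.1 s.2

/-- The standard basis of the ambient space. -/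
def basisVec (s : Fin n × Fin b) : Space n b := Pi.single s.1 (Pi.single s.2 1)

/-- The Gram matrix of the form `x · y`. -/
def gram (κ : Fin b → Fin b → Fin b → ℝ) (p : Fin n → Fin b → ℝ) (s s' : Fin n × Fin b) : ℝ :=
  bilin κ p (basisVec s) (basisVec s')

theorem gram_comm (hκ : IsSymmetricCubic κ) (p : Fin n → Fin b → ℝ) (s s' : Fin n × Fin b) :
    gram κ p s s' = gram κ p s' s :=
  bilin_comm hκ _ _ _

theorem eq_sum_basisVec (v : Space n b) : v = ∑ s, coords v s • basisVec s := by
  ext k a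
  rw [Fintype.sum_prod_type]
  simp only [Finset.sum_apply, Pi.smul_apply, coords, basisVec, smul_eq_mul]
  rw [Finset.sum_eq_single k]
  · simp [Pi.single_apply]
  · intro j _ hj
    simp [hj.symm]
  · simp

theorem gramForm_coords (hκ : IsSymmetricCubic κ) (p : Fin n → Fin b → ℝ) (v w : Space n b) :
    gramForm (gram κ p) (coords v) (coords w) = bilin κ p v w := by
  conv_rhs => rw [← bilinMap_apply hκ, eq_sum_basisVec v, eq_sum_basisVec w]
  simp only [map_sum, LinearMap.sum_apply, map_smul, LinearMap.smul_apply, bilinMap_apply,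
    smul_eq_mul, Finset.mul_sum, gramForm]
  rw [Finset.sum_comm]
  refine Finset.sum_congr rfl fun s _ => Finset.sum_congr rfl fun s' _ => ?_
  rw [gram]
  ring

/-- The function on the ambient space given by a polynomial in vectors. -/
noncomputable def polyFun (κ : Fin b → Fin b → Fin b → ℝ) (p : Fin n → Fin b → ℝ) (x : Space n b) :
    MvPolynomial (Fin n × Fin b) ℝ →ₐ[ℝ] ℝ :=
  aeval fun s => bilin κ p (basisVec s) x

theorem polyFun_linPoly (hκ : IsSymmetricCubic κ) (p : Fin n → Fin b → ℝ) (x v : Space n b) :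
    polyFun κ p x (linPoly (coords v)) = bilin κ p v x := by
  conv_rhs => rw [← bilinMap_apply hκ, eq_sum_basisVec v]
  simp [linPoly, polyFun]

/-- The variable X_s stands for the function e_s·x, whose derivative along v is the constant e_s·v;
the Leibniz rule does the rest. -/
theorem hasFDerivAt_polyFun (hκ : IsSymmetricCubic κ) (p : Fin n → Fin b → ℝ)
    (f : MvPolynomial (Fin n × Fin b) ℝ) (x : Space n b) :
    ∃ D : Space n b →L[ℝ] ℝ, HasFDerivAt (fun x => polyFun κ p x f) D x ∧
      ∀ v, D v = polyFun κ p x (dirDeriv (gram κ p) (coords v) f) := by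
  induction f using MvPolynomial.induction_on with
  | C c =>
    refine ⟨0, ?_, fun v => ?_⟩
    · simpa using hasFDerivAt_const c x
    · simp [dirDeriv]
  | add f g hf hg =>
    obtain ⟨D, hD, hD'⟩ := hf
    obtain ⟨D', hg, hg'⟩ := hg
    refine ⟨D + D', ?_, fun v => ?_⟩
    · simp only [map_add]
      exact hD.add hg
    · simp [hD', hg']
  | mul_X f s hf =>
    obtain ⟨D, hD, hD'⟩ := hf
    have h1 : HasFDerivAt (fun x => polyFun κ p x (X s)) (bilinForm hκ p (basisVec s)) x := by
      simp only [polyFun, aeval_X]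
      exact (bilinForm hκ p (basisVec s)).hasFDerivAt
    refine ⟨_, by simp only [map_mul]; exact hD.mul h1, fun v => ?_⟩
    have h2 : dirDeriv (gram κ p) (coords v) (X s) = C (bilin κ p (basisVec s) v) := by
      rw [dirDeriv, mkDerivation_X]
      congr 1
      conv_rhs => rw [bilin_comm hκ, ← bilinMap_apply hκ, eq_sum_basisVec v]
      simp only [map_sum, LinearMap.sum_apply, map_smul, LinearMap.smul_apply, bilinMap_apply,
        smul_eq_mul, gram]
      exact Finset.sum_congr rfl fun _ _ => by ring
    simp only [add_apply, smul_apply, smul_eq_mul, bilinForm_apply, Derivation.leibniz, h2,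
      map_add, map_mul, hD']
    simp [polyFun]

theorem raiseOp_polyFun (hκ : IsSymmetricCubic κ) (p : Fin n → Fin b → ℝ)
    (f : MvPolynomial (Fin n × Fin b) ℝ) (v : Space n b) :
    covDeriv κ p v (fun x => polyFun κ p x f) = fun x => polyFun κ p x
      (linPoly (coords v) * f + (1 / (2 * Real.pi)) • dirDeriv (gram κ p) (coords v) f) := by
  ext x
  obtain ⟨D, hD, hD'⟩ := hasFDerivAt_polyFun hκ p f x
  rw [covDeriv, hD.fderiv, hD', map_add, map_mul, polyFun_linPoly hκ, map_smul, smul_eq_mul]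

/-- Each 𝒟 is moved inside the heat operator, where it becomes multiplication by its vector. On a
product of fewer than `N` linear factors the truncation loses nothing. -/
theorem foldr_covDeriv_one (hκ : IsSymmetricCubic κ) (p : Fin n → Fin b → ℝ) {α : Type}
    (l : List α) (z : α → Space n b) {N : ℕ} (hN : l.length < N) :
    l.foldr (fun e f => covDeriv κ p (z e) f) (fun _ => 1) = fun x => polyFun κ p x
      (heat (gram κ p) N (l.map fun e => linPoly (coords (z e))).prod) := by
  have hmap : ∀ l : List α, (l.map fun e => linPoly (coords (z e))) =
      (l.map fun e => coords (z e)).map linPoly := fun l => by simp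
  induction l generalizing N with
  | nil =>
    have h1 := heat_eq_of_length_lt (gram_comm hκ p) [] (N := 1) (N' := N) (by simp)
      (by simp at hN; omega)
    simp only [List.map_nil, List.prod_nil] at h1
    rw [List.map_nil, List.prod_nil, h1]
    simp [heat]
  | cons e l ih =>
    obtain ⟨N, rfl⟩ : ∃ k, N = k + 1 := ⟨N - 1, by simp at hN; omega⟩
    simp only [List.length_cons, add_lt_add_iff_right] at hN
    rw [List.foldr_cons, ih hN, raiseOp_polyFun hκ, List.map_cons, List.prod_cons,
      heat_linPoly_mul (gram_comm hκ p), hmap,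
      heat_eq_of_length_lt (gram_comm hκ p) _ (N := N) (N' := N + 1) (by simpa using hN) (by omega)]

/-- A polynomial in vectors as a polynomial in the coordinates of the argument. -/
theorem exists_eval_eq_polyFun (hκ : IsSymmetricCubic κ) (p : Fin n → Fin b → ℝ)
    (f : MvPolynomial (Fin n × Fin b) ℝ) : ∃ P : MvPolynomial (Fin n × Fin b) ℝ,
      ∀ x : Space n b, MvPolynomial.eval (fun k => x k.1 k.2) P = polyFun κ p x f := by
  refine ⟨bind₁ (fun s => ∑ s', C (gram κ p s s') * X s') f, fun x => ?_⟩
  have h : ∀ s, bilin κ p (basisVec s) x = MvPolynomial.eval (fun k => x k.1 k.2)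
      (∑ s', C (gram κ p s s') * X s') := by
    intro s
    conv_lhs => rw [← bilinMap_apply hκ, eq_sum_basisVec x]
    simp only [map_sum, map_smul, bilinMap_apply, smul_eq_mul, map_mul, eval_C, eval_X, gram]
    exact Finset.sum_congr rfl fun s' _ => by rw [mul_comm]; rfl
  rw [polyFun]
  simp only [h]
  rw [← MvPolynomial.coe_aeval_eq_eval, RingHom.coe_coe, aeval_bind₁]

end PolyFunctions

end BPSTree

namespace BPSTree

/-! ### Existence and uniqueness of the large x limit. -/

section LargeLimit

variable {n b : ℕ} {κ : Fin b → Fin b → Fin b → ℝ}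

/-- The product of the vectors attached to the edges of a tree. -/
noncomputable def edgePoly (p : Fin n → Fin b → ℝ) (o : Sym2 (Fin n) → Fin n × Fin n)
    (F : Finset (Sym2 (Fin n))) : MvPolynomial (Fin n × Fin b) ℝ :=
  ∏ e ∈ F, linPoly (coords (vVec p (o e).1 (o e).2))

theorem edgeSet_prod {V M : Type} [CommMonoid M] (T : SimpleGraph V) [Fintype T.edgeSet]
    (f : Sym2 V → M) : ∏ e : T.edgeSet, f e = ∏ e ∈ T.edgeFinset, f e :=
  Finset.prod_set_coe _

open Classical in
/-- The large argument limit of the tree kernel: each generalized error function is replaced by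
the product of the signs. -/
noncomputable def limitKernel (κ : Fin b → Fin b → Fin b → ℝ) (p : Fin n → Fin b → ℝ)
    (t : Fin b → ℝ) (o : SimpleGraph (Fin n) → Sym2 (Fin n) → Fin n × Fin n) (N : ℕ)
    (x : Space n b) : ℝ :=
  1 / (2 ^ (n - 1) * (n.factorial : ℝ)) * ∑ T ∈ trees (Fin n),
    (∏ e ∈ T.edgeFinset, Real.sign (bilin κ p (uSet κ p t (side T e (o T e).1)) x)) *
      polyFun κ p x (heat (gram κ p) N (edgePoly p (o T) T.edgeFinset))

theorem isLargeLimit_limitKernel (hκ : IsSymmetricCubic κ) {p : Fin n → Fin b → ℝ}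
    {t : Fin b → ℝ} (hp : ∀ i, 0 < cubic κ (p i) t t)
    {o : SimpleGraph (Fin n) → Sym2 (Fin n) → Fin n × Fin n} (ho : ∀ T, IsOrientation (o T))
    {N : ℕ} (hN : n ≤ N) :
    IsLargeLimit κ p t (treeKernel κ p t o) (limitKernel κ p t o N) := by
  classical
  constructor
  · intro x₀ _
    choose P hP using fun T : SimpleGraph (Fin n) => exists_eval_eq_polyFun hκ p
      (heat (gram κ p) N (edgePoly p (o T) T.edgeFinset))
    refine ⟨MvPolynomial.C (1 / (2 ^ (n - 1) * (n.factorial : ℝ))) * ∑ T ∈ trees (Fin n),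
      MvPolynomial.C (∏ e ∈ T.edgeFinset,
        Real.sign (bilin κ p (uSet κ p t (side T e (o T e).1)) x₀)) * P T, fun x hx => ?_⟩
    simp only [map_mul, map_sum, MvPolynomial.eval_C, hP, limitKernel]
    congr 1
    refine Finset.sum_congr rfl fun T hT => ?_
    congr 1
    refine Finset.prod_congr rfl fun e he => ?_
    exact hx _ (isProper_side (mem_trees.1 hT) (ho T) (SimpleGraph.mem_edgeFinset.1 he))
  · intro ε hε
    have key : ∀ T ∈ trees (Fin n), Filter.Tendsto (fun x => upliftedErr (ι := T.edgeSet) κ p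
        (fun e => uEdge κ p t (o T) T e) (fun e => vVec p (o T e).1 (o T e).2) x -
        (∏ e ∈ T.edgeFinset, Real.sign (bilin κ p (uSet κ p t (side T e (o T e).1)) x)) *
          polyFun κ p x (heat (gram κ p) N (edgePoly p (o T) T.edgeFinset)))
        (Bornology.cobounded (Space n b) ⊓
        Filter.principal {x | ∀ I : Finset (Fin n), IsProper I →
          ε * ‖x‖ ≤ |bilin κ p (uSet κ p t I) x|}) (nhds 0) := by
      intro T hT
      have hT' := mem_trees.1 hT
      have h := tendsto_upliftedErr hκ p (fun e : T.edgeSet => vVec p (o T e).1 (o T e).2)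
        (exists_basis_uEdge hκ hp hT' (ho T)) hε
        (S := {x | ∀ I : Finset (Fin n), IsProper I → ε * ‖x‖ ≤ |bilin κ p (uSet κ p t I) x|})
        (fun x hx e => by
          rw [uEdge_eq_uSet p t hT' (ho T) e.2]
          exact hx _ (isProper_side hT' (ho T) e.2))
      refine h.congr fun x => ?_
      congr 1
      congr 1
      · rw [← edgeSet_prod T fun e => Real.sign (bilin κ p (uSet κ p t (side T e (o T e).1)) x)]
        refine Finset.prod_congr rfl fun e _ => ?_
        rw [uEdge_eq_uSet p t hT' (ho T) e.2]
      -- A tree has n-1 edges, so the truncation at N ≥ n is exact.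
      · have hcard : (Finset.univ : Finset T.edgeSet).toList.length < N := by
          rw [Finset.length_toList, Finset.card_univ]
          have h1 := (SimpleGraph.isTree_iff_connected_and_card.1 hT').2
          rw [Nat.card_eq_fintype_card, Nat.card_eq_fintype_card, Fintype.card_fin] at h1
          omega
        rw [foldr_covDeriv_one hκ p _ _ hcard, Finset.prod_map_toList, edgePoly]
        refine congrArg (fun f => polyFun κ p x (heat (gram κ p) N f)) ?_
        exact edgeSet_prod T fun e => linPoly (coords (vVec p (o T e).1 (o T e).2))
    have h := (tendsto_finsetSum _ key).const_mul (1 / (2 ^ (n - 1) * (n.factorial : ℝ)))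
    simp only [Finset.sum_const_zero, mul_zero] at h
    refine h.congr fun x => ?_
    rw [Finset.sum_sub_distrib, mul_sub]
    rfl

theorem polynomial_eq_zero_of_tendsto {q : Polynomial ℝ}
    (h : Filter.Tendsto (fun s => q.eval s) Filter.atTop (nhds 0)) : q = 0 :=
  Polynomial.leadingCoeff_eq_zero.1 ((Polynomial.tendsto_nhds_iff q).1 h).1

/-- Along a suitable ray from `x` all pairings u_I·x are only rescaled by 1+s, so the ray stays in
the chamber and in one closed cone. There the difference of the two limits is a polynomial in s that
tends to zero, hence is zero, also at s = 0. -/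
theorem IsLargeLimit.eq_of_offWalls (hκ : IsSymmetricCubic κ) (hn : 1 ≤ n)
    {p : Fin n → Fin b → ℝ} {t : Fin b → ℝ} (hp : ∀ i, 0 < cubic κ (p i) t t)
    {Φ Φ₀ Φ₁ : Space n b → ℝ} (h₀ : IsLargeLimit κ p t Φ Φ₀) (h₁ : IsLargeLimit κ p t Φ Φ₁)
    {x : Space n b} (hx : OffWalls κ p t x) : Φ₀ x = Φ₁ x := by
  have ht : t ≠ 0 := by
    rintro rfl
    have := hp ⟨0, hn⟩
    simp [cubic] at this
  -- The direction is `x` itself. If x = 0, being off the walls means that there are no proper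
  -- subsets, and any nonzero direction serves.
  obtain ⟨w, hw0, hw⟩ : ∃ w : Space n b, w ≠ 0 ∧ ∀ I, IsProper I →
      bilin κ p (uSet κ p t I) w = bilin κ p (uSet κ p t I) x := by
    by_cases hx0 : x = 0
    · refine ⟨fun _ => t, fun h => ht (congrFun h ⟨0, hn⟩), fun I hI => (hx I hI ?_).elim⟩
      rw [hx0, ← bilinMap_apply hκ, map_zero]
    · exact ⟨x, hx0, fun _ _ => rfl⟩
  have hb : ∀ s : ℝ, ∀ I, IsProper I → bilin κ p (uSet κ p t I) (x + s • w) =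
      (1 + s) * bilin κ p (uSet κ p t I) x := by
    intro s I hI
    have h2 := hw I hI
    rw [← bilinMap_apply hκ] at h2 ⊢
    rw [map_add, map_smul, h2, smul_eq_mul, bilinMap_apply]
    ring
  obtain ⟨δ, hδ, hδx⟩ : ∃ δ : ℝ, 0 < δ ∧ ∀ I, IsProper I →
      δ ≤ |bilin κ p (uSet κ p t I) x| := by
    have h1 : ∀ᶠ δ in nhdsWithin (0 : ℝ) (Set.Ioi 0), ∀ I : Finset (Fin n), IsProper I →
        δ ≤ |bilin κ p (uSet κ p t I) x| := by
      rw [Filter.eventually_all]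
      intro I
      by_cases hI : IsProper I
      · have h2 : 0 < |bilin κ p (uSet κ p t I) x| := abs_pos.2 (hx I hI)
        filter_upwards [Ioo_mem_nhdsGT h2] with δ hδ _
        exact hδ.2.le
      · simp [hI]
    obtain ⟨δ, h2, h3⟩ := (h1.and self_mem_nhdsWithin).exists
    exact ⟨δ, h3, h2⟩
  have hwn : 0 < ‖w‖ := norm_pos_iff.2 hw0
  have hR : 0 < ‖x‖ + ‖w‖ := by positivity
  have hcone : Filter.Tendsto (fun s : ℝ => x + s • w) Filter.atTop
      (Bornology.cobounded (Space n b) ⊓ Filter.principal {y | ∀ I : Finset (Fin n), IsProper I →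
          δ / (‖x‖ + ‖w‖) * ‖y‖ ≤ |bilin κ p (uSet κ p t I) y|}) := by
    refine Filter.tendsto_inf.2 ⟨?_, Filter.tendsto_principal.2 ?_⟩
    · rw [← tendsto_norm_atTop_iff_cobounded]
      refine Filter.tendsto_atTop_mono (f := fun s => s * ‖w‖ - ‖x‖) (fun s => ?_)
        (Filter.tendsto_atTop_add_const_right _ _ (Filter.tendsto_id.atTop_mul_const hwn))
      have h1 := norm_sub_le (x + s • w) x
      rw [add_sub_cancel_left, norm_smul, Real.norm_eq_abs] at h1
      have h2 := mul_le_mul_of_nonneg_right (le_abs_self s) hwn.le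
      linarith
    · filter_upwards [Filter.eventually_ge_atTop 0] with s hs I hI
      rw [hb s I hI, abs_mul, abs_of_nonneg (by linarith : (0 : ℝ) ≤ 1 + s)]
      have h1 : ‖x + s • w‖ ≤ (1 + s) * (‖x‖ + ‖w‖) := by
        refine (norm_add_le _ _).trans ?_
        rw [norm_smul, Real.norm_eq_abs, abs_of_nonneg hs]
        nlinarith [norm_nonneg x]
      calc δ / (‖x‖ + ‖w‖) * ‖x + s • w‖ ≤ δ / (‖x‖ + ‖w‖) * ((1 + s) * (‖x‖ + ‖w‖)) := by
            gcongr
        _ = (1 + s) * δ := by field_simp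
        _ ≤ _ := mul_le_mul_of_nonneg_left (hδx I hI) (by linarith)
  obtain ⟨P₀, hP₀⟩ := h₀.1 x hx
  obtain ⟨P₁, hP₁⟩ := h₁.1 x hx
  have hlim := (h₁.2 _ (div_pos hδ hR)).sub (h₀.2 _ (div_pos hδ hR))
  rw [sub_zero] at hlim
  have hlim2 := hlim.comp hcone
  set q : Polynomial ℝ := MvPolynomial.aeval (fun k : Fin n × Fin b =>
    Polynomial.C (x k.1 k.2) + Polynomial.X * Polynomial.C (w k.1 k.2)) (P₀ - P₁) with hq
  have hqe : ∀ s, q.eval s = MvPolynomial.eval (fun k => (x + s • w) k.1 k.2) (P₀ - P₁) := by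
    intro s
    rw [hq, ← Polynomial.coe_evalRingHom, MvPolynomial.aeval_def, MvPolynomial.hom_eval₂]
    have h3 : (Polynomial.evalRingHom s).comp (algebraMap ℝ (Polynomial ℝ)) = RingHom.id ℝ := by
      ext; simp
    rw [h3, MvPolynomial.eval₂_id]
    congr 2
    ext k
    simp only [map_add, map_mul, Polynomial.coe_evalRingHom, Polynomial.eval_C, Polynomial.eval_X,
      Pi.add_apply, Pi.smul_apply, smul_eq_mul]
  have hsame : ∀ s : ℝ, 0 ≤ s → ∀ I : Finset (Fin n), IsProper I →
      Real.sign (bilin κ p (uSet κ p t I) (x + s • w)) =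
        Real.sign (bilin κ p (uSet κ p t I) x) := by
    intro s hs I hI
    rw [hb s I hI, real_sign_eq_coe, real_sign_eq_coe, sign_mul, sign_pos (by linarith), one_mul]
  have hq0 : q = 0 := by
    refine polynomial_eq_zero_of_tendsto (hlim2.congr' ?_)
    filter_upwards [Filter.eventually_ge_atTop 0] with s hs
    rw [hqe, map_sub, ← hP₀ _ (hsame s hs), ← hP₁ _ (hsame s hs)]
    simp only [Function.comp_apply]
    ring
  have h5 := hqe 0
  rw [hq0, Polynomial.eval_zero, map_sub, ← hP₀ _ (hsame 0 le_rfl), ← hP₁ _ (hsame 0 le_rfl),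
    zero_smul, add_zero] at h5
  linarith

end LargeLimit

end BPSTree

namespace BPSTree

/-! ### Trees over an equivalence relation and the contraction of triples. -/

section Connectivity

variable {V : Type}

/-- The equivalence relation generated by the pairs in `F`. -/
def edgeRel (F : Finset (Sym2 V)) : Setoid V := Relation.EqvGen.setoid fun i j => s(i, j) ∈ F

theorem edgeRel_le_iff {F : Finset (Sym2 V)} {r : Setoid V} :
    edgeRel F ≤ r ↔ ∀ i j, s(i, j) ∈ F → r i j := by
  constructor
  · intro h i j hij
    exact h (Relation.EqvGen.rel _ _ hij)
  · intro h
    exact Setoid.eqvGen_le fun i j => h i j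

theorem edgeRel_of_mem {F : Finset (Sym2 V)} {i j : V} (h : s(i, j) ∈ F) : edgeRel F i j :=
  edgeRel_le_iff.1 le_rfl i j h

theorem edgeRel_mono {F F' : Finset (Sym2 V)} (h : F ⊆ F') : edgeRel F ≤ edgeRel F' :=
  edgeRel_le_iff.2 fun _ _ hij => edgeRel_of_mem (h hij)

theorem edgeRel_empty : edgeRel (∅ : Finset (Sym2 V)) = ⊥ :=
  le_bot_iff.1 (edgeRel_le_iff.2 fun _ _ h => by simp at h)

theorem edgeRel_insert [DecidableEq V] (e : Sym2 V) (F : Finset (Sym2 V)) :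
    edgeRel (insert e F) = edgeRel {e} ⊔ edgeRel F := by
  refine le_antisymm (edgeRel_le_iff.2 fun i j hij => ?_)
    (sup_le (edgeRel_mono (by simp)) (edgeRel_mono (Finset.subset_insert _ _)))
  rcases Finset.mem_insert.1 hij with h | h
  · exact (le_sup_left : edgeRel {e} ≤ _) (edgeRel_of_mem (by simp [h]))
  · exact (le_sup_right : edgeRel F ≤ _) (edgeRel_of_mem h)

/-- One more edge merges the classes of its two ends and nothing else; the right-hand side is
already an equivalence relation, so it is the join. -/
theorem sup_edgeRel_apply (P : Setoid V) (i j x y : V) :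
    (P ⊔ edgeRel {s(i, j)}) x y ↔ P x y ∨ (P x i ∧ P j y) ∨ (P x j ∧ P i y) := by
  have hr : ∀ a, P a a := P.refl'
  have hs : ∀ {a b}, P a b → P b a := P.symm'
  have ht : ∀ {a b c}, P a b → P b c → P a c := P.trans'
  constructor
  · intro h
    let Q : Setoid V :=
      { r := fun x y => P x y ∨ (P x i ∧ P j y) ∨ (P x j ∧ P i y)
        iseqv := ⟨fun x => Or.inl (hr x), fun {x y} h => by
          rcases h with h | ⟨h1, h2⟩ | ⟨h1, h2⟩
          · exact Or.inl (hs h)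
          · exact Or.inr (Or.inr ⟨hs h2, hs h1⟩)
          · exact Or.inr (Or.inl ⟨hs h2, hs h1⟩), fun {x y z} h h' => by
          rcases h with h | ⟨h1, h2⟩ | ⟨h1, h2⟩ <;> rcases h' with h' | ⟨h3, h4⟩ | ⟨h3, h4⟩
          · exact Or.inl (ht h h')
          · exact Or.inr (Or.inl ⟨ht h h3, h4⟩)
          · exact Or.inr (Or.inr ⟨ht h h3, h4⟩)
          · exact Or.inr (Or.inl ⟨h1, ht h2 h'⟩)
          · exact Or.inr (Or.inl ⟨h1, h4⟩)
          · exact Or.inl (ht h1 h4)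
          · exact Or.inr (Or.inr ⟨h1, ht h2 h'⟩)
          · exact Or.inl (ht h1 h4)
          · exact Or.inr (Or.inr ⟨h1, h4⟩)⟩ }
    have hle : P ⊔ edgeRel {s(i, j)} ≤ Q := by
      refine sup_le (fun {x y} h => Or.inl h) (edgeRel_le_iff.2 fun a b hab => ?_)
      rcases Sym2.eq_iff.1 (Finset.mem_singleton.1 hab) with ⟨rfl, rfl⟩ | ⟨rfl, rfl⟩
      · exact Or.inr (Or.inl ⟨hr _, hr _⟩)
      · exact Or.inr (Or.inr ⟨hr _, hr _⟩)
    exact hle h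
  · have h1 : ∀ {a b}, P a b → (P ⊔ edgeRel {s(i, j)}) a b := fun h =>
      (le_sup_left : P ≤ P ⊔ edgeRel {s(i, j)}) h
    have h2 : (P ⊔ edgeRel {s(i, j)}) i j :=
      (le_sup_right : edgeRel {s(i, j)} ≤ P ⊔ edgeRel {s(i, j)}) (edgeRel_of_mem (by simp))
    rintro (h | ⟨h, h'⟩ | ⟨h, h'⟩)
    · exact h1 h
    · exact Setoid.trans' _ (h1 h) (Setoid.trans' _ h2 (h1 h'))
    · exact Setoid.trans' _ (h1 h) (Setoid.trans' _ (Setoid.symm' _ h2) (h1 h'))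

theorem sup_edgeRel_of_rel {P : Setoid V} {i j : V} (h : P i j) : P ⊔ edgeRel {s(i, j)} = P := by
  refine sup_eq_left.2 (edgeRel_le_iff.2 fun a b hab => ?_)
  rcases Sym2.eq_iff.1 (Finset.mem_singleton.1 hab) with ⟨rfl, rfl⟩ | ⟨rfl, rfl⟩
  · exact h
  · exact P.symm' h

/-- The classes other than that of `j` correspond bijectively to the classes after the merger. -/
theorem card_quotient_sup_edgeRel [Finite V] {P : Setoid V} {i j : V} (h : ¬ P i j) :
    Nat.card (Quotient P) = Nat.card (Quotient (P ⊔ edgeRel {s(i, j)})) + 1 := by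
  classical
  have := Fintype.ofFinite (Quotient P)
  have := Fintype.ofFinite (Quotient (P ⊔ edgeRel {s(i, j)}))
  let j' : Quotient P := Quotient.mk P j
  let f : {q : Quotient P | q ≠ j'} → Quotient (P ⊔ edgeRel {s(i, j)}) := fun q =>
    Quotient.map' id (fun a b hab => (le_sup_left : P ≤ P ⊔ edgeRel {s(i, j)}) hab) q.1
  have hf : Function.Bijective f := by
    constructor
    · rintro ⟨q, hq⟩ ⟨q', hq'⟩ hqq
      induction q using Quotient.inductionOn with | h x => ?_
      induction q' using Quotient.inductionOn with | h y => ?_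
      have hx : ¬ P x j := fun h => hq (Quotient.sound h)
      have hy : ¬ P y j := fun h => hq' (Quotient.sound h)
      have h1 : (P ⊔ edgeRel {s(i, j)}) x y := Quotient.exact hqq
      rw [sup_edgeRel_apply] at h1
      rcases h1 with h1 | ⟨_, h1⟩ | ⟨h1, _⟩
      · exact Subtype.ext (Quotient.sound h1)
      · exact (hy (P.symm' h1)).elim
      · exact (hx h1).elim
    · intro q
      induction q using Quotient.inductionOn with | h y => ?_
      by_cases hy : P y j
      · refine ⟨⟨Quotient.mk P i, fun h' => h (Quotient.exact h')⟩, Quotient.sound ?_⟩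
        exact (sup_edgeRel_apply P i j i y).2 (Or.inr (Or.inl ⟨P.refl' _, P.symm' hy⟩))
      · exact ⟨⟨Quotient.mk P y, fun h' => hy (Quotient.exact h')⟩, rfl⟩
  have h1 := Fintype.card_of_bijective hf
  rw [Set.card_ne_eq] at h1
  have h2 : 0 < Fintype.card (Quotient P) := Fintype.card_pos_iff.2 ⟨j'⟩
  rw [Nat.card_eq_fintype_card, Nat.card_eq_fintype_card]
  omega

theorem card_quotient_le [Finite V] {P : Setoid V} {F : Finset (Sym2 V)}
    (h : P ⊔ edgeRel F = ⊤) : Nat.card (Quotient P) ≤ F.card + 1 := by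
  classical
  induction F using Finset.induction_on generalizing P with
  | empty =>
    rw [edgeRel_empty, sup_bot_eq] at h
    subst h
    have : Subsingleton (Quotient (⊤ : Setoid V)) := ⟨fun a b => by
      induction a using Quotient.inductionOn
      induction b using Quotient.inductionOn
      exact Quotient.sound trivial⟩
    have := Finite.card_le_one_iff_subsingleton.2 this
    simpa using this
  | insert e F he ih =>
    induction e using Sym2.inductionOn with | hf i j => ?_
    rw [edgeRel_insert, ← sup_assoc] at h
    have h1 := ih h
    rw [Finset.card_insert_of_notMem he]
    by_cases hij : P i j
    · rw [sup_edgeRel_of_rel hij] at h1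
      omega
    · rw [card_quotient_sup_edgeRel hij]
      omega

/-- The edges in `F` join the classes of `P` into a tree. -/
def IsTreeOver (P : Setoid V) (F : Finset (Sym2 V)) : Prop :=
  P ⊔ edgeRel F = ⊤ ∧ F.card + 1 = Nat.card (Quotient P)

theorem sup_edgeRel_erase [DecidableEq V] (P : Setoid V) {F : Finset (Sym2 V)} {e : Sym2 V}
    (he : e ∈ F) : P ⊔ edgeRel (F.erase e) ⊔ edgeRel {e} = P ⊔ edgeRel F := by
  conv_rhs => rw [← Finset.insert_erase he, edgeRel_insert]
  rw [sup_assoc, sup_comm (edgeRel {e})]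

/-- Otherwise the edge could be dropped, and too few edges would join all the classes, against
`card_quotient_le`. -/
theorem IsTreeOver.not_rel [Finite V] [DecidableEq V] {P : Setoid V} {F : Finset (Sym2 V)}
    (h : IsTreeOver P F) {i j : V} (he : s(i, j) ∈ F) :
    ¬ (P ⊔ edgeRel (F.erase s(i, j))) i j := by
  intro hij
  have h1 := sup_edgeRel_erase P he
  rw [sup_edgeRel_of_rel hij, h.1] at h1
  have h2 := card_quotient_le h1
  have h3 := Finset.card_erase_of_mem he
  have h4 := Finset.card_pos.2 ⟨_, he⟩
  have h5 := h.2
  omega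

theorem IsTreeOver.rel_or_rel [DecidableEq V] {P : Setoid V} {F : Finset (Sym2 V)}
    (h : IsTreeOver P F) {i j : V} (he : s(i, j) ∈ F) (x : V) :
    (P ⊔ edgeRel (F.erase s(i, j))) x i ∨ (P ⊔ edgeRel (F.erase s(i, j))) x j := by
  have h1 := sup_edgeRel_erase P he
  rw [h.1] at h1
  have h2 : (P ⊔ edgeRel (F.erase s(i, j)) ⊔ edgeRel {s(i, j)}) x i := by
    rw [h1]; trivial
  rcases (sup_edgeRel_apply _ i j x i).1 h2 with h2 | ⟨h2, _⟩ | ⟨h2, _⟩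
  · exact Or.inl h2
  · exact Or.inl h2
  · exact Or.inr h2

/-- The join of `P` with the relation that identifies `i`, `j` and `k`. -/
def joinTriple [DecidableEq V] (P : Setoid V) (i j k : V) : Setoid V :=
  P ⊔ edgeRel {s(i, j), s(i, k)}

theorem joinTriple_le_iff [DecidableEq V] {P r : Setoid V} {i j k : V} :
    joinTriple P i j k ≤ r ↔ P ≤ r ∧ r i j ∧ r i k := by
  rw [joinTriple, sup_le_iff, edgeRel_le_iff]
  refine and_congr_right fun _ => ⟨fun h => ⟨h _ _ (by simp), h _ _ (by simp)⟩, ?_⟩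
  rintro ⟨h1, h2⟩ a b hab
  rcases Finset.mem_insert.1 hab with h | h
  · rcases Sym2.eq_iff.1 h with ⟨rfl, rfl⟩ | ⟨rfl, rfl⟩
    · exact h1
    · exact r.symm' h1
  · rcases Sym2.eq_iff.1 (Finset.mem_singleton.1 h) with ⟨rfl, rfl⟩ | ⟨rfl, rfl⟩
    · exact h2
    · exact r.symm' h2

theorem joinTriple_rotate [DecidableEq V] (P : Setoid V) (i j k : V) :
    joinTriple P j k i = joinTriple P i j k := by
  refine eq_of_forall_ge_iff fun r => ?_
  rw [joinTriple_le_iff, joinTriple_le_iff]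
  refine and_congr_right fun _ => ⟨?_, ?_⟩
  · rintro ⟨h1, h2⟩
    exact ⟨r.symm' h2, r.trans' (r.symm' h2) h1⟩
  · rintro ⟨h1, h2⟩
    exact ⟨r.trans' (r.symm' h1) h2, r.symm' h1⟩

theorem le_joinTriple [DecidableEq V] (P : Setoid V) (i j k : V) : P ≤ joinTriple P i j k :=
  (joinTriple_le_iff.1 le_rfl).1

/-- The three elements lie in pairwise distinct classes. -/
def Separated (P : Setoid V) (i j k : V) : Prop := ¬ P i j ∧ ¬ P j k ∧ ¬ P k i

theorem Separated.rotate {P : Setoid V} {i j k : V} (h : Separated P i j k) :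
    Separated P j k i :=
  ⟨h.2.1, h.2.2, h.1⟩

theorem joinTriple_eq [DecidableEq V] (P : Setoid V) (i j k : V) :
    joinTriple P i j k = P ⊔ edgeRel {s(i, j)} ⊔ edgeRel {s(i, k)} := by
  rw [joinTriple, edgeRel_insert, sup_assoc]

theorem card_quotient_joinTriple [Finite V] [DecidableEq V] {P : Setoid V} {i j k : V}
    (h : Separated P i j k) :
    Nat.card (Quotient P) = Nat.card (Quotient (joinTriple P i j k)) + 2 := by
  have h1 : ¬ (P ⊔ edgeRel {s(i, j)}) i k := by
    rw [sup_edgeRel_apply]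
    rintro (h1 | ⟨_, h1⟩ | ⟨_, h1⟩)
    · exact h.2.2 (P.symm' h1)
    · exact h.2.1 h1
    · exact h.2.2 (P.symm' h1)
  rw [card_quotient_sup_edgeRel h.1, card_quotient_sup_edgeRel h1, joinTriple_eq]

theorem sup_edgeRel_insert_insert [DecidableEq V] (P : Setoid V) (i j k : V)
    (F : Finset (Sym2 V)) :
    P ⊔ edgeRel (insert s(i, j) (insert s(i, k) F)) = joinTriple P i j k ⊔ edgeRel F := by
  rw [edgeRel_insert, edgeRel_insert, joinTriple_eq, sup_assoc, sup_assoc]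

theorem IsTreeOver.notMem_of_rel [Finite V] [DecidableEq V] {P : Setoid V} {F : Finset (Sym2 V)}
    (h : IsTreeOver P F) {i j : V} (hij : P i j) : s(i, j) ∉ F := fun he =>
  h.not_rel he ((le_sup_left : P ≤ _) hij)

theorem IsTreeOver.separated [Finite V] [DecidableEq V] {P : Setoid V} {F : Finset (Sym2 V)}
    (h : IsTreeOver P F) {i j k : V} (hj : s(i, j) ∈ F) (hk : s(i, k) ∈ F)
    (hjk : s(i, k) ≠ s(i, j)) :
    Separated (P ⊔ edgeRel ((F.erase s(i, j)).erase s(i, k))) i j k := by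
  have h1 := h.not_rel hj
  have h2 := h.not_rel hk
  have hle1 : P ⊔ edgeRel ((F.erase s(i, j)).erase s(i, k)) ≤ P ⊔ edgeRel (F.erase s(i, j)) :=
    sup_le_sup_left (edgeRel_mono (Finset.erase_subset _ _)) _
  have hle2 : P ⊔ edgeRel ((F.erase s(i, j)).erase s(i, k)) ≤ P ⊔ edgeRel (F.erase s(i, k)) := by
    rw [Finset.erase_right_comm]
    exact sup_le_sup_left (edgeRel_mono (Finset.erase_subset _ _)) _
  have hik : (P ⊔ edgeRel (F.erase s(i, j))) i k :=
    (le_sup_right : edgeRel (F.erase s(i, j)) ≤ _)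
      (edgeRel_of_mem (Finset.mem_erase.2 ⟨hjk, hk⟩))
  refine ⟨fun h3 => h1 (hle1 h3), fun h3 => h1 ?_, fun h3 => h2 (hle2 (Setoid.symm' _ h3))⟩
  exact Setoid.trans' _ hik (Setoid.symm' _ (hle1 h3))

theorem Separated.mono {P Q : Setoid V} {i j k : V} (h : Separated Q i j k) (hPQ : P ≤ Q) :
    Separated P i j k :=
  ⟨fun h' => h.1 (hPQ h'), fun h' => h.2.1 (hPQ h'), fun h' => h.2.2 (hPQ h')⟩

/-- Contracting two adjacent edges removes two edges and two classes, so the edge count of a tree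
persists. `isTreeOver_insert_insert` is the inverse operation. -/
theorem isTreeOver_joinTriple [Finite V] [DecidableEq V] {P : Setoid V} {F : Finset (Sym2 V)}
    (h : IsTreeOver P F) {i j k : V} (hj : s(i, j) ∈ F) (hk : s(i, k) ∈ F)
    (hjk : s(i, k) ≠ s(i, j)) :
    IsTreeOver (joinTriple P i j k) ((F.erase s(i, j)).erase s(i, k)) := by
  have hk' : s(i, k) ∈ F.erase s(i, j) := Finset.mem_erase.2 ⟨hjk, hk⟩
  have hsep : Separated P i j k := (h.separated hj hk hjk).mono le_sup_left
  constructor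
  · rw [← sup_edgeRel_insert_insert, Finset.insert_erase hk', Finset.insert_erase hj, h.1]
  · have h1 := Finset.card_erase_add_one hj
    have h2 := Finset.card_erase_add_one hk'
    have h3 := h.2
    have h4 := card_quotient_joinTriple hsep
    omega

theorem joinTriple_rel_left [DecidableEq V] (P : Setoid V) (i j k : V) :
    joinTriple P i j k i j := (joinTriple_le_iff.1 le_rfl).2.1

theorem joinTriple_rel_right [DecidableEq V] (P : Setoid V) (i j k : V) :
    joinTriple P i j k i k := (joinTriple_le_iff.1 le_rfl).2.2

theorem Separated.edge_ne {P : Setoid V} {i j k : V} (h : Separated P i j k) :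
    s(i, k) ≠ s(i, j) := by
  intro h'
  have : k = j := by
    rcases Sym2.eq_iff.1 h' with ⟨_, h'⟩ | ⟨h', h''⟩
    · exact h'
    · exact h''.trans h'
  exact h.2.1 (this ▸ P.refl' _)

theorem isTreeOver_insert_insert [Finite V] [DecidableEq V] {P : Setoid V} {F : Finset (Sym2 V)}
    {i j k : V} (hs : Separated P i j k) (h : IsTreeOver (joinTriple P i j k) F) :
    IsTreeOver P (insert s(i, j) (insert s(i, k) F)) := by
  refine ⟨by rw [sup_edgeRel_insert_insert, h.1], ?_⟩
  have h1 := h.notMem_of_rel (joinTriple_rel_left P i j k)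
  have h2 := h.notMem_of_rel (joinTriple_rel_right P i j k)
  rw [Finset.card_insert_of_notMem, Finset.card_insert_of_notMem h2,
    card_quotient_joinTriple hs, ← h.2]
  rw [Finset.mem_insert, not_or]
  exact ⟨hs.edge_ne.symm, h1⟩

end Connectivity

end BPSTree

namespace BPSTree

/-! ### Signs attached to the edges of a forest. -/

section SignedForests

variable {V : Type} [Fintype V]

open Classical in
/-- The sum of `c` over the class of `i`. -/
noncomputable def classSum (c : V → ℝ) (Q : Setoid V) (i : V) : ℝ :=
  ∑ x ∈ Finset.univ.filter fun x => Q x i, c x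

/-- The vector of an edge together with the sign of the difference of the sums of `c` over the
classes of its two ends. -/
noncomputable def edgeWt {R : Type} [AddCommGroup R] [Module ℝ R] (c : V → ℝ) (w : V → V → R)
    (o : Sym2 V → V × V) (Q : Setoid V) (e : Sym2 V) : R :=
  Real.sign (classSum c Q (o e).1 - classSum c Q (o e).2) • w (o e).1 (o e).2

theorem sign_sub_comm (a b : ℝ) : Real.sign (a - b) = -Real.sign (b - a) := by
  rw [← Real.sign_neg, neg_sub]

open Classical in
/-- The sets of edges that join the classes of `P` into a tree. -/
noncomputable def treeSets (P : Setoid V) : Finset (Finset (Sym2 V)) :=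
  Finset.univ.filter (IsTreeOver P)

theorem mem_treeSets {P : Setoid V} {F : Finset (Sym2 V)} : F ∈ treeSets P ↔ IsTreeOver P F := by
  simp [treeSets]

/-- The signed sum over the sets of edges that join the classes of `P` into a tree. -/
noncomputable def forestSum [DecidableEq V] {R : Type} [CommRing R] [Algebra ℝ R] (c : V → ℝ)
    (w : V → V → R) (o : Sym2 V → V × V) (P : Setoid V) : R :=
  ∑ F ∈ treeSets P, ∏ e ∈ F, edgeWt c w o (P ⊔ edgeRel (F.erase e)) e

/-- No sum of `c` over a nonempty proper subset vanishes, but the total sum does. -/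
def IsGenericZeroSum (c : V → ℝ) : Prop :=
  ∑ x, c x = 0 ∧ ∀ I : Finset V, I.Nonempty → I ≠ Finset.univ → ∑ x ∈ I, c x ≠ 0

theorem classSum_add_classSum {c : V → ℝ} (hc : ∑ x, c x = 0) {Q : Setoid V} {i j : V}
    (hij : ¬ Q i j) (h : ∀ x, Q x i ∨ Q x j) : classSum c Q i + classSum c Q j = 0 := by
  classical
  rw [classSum, classSum, ← hc, ← Finset.sum_union]
  · refine Finset.sum_congr ?_ fun _ _ => rfl
    ext x
    simpa using h x
  · rw [Finset.disjoint_filter]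
    exact fun x _ h1 h2 => hij (Q.trans' (Q.symm' h1) h2)

theorem classSum_add_add {c : V → ℝ} (hc : ∑ x, c x = 0) {Q : Setoid V} {i j k : V}
    (hs : Separated Q i j k) (h : ∀ x, Q x i ∨ Q x j ∨ Q x k) :
    classSum c Q i + classSum c Q j + classSum c Q k = 0 := by
  classical
  rw [classSum, classSum, classSum, ← hc, ← Finset.sum_union, ← Finset.sum_union]
  · refine Finset.sum_congr ?_ fun _ _ => rfl
    ext x
    simpa [or_assoc] using h x
  · rw [Finset.disjoint_union_left, Finset.disjoint_filter, Finset.disjoint_filter]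
    exact ⟨fun x _ h1 h2 => hs.2.2 (Q.trans' (Q.symm' h2) h1),
      fun x _ h1 h2 => hs.2.1 (Q.trans' (Q.symm' h1) h2)⟩
  · rw [Finset.disjoint_filter]
    exact fun x _ h1 h2 => hs.1 (Q.trans' (Q.symm' h1) h2)

theorem classSum_ne_zero {c : V → ℝ} (hc : IsGenericZeroSum c) {Q : Setoid V} {i j : V}
    (hij : ¬ Q i j) : classSum c Q j ≠ 0 := by
  classical
  refine hc.2 _ ⟨j, by simp⟩ fun h => hij ?_
  have h1 := Finset.mem_univ i
  rw [← h] at h1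
  simpa using h1

/-- The edge from `i` to `k` does not touch the class of `j`. -/
theorem classSum_sup_edgeRel (c : V → ℝ) {Q : Setoid V} {i j k : V} (hs : Separated Q i j k) :
    classSum c (Q ⊔ edgeRel {s(i, k)}) j = classSum c Q j := by
  classical
  rw [classSum, classSum]
  refine Finset.sum_congr ?_ fun _ _ => rfl
  ext x
  simp only [Finset.mem_filter, Finset.mem_univ, true_and]
  rw [sup_edgeRel_apply]
  constructor
  · rintro (h | ⟨_, h⟩ | ⟨_, h⟩)
    · exact h
    · exact (hs.2.1 (Q.symm' h)).elim
    · exact (hs.1 h).elim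
  · exact Or.inl

theorem sign_sub_of_add_eq_zero {a b : ℝ} (h : a + b = 0) : Real.sign (a - b) = -Real.sign b := by
  have h1 : a - b = 2 * (-b) := by linarith
  rw [h1, real_sign_eq_coe, sign_mul, sign_pos two_pos, one_mul, ← real_sign_eq_coe, Real.sign_neg]

/-- The three signs cannot all agree: two are equal and the third is opposite, so the products are
1, -1, -1. This is the identity behind the contraction. -/
theorem sign_mul_sign_sum {a b c : ℝ} (h : a + b + c = 0) (ha : a ≠ 0) (hb : b ≠ 0) (hc : c ≠ 0) :
    Real.sign b * Real.sign c + Real.sign c * Real.sign a + Real.sign a * Real.sign b = -1 := by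
  rcases lt_or_gt_of_ne ha with ha | ha <;> rcases lt_or_gt_of_ne hb with hb | hb <;>
    rcases lt_or_gt_of_ne hc with hc | hc <;>
    simp only [Real.sign_of_neg, Real.sign_of_pos, ha, hb, hc] <;> linarith

/-- The sign attached to the edge from `i` to `j` of a tree that contains the edges from `i` to
`j` and to `k`, in terms of the forest without these two edges. -/
theorem sign_classSum_sub [DecidableEq V] {c : V → ℝ} (hc : ∑ x, c x = 0) {P : Setoid V}
    {F : Finset (Sym2 V)} (h : IsTreeOver P F) {i j k : V} (hj : s(i, j) ∈ F) (hk : s(i, k) ∈ F)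
    (hjk : s(i, k) ≠ s(i, j)) :
    Real.sign (classSum c (P ⊔ edgeRel (F.erase s(i, j))) i -
      classSum c (P ⊔ edgeRel (F.erase s(i, j))) j) =
      -Real.sign (classSum c (P ⊔ edgeRel ((F.erase s(i, j)).erase s(i, k))) j) := by
  rw [sign_sub_of_add_eq_zero (classSum_add_classSum hc (h.not_rel hj) (h.rel_or_rel hj))]
  have hk' : s(i, k) ∈ F.erase s(i, j) := Finset.mem_erase.2 ⟨hjk, hk⟩
  rw [← sup_edgeRel_erase P hk', classSum_sup_edgeRel c (h.separated hj hk hjk)]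

theorem IsTreeOver.rel_or_rel_or_rel {V : Type} [DecidableEq V] {P : Setoid V} {F : Finset (Sym2 V)}
    {i j k : V} (h : IsTreeOver (joinTriple P i j k) F) (x : V) :
    (P ⊔ edgeRel F) x i ∨ (P ⊔ edgeRel F) x j ∨ (P ⊔ edgeRel F) x k := by
  have h1 : joinTriple (P ⊔ edgeRel F) i j k = ⊤ := by
    rw [← h.1, joinTriple, joinTriple, sup_right_comm]
  rw [joinTriple_eq] at h1
  have h2 : (P ⊔ edgeRel F ⊔ edgeRel {s(i, j)} ⊔ edgeRel {s(i, k)}) x i := by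
    rw [h1]; trivial
  rcases (sup_edgeRel_apply _ i k x i).1 h2 with h2 | ⟨h2, _⟩ | ⟨h2, _⟩
  · rcases (sup_edgeRel_apply _ i j x i).1 h2 with h2 | ⟨h2, _⟩ | ⟨h2, _⟩
    exacts [Or.inl h2, Or.inl h2, Or.inr (Or.inl h2)]
  · rcases (sup_edgeRel_apply _ i j x i).1 h2 with h2 | ⟨h2, _⟩ | ⟨h2, _⟩
    exacts [Or.inl h2, Or.inl h2, Or.inr (Or.inl h2)]
  · rcases (sup_edgeRel_apply _ i j x k).1 h2 with h2 | ⟨h2, _⟩ | ⟨h2, _⟩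
    exacts [Or.inr (Or.inr h2), Or.inl h2, Or.inr (Or.inl h2)]

theorem sum_ite_mk_eq [DecidableEq V] {M : Type} [AddCommMonoid M] {x y : V} (hxy : x ≠ y) (i : V)
    (f : V → M) :
    ∑ j, (if s(i, j) = s(x, y) then f j else 0) =
      (if i = x then f y else 0) + (if i = y then f x else 0) := by
  have h : ∀ j, (if s(i, j) = s(x, y) then f j else 0) =
      (if i = x then (if j = y then f j else 0) else 0) +
        (if i = y then (if j = x then f j else 0) else 0) := by
    intro j
    by_cases h1 : i = x
    · subst h1
      by_cases h2 : j = y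
      · simp [h2, hxy]
      · simp [h2, hxy]
    · by_cases h2 : i = y
      · subst h2
        by_cases h3 : j = x
        · simp [h1, h3, Sym2.eq_swap]
        · simp [h1, h3]
      · simp [h1, h2]
  simp only [h, Finset.sum_add_distrib, Finset.sum_ite_irrel, Finset.sum_const_zero,
    Finset.sum_ite_eq', Finset.mem_univ, if_true]

end SignedForests

/-! ### The Laplace operator on signed tree sums. -/

section Contraction

open MvPolynomial

variable {V σ : Type} [Fintype V] [DecidableEq V] [Fintype σ]

/-- The vectors `z i j` pair like the vectors attached to pairs of charges with the symmetric
tensor `τ`. -/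
structure PairingData (g : σ → σ → ℝ) (z : V → V → σ → ℝ) (τ : V → V → V → ℝ) : Prop where
  gram_comm : ∀ s s', g s s' = g s' s
  pairing : ∀ i j k l, gramForm g (z i j) (z k l) =
    (if i = k then τ i j l else 0) - (if i = l then τ i j k else 0) -
      (if j = k then τ j i l else 0) + (if j = l then τ j i k else 0)
  rotate : ∀ i j k, τ j k i = τ i j k

theorem gramForm_smul_smul (g : σ → σ → ℝ) (a b : ℝ) (v w : σ → ℝ) :
    gramForm g (a • v) (b • w) = a * b * gramForm g v w := by
  simp only [gramForm, Finset.mul_sum, Pi.smul_apply, smul_eq_mul]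
  exact Finset.sum_congr rfl fun _ _ => Finset.sum_congr rfl fun _ _ => by ring

end Contraction

end BPSTree

namespace BPSTree

section Contraction

open MvPolynomial

variable {V σ : Type} [Fintype V] [DecidableEq V] [Fintype σ]

/-- Edges pair only if they share a vertex. The antisymmetric factors `a` and `a'` absorb the signs
of the orientation, so the pairing becomes a sum over the shared vertex `i` with the other ends `j`
and `k`. -/
theorem PairingData.pairing_eq_sum {g : σ → σ → ℝ} {z : V → V → σ → ℝ} {τ : V → V → V → ℝ}
    (hz : PairingData g z τ) {o : Sym2 V → V × V} (ho : IsOrientation o) {a a' : V → V → ℝ}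
    (ha : ∀ i j, a i j = -a j i) (ha' : ∀ i j, a' i j = -a' j i) {e e' : Sym2 V}
    (he : ¬ e.IsDiag) (he' : ¬ e'.IsDiag) :
    gramForm g (a (o e).1 (o e).2 • z (o e).1 (o e).2) (a' (o e').1 (o e').2 • z (o e').1 (o e').2) =
      ∑ i, ∑ j, ∑ k, if s(i, j) = e ∧ s(i, k) = e' then τ i j k * (a i j * a' i k) else 0 := by
  have h1 := ho e
  have h2 := ho e'
  set x := (o e).1
  set y := (o e).2
  set u := (o e').1
  set v := (o e').2
  have hxy : x ≠ y := by
    rw [← h1] at he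
    exact fun h => he (by simpa using h)
  have huv : u ≠ v := by
    rw [← h2] at he'
    exact fun h => he' (by simpa using h)
  rw [← h1, ← h2, gramForm_smul_smul, hz.pairing]
  simp only [ite_and, Finset.sum_ite_irrel, Finset.sum_const_zero, sum_ite_mk_eq huv,
    sum_ite_mk_eq hxy, Finset.sum_add_distrib, Finset.sum_ite_eq', Finset.mem_univ, if_true]
  rw [ha y x]
  by_cases hxu : x = u
  · have hxv : x ≠ v := hxu ▸ huv
    have hyu : y ≠ u := hxu ▸ hxy.symm
    by_cases hyv : y = v
    · simp only [hxu, hyv, if_true, huv, huv.symm, if_false]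
      rw [ha' v u]
      ring
    · simp only [hyu, hyv, if_false, hxu, if_true, huv]
      ring
  · by_cases hxv : x = v
    · have hyv : y ≠ v := hxv ▸ hxy.symm
      by_cases hyu : y = u
      · simp only [hxv, hyu, if_true, huv, huv.symm, if_false]
        rw [ha' v u]
        ring
      · simp only [hxv, hyu, if_true, huv.symm, hyv, if_false]
        rw [ha' v u]
        ring
    · by_cases hyu : y = u
      · simp only [hxu, hxv, hyu, if_true, huv, if_false]
        ring
      · by_cases hyv : y = v
        · simp only [hxu, hxv, hyv, if_true, huv.symm, if_false]
          rw [ha' v u]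
          ring
        · simp [hxu, hxv, hyu, hyv]

theorem linPoly_smul (r : ℝ) (v : σ → ℝ) : linPoly (r • v) = r • linPoly v := by
  simp only [linPoly, Pi.smul_apply, smul_eq_mul, C_mul, Finset.smul_sum, smul_eq_C_mul, mul_assoc]

theorem linPoly_neg (v : σ → ℝ) : linPoly (-v) = -linPoly v := by
  rw [← neg_one_smul ℝ v, linPoly_smul, neg_one_smul]

theorem IsTreeOver.not_isDiag {P : Setoid V} {F : Finset (Sym2 V)} (h : IsTreeOver P F)
    {e : Sym2 V} (he : e ∈ F) : ¬ e.IsDiag := by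
  induction e using Sym2.inductionOn with | hf i j => ?_
  intro hd
  have hd' : i = j := by simpa using hd
  subst hd'
  exact h.notMem_of_rel (P.refl' i) he

theorem sum_sum_erase_ite {V : Type} [DecidableEq V] {M : Type} [AddCommMonoid M] (F : Finset (Sym2 V)) (e₀ e₀' : Sym2 V)
    (X : Sym2 V → Sym2 V → M) :
    ∑ e ∈ F, ∑ e' ∈ F.erase e, (if e₀ = e ∧ e₀' = e' then X e e' else 0) =
      if e₀ ∈ F ∧ e₀' ∈ F.erase e₀ then X e₀ e₀' else 0 := by
  simp only [ite_and, Finset.sum_ite_irrel, Finset.sum_const_zero, Finset.sum_ite_eq]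

theorem lap_edgeProd {g : σ → σ → ℝ} {z : V → V → σ → ℝ} {τ : V → V → V → ℝ}
    (hz : PairingData g z τ) {o : Sym2 V → V × V} (ho : IsOrientation o) {c : V → ℝ}
    (hc : ∑ x, c x = 0) {P : Setoid V} {F : Finset (Sym2 V)} (hF : IsTreeOver P F) :
    lap g (∏ e ∈ F, edgeWt c (fun i j => linPoly (z i j)) o (P ⊔ edgeRel (F.erase e)) e) =
      ∑ i, ∑ j, ∑ k, if s(i, j) ∈ F ∧ s(i, k) ∈ F.erase s(i, j) then
        (τ i j k * (Real.sign (classSum c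
            (P ⊔ edgeRel ((F.erase s(i, j)).erase s(i, k))) j) * Real.sign (classSum c
            (P ⊔ edgeRel ((F.erase s(i, j)).erase s(i, k))) k))) •
          ∏ e ∈ (F.erase s(i, j)).erase s(i, k),
            edgeWt c (fun i j => linPoly (z i j)) o (P ⊔ edgeRel (F.erase e)) e else 0 := by
  set a : Sym2 V → V → V → ℝ := fun e i j => Real.sign
    (classSum c (P ⊔ edgeRel (F.erase e)) i - classSum c (P ⊔ edgeRel (F.erase e)) j) with ha
  have hwt : ∀ e, edgeWt c (fun i j => linPoly (z i j)) o (P ⊔ edgeRel (F.erase e)) e =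
      linPoly (a e (o e).1 (o e).2 • z (o e).1 (o e).2) := by
    intro e
    rw [linPoly_smul]
    rfl
  simp only [hwt]
  rw [lap_prod hz.gram_comm F]
  have hpair : ∀ e ∈ F, ∀ e' ∈ F.erase e,
      gramForm g (a e (o e).1 (o e).2 • z (o e).1 (o e).2)
        (a e' (o e').1 (o e').2 • z (o e').1 (o e').2) •
        (∏ e'' ∈ (F.erase e).erase e', linPoly (a e'' (o e'').1 (o e'').2 • z (o e'').1 (o e'').2)) =
      ∑ i, ∑ j, ∑ k, if s(i, j) = e ∧ s(i, k) = e' then (τ i j k * (a e i j * a e' i k)) •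
        (∏ e'' ∈ (F.erase e).erase e', linPoly (a e'' (o e'').1 (o e'').2 • z (o e'').1 (o e'').2))
        else 0 := by
    intro e he e' he'
    rw [hz.pairing_eq_sum ho (a := a e) (a' := a e') (fun i j => sign_sub_comm _ _) (fun i j => sign_sub_comm _ _)
      (hF.not_isDiag he) (hF.not_isDiag (Finset.mem_of_mem_erase he'))]
    simp only [Finset.sum_smul, ite_smul, zero_smul]
  rw [Finset.sum_congr rfl fun e he => Finset.sum_congr rfl fun e' he' => hpair e he e' he']
  have hswap : ∀ f : Sym2 V → Sym2 V → V → V → V → MvPolynomial σ ℝ,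
      ∑ e ∈ F, ∑ e' ∈ F.erase e, ∑ i, ∑ j, ∑ k, f e e' i j k =
      ∑ i, ∑ j, ∑ k, ∑ e ∈ F, ∑ e' ∈ F.erase e, f e e' i j k := by
    intro f
    simp only [Finset.sum_comm (s := F.erase _) (t := Finset.univ)]
    rw [Finset.sum_comm]
    refine Finset.sum_congr rfl fun i _ => ?_
    rw [Finset.sum_comm]
    refine Finset.sum_congr rfl fun j _ => ?_
    rw [Finset.sum_comm]
  rw [hswap]
  refine Finset.sum_congr rfl fun i _ => Finset.sum_congr rfl fun j _ =>
    Finset.sum_congr rfl fun k _ => ?_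
  rw [sum_sum_erase_ite F s(i, j) s(i, k) fun e e' => (τ i j k * (a e i j * a e' i k)) •
    ∏ e'' ∈ (F.erase e).erase e', linPoly (a e'' (o e'').1 (o e'').2 • z (o e'').1 (o e'').2)]
  split_ifs with h
  · obtain ⟨hj, hk'⟩ := h
    obtain ⟨hne, hk⟩ := Finset.mem_erase.1 hk'
    -- Each sign is minus that of the outer component, once both edges are removed; the two minus
    -- signs cancel in the product.
    have e1 : a s(i, j) i j = _ := sign_classSum_sub hc hF hj hk hne
    have e2 : a s(i, k) i k = _ := sign_classSum_sub hc hF hk hj hne.symm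
    rw [e1, e2, Finset.erase_right_comm (a := s(i, k)), neg_mul_neg]
  · rfl

/-- Removing the two edges is a bijection from the trees that contain them onto the trees over the
contracted relation. If two of the three vertices are already related, no tree contains both edges.
-/
theorem sum_joinTriple_eq {M : Type} [AddCommMonoid M] {P : Setoid V} (i j k : V)
    (Y : Finset (Sym2 V) → M) :
    ∑ F ∈ treeSets P, (if s(i, j) ∈ F ∧ s(i, k) ∈ F.erase s(i, j) then
        Y ((F.erase s(i, j)).erase s(i, k)) else 0) =
      open Classical in
      if Separated P i j k then ∑ F ∈ treeSets (joinTriple P i j k), Y F else 0 := by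
  classical
  rw [← Finset.sum_filter]
  by_cases hs : Separated P i j k
  · rw [if_pos hs]
    refine Finset.sum_nbij' (fun F => (F.erase s(i, j)).erase s(i, k))
      (fun F => insert s(i, j) (insert s(i, k) F)) ?_ ?_ ?_ ?_ fun _ _ => rfl
    · intro F hF
      obtain ⟨hF, hj, hk⟩ := by simpa only [Finset.mem_filter, mem_treeSets] using hF
      obtain ⟨hne, hk⟩ := Finset.mem_erase.1 hk
      exact mem_treeSets.2 (isTreeOver_joinTriple hF hj hk hne)
    · intro F hF
      have hF' := mem_treeSets.1 hF
      refine Finset.mem_filter.2 ⟨mem_treeSets.2 (isTreeOver_insert_insert hs hF'),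
        Finset.mem_insert_self _ _, Finset.mem_erase.2 ⟨hs.edge_ne, ?_⟩⟩
      exact Finset.mem_insert_of_mem (Finset.mem_insert_self _ _)
    · intro F hF
      obtain ⟨hF, hj, hk⟩ := by simpa only [Finset.mem_filter, mem_treeSets] using hF
      rw [Finset.insert_erase hk, Finset.insert_erase hj]
    · intro F hF
      have hF' := mem_treeSets.1 hF
      have h1 := hF'.notMem_of_rel (joinTriple_rel_left P i j k)
      have h2 := hF'.notMem_of_rel (joinTriple_rel_right P i j k)
      rw [Finset.erase_insert, Finset.erase_insert h2]
      rw [Finset.mem_insert, not_or]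
      exact ⟨hs.edge_ne.symm, h1⟩
  · rw [if_neg hs]
    refine Finset.sum_eq_zero fun F hF => (hs ?_).elim
    obtain ⟨hF, hj, hk⟩ := by simpa only [Finset.mem_filter, mem_treeSets] using hF
    obtain ⟨hne, hk⟩ := Finset.mem_erase.1 hk
    exact (hF.separated hj hk hne).mono le_sup_left

theorem sum_rotate {V M : Type} [Fintype V] [AddCommMonoid M] (f : V → V → V → M) :
    ∑ i, ∑ j, ∑ k, f j k i = ∑ i, ∑ j, ∑ k, f i j k := by
  rw [Finset.sum_comm]
  refine Finset.sum_congr rfl fun j _ => ?_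
  rw [Finset.sum_comm]

open Classical in
/-- The Laplace operator contracts three classes into one. -/
theorem lap_forestSum {g : σ → σ → ℝ} {z : V → V → σ → ℝ} {τ : V → V → V → ℝ}
    (hz : PairingData g z τ) {o : Sym2 V → V × V} (ho : IsOrientation o) {c : V → ℝ}
    (hc : IsGenericZeroSum c) (P : Setoid V) :
    (3 : ℝ) • lap g (forestSum c (fun i j => linPoly (z i j)) o P) =
      -∑ i, ∑ j, ∑ k, if Separated P i j k then
        τ i j k • forestSum c (fun i j => linPoly (z i j)) o (joinTriple P i j k) else 0 := by
  set w : V → V → MvPolynomial σ ℝ := fun i j => linPoly (z i j) with hw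
  set S : V → V → V → Finset (Sym2 V) → ℝ := fun i j k F =>
    Real.sign (classSum c (P ⊔ edgeRel F) j) * Real.sign (classSum c (P ⊔ edgeRel F) k) with hS
  set Y : V → V → V → Finset (Sym2 V) → MvPolynomial σ ℝ := fun i j k F =>
    ∏ e ∈ F, edgeWt c w o (joinTriple P i j k ⊔ edgeRel (F.erase e)) e with hY
  have hYrot : ∀ i j k, Y j k i = Y i j k := fun i j k => by simp only [hY, joinTriple_rotate]
  -- For the remaining edges the two removed ones only glue `i`, `j`, `k` together, so their weights
  -- are those of the contracted tree.
  have hprod : ∀ i j k (F : Finset (Sym2 V)), s(i, j) ∈ F → s(i, k) ∈ F.erase s(i, j) →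
      ∏ e ∈ (F.erase s(i, j)).erase s(i, k), edgeWt c w o (P ⊔ edgeRel (F.erase e)) e =
        Y i j k ((F.erase s(i, j)).erase s(i, k)) := by
    intro i j k F hj hk
    refine Finset.prod_congr rfl fun e he => ?_
    obtain ⟨he1, he'⟩ := Finset.mem_erase.1 he
    obtain ⟨he2, he3⟩ := Finset.mem_erase.1 he'
    rw [← sup_edgeRel_insert_insert]
    congr 3
    ext a
    simp only [Finset.mem_insert, Finset.mem_erase]
    have hk2 := (Finset.mem_erase.1 hk).2
    by_cases h1 : a = s(i, j)
    · simp [h1, hj, he2.symm]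
    · by_cases h2 : a = s(i, k)
      · simp [h2, hk2, he1.symm]
      · simp [h1, h2]
  have h1 : lap g (forestSum c w o P) = ∑ i, ∑ j, ∑ k, if Separated P i j k then
      ∑ F ∈ treeSets (joinTriple P i j k), (τ i j k * S i j k F) • Y i j k F else 0 := by
    have hF : ∀ F ∈ treeSets P,
        lap g (∏ e ∈ F, edgeWt c w o (P ⊔ edgeRel (F.erase e)) e) =
        ∑ i, ∑ j, ∑ k, if s(i, j) ∈ F ∧ s(i, k) ∈ F.erase s(i, j) then
          (τ i j k * S i j k ((F.erase s(i, j)).erase s(i, k))) •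
            Y i j k ((F.erase s(i, j)).erase s(i, k)) else 0 := by
      intro F hF
      rw [lap_edgeProd hz ho hc.1 (mem_treeSets.1 hF)]
      refine Finset.sum_congr rfl fun i _ => Finset.sum_congr rfl fun j _ =>
        Finset.sum_congr rfl fun k _ => ?_
      split_ifs with h
      · rw [hprod i j k F h.1 h.2]
      · rfl
    rw [forestSum, map_sum, Finset.sum_congr rfl hF, Finset.sum_comm]
    refine Finset.sum_congr rfl fun i _ => ?_
    rw [Finset.sum_comm]
    refine Finset.sum_congr rfl fun j _ => ?_
    rw [Finset.sum_comm]
    refine Finset.sum_congr rfl fun k _ => ?_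
    rw [sum_joinTriple_eq i j k fun F => (τ i j k * S i j k F) • Y i j k F]
  have hSsum : ∀ i j k, Separated P i j k → ∀ F ∈ treeSets (joinTriple P i j k),
      S i j k F + S j k i F + S k i j F = -1 := by
    intro i j k hs F hF
    have hF' := mem_treeSets.1 hF
    have hs' : Separated (P ⊔ edgeRel F) i j k := by
      have h2 := isTreeOver_insert_insert hs hF'
      have h3 := h2.separated (Finset.mem_insert_self _ _)
        (Finset.mem_insert_of_mem (Finset.mem_insert_self _ _)) hs.edge_ne
      have h4 := hF'.notMem_of_rel (joinTriple_rel_left P i j k)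
      have h5 := hF'.notMem_of_rel (joinTriple_rel_right P i j k)
      rwa [Finset.erase_insert (by
        rw [Finset.mem_insert, not_or]
        exact ⟨hs.edge_ne.symm, h4⟩), Finset.erase_insert h5] at h3
    exact sign_mul_sign_sum (classSum_add_add hc.1 hs' hF'.rel_or_rel_or_rel)
      (classSum_ne_zero hc hs'.2.2) (classSum_ne_zero hc hs'.1) (classSum_ne_zero hc hs'.2.1)
  set f : V → V → V → MvPolynomial σ ℝ := fun i j k => if Separated P i j k then
      ∑ F ∈ treeSets (joinTriple P i j k), (τ i j k * S i j k F) • Y i j k F else 0 with hf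
  -- Averaging over the cyclic rotations collects the three trees with `i`, `j` or `k` in the
  -- middle. Everything except the sign is invariant under rotation, and `hSsum` adds the signs up
  -- to -1.
  have h3 : (3 : ℝ) • ∑ i, ∑ j, ∑ k, f i j k =
      ∑ i, ∑ j, ∑ k, (f i j k + f j k i + f k i j) := by
    simp only [Finset.sum_add_distrib]
    rw [sum_rotate f, ← sum_rotate fun i j k => f k i j]
    module
  rw [h1, h3]
  simp only [← Finset.sum_neg_distrib]
  refine Finset.sum_congr rfl fun i _ => Finset.sum_congr rfl fun j _ =>
    Finset.sum_congr rfl fun k _ => ?_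
  by_cases hs : Separated P i j k
  · simp only [hf]
    rw [if_pos hs, if_pos hs.rotate, if_pos hs.rotate.rotate, if_pos hs, joinTriple_rotate P i j k,
      ← joinTriple_rotate P k i j, forestSum, Finset.smul_sum, ← Finset.sum_add_distrib,
      ← Finset.sum_add_distrib, ← Finset.sum_neg_distrib]
    refine Finset.sum_congr rfl fun F hF => ?_
    rw [hYrot i j k, ← hYrot k i j, hz.rotate i j k, ← hz.rotate k i j, ← add_smul, ← add_smul,
      ← mul_add, ← mul_add, hSsum i j k hs F hF, mul_neg_one, neg_smul]
  · have hs2 : ¬ Separated P j k i := fun h => hs h.rotate.rotate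
    have hs3 : ¬ Separated P k i j := fun h => hs h.rotate
    simp only [hf]
    rw [if_neg hs, if_neg hs2, if_neg hs3, if_neg hs]
    simp

end Contraction

end BPSTree

namespace BPSTree

/-! ### Trees over the fibers of a map as trees on its target. -/

section Blocks

variable {V W : Type}

/-- Expanding the product chooses one element in each fiber. Such a choice is encoded by the set `F`
of chosen elements: equal cardinalities force `g` to be injective on it. -/
theorem prod_sum_fiber {α β M : Type} [Fintype α] [DecidableEq α] [DecidableEq β] [CommRing M]
    (g : α → β) (S : Finset β) (φ : α → M) :
    ∏ y ∈ S, ∑ x ∈ Finset.univ.filter (fun x => g x = y), φ x =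
      ∑ F ∈ Finset.univ.filter (fun F : Finset α => F.image g = S ∧ F.card = S.card),
        ∏ x ∈ F, φ x := by
  induction S using Finset.induction_on with
  | empty =>
    rw [Finset.prod_empty, Finset.sum_eq_single ∅]
    · simp
    · intro F hF hne
      simp only [Finset.mem_filter, Finset.image_eq_empty] at hF
      exact (hne hF.2.1).elim
    · simp
  | insert y S hy ih =>
    rw [Finset.prod_insert hy, ih, Finset.sum_mul_sum, ← Finset.sum_product']
    have hnot : ∀ (x : α) (F : Finset α), g x = y → F.image g = S → x ∉ F := by
      intro x F hx hF hxF
      exact hy (hF ▸ hx ▸ Finset.mem_image_of_mem g hxF)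
    refine Finset.sum_bij (fun q _ => insert q.1 q.2) ?_ ?_ ?_ ?_
    · rintro ⟨x, F⟩ h
      simp only [Finset.mem_product, Finset.mem_filter, Finset.mem_univ, true_and] at h ⊢
      obtain ⟨hx, hF, hc⟩ := h
      rw [Finset.image_insert, hx, hF, Finset.card_insert_of_notMem (hnot x F hx hF),
        Finset.card_insert_of_notMem hy, hc]
      exact ⟨rfl, rfl⟩
    · rintro ⟨x, F⟩ h ⟨x', F'⟩ h' heq
      simp only [Finset.mem_product, Finset.mem_filter, Finset.mem_univ, true_and] at h h' heq
      obtain ⟨hx, hF, -⟩ := h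
      obtain ⟨hx', hF', -⟩ := h'
      have h1 : x = x' := by
        have h2 : x ∈ insert x' F' := heq ▸ Finset.mem_insert_self x F
        exact (Finset.mem_insert.1 h2).resolve_right (hnot x F' hx hF')
      subst h1
      have h3 : (insert x F).erase x = (insert x F').erase x := by rw [heq]
      rw [Finset.erase_insert (hnot x F hx hF), Finset.erase_insert (hnot x F' hx' hF')] at h3
      rw [h3]
    · intro F hF
      simp only [Finset.mem_filter, Finset.mem_univ, true_and] at hF
      obtain ⟨hF, hc⟩ := hF
      have hinj : Set.InjOn g F := Finset.card_image_iff.1 (by rw [hF, hc])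
      obtain ⟨x, hx, hgx⟩ := Finset.mem_image.1 (hF ▸ Finset.mem_insert_self y S)
      refine ⟨(x, F.erase x), ?_, Finset.insert_erase hx⟩
      simp only [Finset.mem_product, Finset.mem_filter, Finset.mem_univ, true_and]
      refine ⟨hgx, ?_, ?_⟩
      · rw [← Finset.erase_insert hy, ← hF, ← hgx]
        ext z
        simp only [Finset.mem_image, Finset.mem_erase]
        constructor
        · rintro ⟨u, ⟨hu, huF⟩, rfl⟩
          exact ⟨fun h => hu (hinj huF hx h), u, huF, rfl⟩
        · rintro ⟨hz, u, huF, rfl⟩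
          exact ⟨u, ⟨fun h => hz (by rw [h]), huF⟩, rfl⟩
      · rw [Finset.card_insert_of_notMem hy] at hc
        have := Finset.card_erase_add_one hx
        omega
    · rintro ⟨x, F⟩ h
      simp only [Finset.mem_product, Finset.mem_filter, Finset.mem_univ, true_and] at h
      rw [Finset.prod_insert (hnot x F h.1 h.2.1)]

theorem card_quotient_ker {f : V → W} (hf : Function.Surjective f) :
    Nat.card (Quotient (Setoid.ker f)) = Nat.card W :=
  Nat.card_congr (Setoid.quotientKerEquivOfSurjective f hf)

variable [DecidableEq W]

/-- The graph of the images of the edges in `F`. -/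
def imageGraph (f : V → W) (F : Finset (Sym2 V)) : SimpleGraph W :=
  SimpleGraph.fromEdgeSet (F.image (Sym2.map f) : Finset (Sym2 W))

theorem rel_iff_reachable (f : V → W) (F : Finset (Sym2 V)) (x y : V) :
    (Setoid.ker f ⊔ edgeRel F) x y ↔ (imageGraph f F).Reachable (f x) (f y) := by
  constructor
  · have h : Setoid.ker f ⊔ edgeRel F ≤ Setoid.comap f (imageGraph f F).reachableSetoid := by
      refine sup_le ?_ (edgeRel_le_iff.2 fun i j hij => ?_)
      · intro i j hij
        have hij' : f i = f j := hij
        change (imageGraph f F).Reachable (f i) (f j)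
        rw [hij']
      · change (imageGraph f F).Reachable (f i) (f j)
        by_cases hf : f i = f j
        · rw [hf]
        · refine SimpleGraph.Adj.reachable ?_
          rw [imageGraph, SimpleGraph.fromEdgeSet_adj]
          exact ⟨Finset.mem_image.2 ⟨_, hij, rfl⟩, hf⟩
    exact fun hxy => h hxy
  · intro h
    have h1 := (SimpleGraph.reachable_iff_reflTransGen _ _).1 h
    have key : ∀ B, Relation.ReflTransGen (imageGraph f F).Adj (f x) B → ∀ y, f y = B →
        (Setoid.ker f ⊔ edgeRel F) x y := by
      intro B hB
      induction hB with
      | refl =>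
        intro y hy
        exact (le_sup_left : Setoid.ker f ≤ _) (hy.symm : f x = f y)
      | @tail B B' _ hadj ih =>
        intro y hy
        rw [imageGraph, SimpleGraph.fromEdgeSet_adj] at hadj
        obtain ⟨e, he, heq⟩ := Finset.mem_image.1 (Finset.mem_coe.1 hadj.1)
        induction e using Sym2.inductionOn with | hf u v => ?_
        have huv : (Setoid.ker f ⊔ edgeRel F) u v :=
          (le_sup_right : edgeRel F ≤ _) (edgeRel_of_mem he)
        have hk : ∀ a b, f a = f b → (Setoid.ker f ⊔ edgeRel F) a b := fun a b hab =>
          (le_sup_left : Setoid.ker f ≤ _) hab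
        rw [Sym2.map_mk] at heq
        rcases Sym2.eq_iff.1 heq with ⟨h1, h2⟩ | ⟨h1, h2⟩
        · exact Setoid.trans' _ (ih u h1) (Setoid.trans' _ huv (hk v y (h2.trans hy.symm)))
        · exact Setoid.trans' _ (ih v h2) (Setoid.trans' _ (Setoid.symm' _ huv)
            (hk u y (h1.trans hy.symm)))
    exact key _ h1 y rfl

theorem edgeSet_imageGraph_subset (f : V → W) (F : Finset (Sym2 V)) :
    (imageGraph f F).edgeSet ⊆ (F.image (Sym2.map f) : Finset (Sym2 W)) := by
  rw [imageGraph, SimpleGraph.edgeSet_fromEdgeSet]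
  exact Set.sdiff_subset

theorem imageGraph_of_image_eq {f : V → W} {F : Finset (Sym2 V)} {T : SimpleGraph W}
    [Fintype T.edgeSet] (h : F.image (Sym2.map f) = T.edgeFinset) : imageGraph f F = T := by
  rw [imageGraph, h, SimpleGraph.coe_edgeFinset, SimpleGraph.fromEdgeSet_edgeSet]

theorem connected_imageGraph_iff [Nonempty V] {f : V → W} (hf : Function.Surjective f)
    (F : Finset (Sym2 V)) :
    (imageGraph f F).Connected ↔ Setoid.ker f ⊔ edgeRel F = ⊤ := by
  have : Nonempty W := ‹Nonempty V›.map f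
  rw [SimpleGraph.connected_iff, Setoid.eq_top_iff]
  constructor
  · intro h x y
    exact (rel_iff_reachable f F x y).2 (h.1 _ _)
  · refine fun h => ⟨fun A B => ?_, this⟩
    obtain ⟨x, rfl⟩ := hf A
    obtain ⟨y, rfl⟩ := hf B
    exact (rel_iff_reachable f F x y).1 (h x y)

theorem sum_fiber_mk [Fintype V] {M : Type} [AddCommMonoid M] (f : V → W) {A B : W} (hAB : A ≠ B)
    (φ : Sym2 V → M) :
    ∑ e ∈ Finset.univ.filter (fun e => Sym2.map f e = s(A, B)), φ e =
      ∑ x ∈ Finset.univ.filter (fun x => f x = A), ∑ y ∈ Finset.univ.filter (fun y => f y = B),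
        φ s(x, y) := by
  rw [← Finset.sum_product']
  symm
  refine Finset.sum_bij (fun q _ => s(q.1, q.2)) ?_ ?_ ?_ fun _ _ => rfl
  · rintro ⟨x, y⟩ h
    simp only [Finset.mem_product, Finset.mem_filter, Finset.mem_univ, true_and] at h ⊢
    rw [Sym2.map_mk, h.1, h.2]
  · rintro ⟨x, y⟩ h ⟨x', y'⟩ h' heq
    simp only [Finset.mem_product, Finset.mem_filter, Finset.mem_univ, true_and] at h h' heq
    rcases Sym2.eq_iff.1 heq with ⟨h1, h2⟩ | ⟨h1, h2⟩
    · rw [h1, h2]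
    · exact (hAB (by rw [← h.1, h1, h'.2])).elim
  · intro e he
    induction e using Sym2.inductionOn with | hf x y => ?_
    simp only [Finset.mem_filter, Finset.mem_univ, true_and, Sym2.map_mk] at he
    rcases Sym2.eq_iff.1 he with ⟨h1, h2⟩ | ⟨h1, h2⟩
    · exact ⟨(x, y), by simp [h1, h2], rfl⟩
    · exact ⟨(y, x), by simp [h1, h2], Sym2.eq_swap⟩

variable [Fintype W]

/-- The image graph is connected and so needs at least |W|-1 edges, while `F` has exactly that many.
Hence no two edges of `F` have the same image and none becomes a loop. -/
theorem IsTreeOver.image_eq [Nonempty V] {f : V → W} (hf : Function.Surjective f)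
    {F : Finset (Sym2 V)} (h : IsTreeOver (Setoid.ker f) F) [Fintype (imageGraph f F).edgeSet] :
    (imageGraph f F).IsTree ∧ F.image (Sym2.map f) = (imageGraph f F).edgeFinset ∧
      F.card = (imageGraph f F).edgeFinset.card := by
  have hconn := (connected_imageGraph_iff hf F).2 h.1
  have h1 := hconn.card_vert_le_card_edgeSet_add_one
  have h2 := h.2
  rw [card_quotient_ker hf] at h2
  have hsub : (imageGraph f F).edgeFinset ⊆ F.image (Sym2.map f) := by
    intro e he
    exact Finset.mem_coe.1 (edgeSet_imageGraph_subset f F (SimpleGraph.mem_edgeFinset.1 he))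
  have h3 := Finset.card_le_card hsub
  have h4 := Finset.card_image_le (s := F) (f := Sym2.map f)
  have h5 : Nat.card (imageGraph f F).edgeSet = (imageGraph f F).edgeFinset.card := by
    rw [SimpleGraph.edgeFinset_card, Nat.card_eq_fintype_card]
  refine ⟨SimpleGraph.isTree_iff_connected_and_card.2 ⟨hconn, by omega⟩,
    (Finset.eq_of_subset_of_card_le hsub (by omega)).symm, by omega⟩

theorem isTreeOver_of_image_eq [Nonempty V] {f : V → W} (hf : Function.Surjective f)
    {F : Finset (Sym2 V)} {T : SimpleGraph W} [Fintype T.edgeSet] (hT : T.IsTree)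
    (h : F.image (Sym2.map f) = T.edgeFinset) (hc : F.card = T.edgeFinset.card) :
    IsTreeOver (Setoid.ker f) F := by
  have h1 := imageGraph_of_image_eq h
  refine ⟨(connected_imageGraph_iff hf F).1 (h1 ▸ hT.connected), ?_⟩
  have h2 := (SimpleGraph.isTree_iff_connected_and_card.1 hT).2
  rw [card_quotient_ker hf, ← h2, hc, SimpleGraph.edgeFinset_card, Nat.card_eq_fintype_card]

variable [Fintype V]

/-- The sum of `c` over the elements mapped to one of the vertices on one side of an edge. -/
noncomputable def sideSum (f : V → W) (c : V → ℝ) (T : SimpleGraph W) (e : Sym2 W) (A : W) : ℝ :=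
  ∑ B ∈ side T e A, ∑ x ∈ Finset.univ.filter (fun x => f x = B), c x

/-- As the edges of `F` have distinct images, erasing one of them deletes exactly its image from
`T`. -/
theorem classSum_eq_sideSum [DecidableEq V] {f : V → W} (c : V → ℝ) {F : Finset (Sym2 V)} {T : SimpleGraph W}
    [Fintype T.edgeSet] (h : F.image (Sym2.map f) = T.edgeFinset)
    (hc : F.card = T.edgeFinset.card) {e : Sym2 V} (he : e ∈ F) (x : V) :
    classSum c (Setoid.ker f ⊔ edgeRel (F.erase e)) x = sideSum f c T (Sym2.map f e) (f x) := by
  classical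
  have hinj : Set.InjOn (Sym2.map f) F := Finset.card_image_iff.1 (by rw [h, hc])
  have hG : imageGraph f (F.erase e) = T.deleteEdges {Sym2.map f e} := by
    ext A B
    rw [imageGraph, SimpleGraph.fromEdgeSet_adj, SimpleGraph.deleteEdges_adj, ← SimpleGraph.mem_edgeSet,
      ← SimpleGraph.mem_edgeFinset, ← h, Finset.mem_coe, Finset.mem_image, Finset.mem_image]
    constructor
    · rintro ⟨⟨e', he', heq⟩, -⟩
      obtain ⟨hne, he'F⟩ := Finset.mem_erase.1 he'
      exact ⟨⟨e', he'F, heq⟩, fun h' => hne (hinj he'F he (heq.trans h'))⟩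
    · rintro ⟨⟨e', he'F, heq⟩, hne⟩
      refine ⟨⟨e', Finset.mem_erase.2 ⟨fun h' => hne (by rw [← heq, h']; rfl), he'F⟩, heq⟩, ?_⟩
      rintro rfl
      have h2 : Sym2.map f e' ∈ T.edgeFinset := h ▸ Finset.mem_image_of_mem _ he'F
      rw [heq, SimpleGraph.mem_edgeFinset, SimpleGraph.mem_edgeSet] at h2
      exact T.loopless.irrefl _ h2
  rw [classSum, sideSum, Finset.sum_fiberwise_eq_sum_filter]
  refine Finset.sum_congr ?_ fun _ _ => rfl
  ext u
  simp only [Finset.mem_filter, Finset.mem_univ, true_and, mem_side, rel_iff_reachable, hG]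
  exact ⟨fun h => h.symm, fun h => h.symm⟩

open Classical in
/-- The signed sum over the sets of edges that join the fibers of `f` into a tree is a sum over
the trees on the set of fibers. -/
theorem forestSum_ker [DecidableEq V] [Nonempty V] {R : Type} [CommRing R] [Algebra ℝ R] {f : V → W}
    (hf : Function.Surjective f) (c : V → ℝ) {w : V → V → R} (hw : ∀ i j, w i j = -w j i)
    {o : Sym2 V → V × V} (ho : IsOrientation o) {oW : SimpleGraph W → Sym2 W → W × W}
    (hoW : ∀ T, IsOrientation (oW T)) :
    forestSum c w o (Setoid.ker f) = ∑ T ∈ trees W, ∏ e ∈ T.edgeFinset,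
      Real.sign (sideSum f c T e (oW T e).1 - sideSum f c T e (oW T e).2) •
        ∑ x ∈ Finset.univ.filter (fun x => f x = (oW T e).1),
          ∑ y ∈ Finset.univ.filter (fun y => f y = (oW T e).2), w x y := by
  have hmaps : ∀ F ∈ treeSets (Setoid.ker f), imageGraph f F ∈ trees W := fun F hF =>
    mem_trees.2 (IsTreeOver.image_eq hf (mem_treeSets.1 hF)).1
  rw [forestSum, ← Finset.sum_fiberwise_of_maps_to hmaps]
  refine Finset.sum_congr rfl fun T hT => ?_
  -- The sets `F` lying over a given tree `T` are the choices of one preimage for each edge of `T`,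
  -- which is the index set of `prod_sum_fiber`.
  have hfil : (treeSets (Setoid.ker f)).filter (fun F => imageGraph f F = T) =
      Finset.univ.filter (fun F : Finset (Sym2 V) =>
        F.image (Sym2.map f) = T.edgeFinset ∧ F.card = T.edgeFinset.card) := by
    ext F
    simp only [Finset.mem_filter, Finset.mem_univ, true_and, mem_treeSets]
    constructor
    · rintro ⟨h, rfl⟩
      exact (IsTreeOver.image_eq hf h).2
    · rintro ⟨h1, h2⟩
      exact ⟨isTreeOver_of_image_eq hf (mem_trees.1 hT) h1 h2, imageGraph_of_image_eq h1⟩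
  let φ : Sym2 V → R := fun e => Real.sign (sideSum f c T (Sym2.map f e) (f (o e).1) -
    sideSum f c T (Sym2.map f e) (f (o e).2)) • w (o e).1 (o e).2
  -- Both the sign and `w` change sign when the ends are exchanged, so the orientation `o` is
  -- immaterial.
  have hφ : ∀ x y, φ s(x, y) = Real.sign (sideSum f c T s(f x, f y) (f x) -
      sideSum f c T s(f x, f y) (f y)) • w x y := by
    intro x y
    simp only [φ, Sym2.map_mk]
    rcases Sym2.eq_iff.1 (ho s(x, y)) with ⟨h1, h2⟩ | ⟨h1, h2⟩
    · rw [h1, h2]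
    · rw [h1, h2, sign_sub_comm, hw, neg_smul_neg]
  rw [hfil]
  have h1 : ∀ F ∈ Finset.univ.filter (fun F : Finset (Sym2 V) =>
      F.image (Sym2.map f) = T.edgeFinset ∧ F.card = T.edgeFinset.card),
      ∏ e ∈ F, edgeWt c w o (Setoid.ker f ⊔ edgeRel (F.erase e)) e = ∏ e ∈ F, φ e := by
    intro F hF
    simp only [Finset.mem_filter, Finset.mem_univ, true_and] at hF
    refine Finset.prod_congr rfl fun e he => ?_
    rw [edgeWt, classSum_eq_sideSum c hF.1 hF.2 he, classSum_eq_sideSum c hF.1 hF.2 he]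
  rw [Finset.sum_congr rfl h1, ← prod_sum_fiber]
  refine Finset.prod_congr rfl fun e he => ?_
  have hne : (oW T e).1 ≠ (oW T e).2 := by
    have h2 := SimpleGraph.mem_edgeFinset.1 he
    rw [← hoW T e, SimpleGraph.mem_edgeSet] at h2
    exact h2.ne
  have h3 : (fun e' : Sym2 V => Sym2.map f e' = e) =
      fun e' => Sym2.map f e' = s((oW T e).1, (oW T e).2) := by rw [hoW T e]
  simp only [h3]
  rw [sum_fiber_mk f hne, Finset.smul_sum]
  refine Finset.sum_congr rfl fun x hx => ?_
  rw [Finset.smul_sum]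
  refine Finset.sum_congr rfl fun y hy => ?_
  have hx' := (Finset.mem_filter.1 hx).2
  have hy' := (Finset.mem_filter.1 hy).2
  rw [hφ, hx', hy', hoW T e]

end Blocks

end BPSTree

namespace BPSTree

/-! ### Ternary trees and the weights of the marks. -/

namespace TernaryTree

theorem card_leaves {ι : Type} (t : TernaryTree ι) : t.leaves.card = 2 * t.numVertices + 1 := by
  induction t with
  | leaf i => simp [leaves, numVertices]
  | node t₁ t₂ t₃ h₁ h₂ h₃ =>
    simp only [leaves, numVertices, Multiset.card_add]
    omega

theorem charge_eq_sum {ι : Type} {b : ℕ} (p : ι → Fin b → ℝ) (t : TernaryTree ι) :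
    t.charge p = (t.leaves.map p).sum := by
  induction t with
  | leaf i => simp [leaves, charge]
  | node t₁ t₂ t₃ h₁ h₂ h₃ =>
    simp only [leaves, charge, Multiset.map_add, Multiset.sum_add, h₁, h₂, h₃]

theorem minLeaf_mem {ι : Type} [LinearOrder ι] (t : TernaryTree ι) : t.minLeaf ∈ t.leaves := by
  induction t with
  | leaf i => simp [leaves, minLeaf]
  | node t₁ t₂ t₃ h₁ h₂ h₃ =>
    simp only [leaves, minLeaf, Multiset.mem_add]
    rcases min_choice t₁.minLeaf (min t₂.minLeaf t₃.minLeaf) with h | h <;> rw [h]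
    · exact Or.inl (Or.inl h₁)
    · rcases min_choice t₂.minLeaf t₃.minLeaf with h | h <;> rw [h]
      · exact Or.inl (Or.inr h₂)
      · exact Or.inr h₃

theorem minLeaf_le {ι : Type} [LinearOrder ι] (t : TernaryTree ι) :
    ∀ i ∈ t.leaves, t.minLeaf ≤ i := by
  induction t with
  | leaf i => simp [leaves, minLeaf]
  | node t₁ t₂ t₃ h₁ h₂ h₃ =>
    intro i hi
    simp only [leaves, Multiset.mem_add] at hi
    simp only [minLeaf, min_le_iff]
    rcases hi with (hi | hi) | hi
    · exact Or.inl (h₁ i hi)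
    · exact Or.inr (Or.inl (h₂ i hi))
    · exact Or.inr (Or.inr (h₃ i hi))

theorem min_eq_minLeaf {ι : Type} [LinearOrder ι] {t : TernaryTree ι} {A : Finset ι}
    (h : t.leaves = A.val) : A.min = t.minLeaf := by
  refine le_antisymm (Finset.min_le ?_) (Finset.le_min fun i hi => ?_)
  · rw [← Finset.mem_val, ← h]
    exact t.minLeaf_mem
  · exact WithTop.coe_le_coe.2 (t.minLeaf_le i (by rwa [h]))

theorem charge_eq {ι : Type} {b : ℕ} (p : ι → Fin b → ℝ) {t : TernaryTree ι} {A : Finset ι}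
    (h : t.leaves = A.val) : t.charge p = ∑ i ∈ A, p i := by
  rw [charge_eq_sum, h]
  rfl

theorem factorial_ne_zero {ι : Type} (t : TernaryTree ι) : t.factorial ≠ 0 := by
  induction t with
  | leaf i => simp [factorial]
  | node t₁ t₂ t₃ h₁ h₂ h₃ =>
    simp only [factorial, numVertices]
    have : 1 + t₁.numVertices + t₂.numVertices + t₃.numVertices ≠ 0 := by omega
    simp [*]

end TernaryTree

theorem mem_toFinset_ternaryTreeSet {n : ℕ} {A : Finset (Fin n)} {t : TernaryTree (Fin n)} :
    t ∈ (finite_ternaryTreeSet A).toFinset ↔ t.leaves = A.val ∧ t.Sorted := by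
  rw [Set.Finite.mem_toFinset]
  rfl

theorem markWeight_eq_zero {n b : ℕ} (κ : Fin b → Fin b → Fin b → ℝ) (p : Fin n → Fin b → ℝ)
    {A : Finset (Fin n)} (hA : ¬ Odd A.card) : markWeight κ p A = 0 := by
  rw [markWeight]
  refine Finset.sum_eq_zero fun t ht => ?_
  have h := (mem_toFinset_ternaryTreeSet.1 ht).1
  refine (hA ⟨t.numVertices, ?_⟩).elim
  rw [← t.card_leaves, h]
  rfl

theorem markWeight_singleton {n b : ℕ} (κ : Fin b → Fin b → Fin b → ℝ) (p : Fin n → Fin b → ℝ)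
    (i : Fin n) : markWeight κ p {i} = 1 := by
  rw [markWeight, Finset.sum_eq_single (TernaryTree.leaf i)]
  · simp [TernaryTree.factorial, TernaryTree.weight]
  · intro t ht hne
    have h := (mem_toFinset_ternaryTreeSet.1 ht).1
    cases t with
    | leaf j => simp_all [TernaryTree.leaves]
    | node t₁ t₂ t₃ =>
      have h1 := congrArg Multiset.card h
      rw [TernaryTree.card_leaves] at h1
      simp only [TernaryTree.numVertices, Finset.singleton_val, Multiset.card_singleton] at h1
      omega
  · intro h
    exact (h (mem_toFinset_ternaryTreeSet.2 ⟨rfl, trivial⟩)).elim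

/-- The decompositions of a set into three parts that are listed by increasing smallest element
are the decompositions at the root of a ternary tree. -/
theorem card_mul_markWeight {n b : ℕ} (κ : Fin b → Fin b → Fin b → ℝ) (p : Fin n → Fin b → ℝ)
    (B : Finset (Fin n)) :
    (((B.card - 1) / 2 : ℕ) : ℝ) * markWeight κ p B =
      ∑ q ∈ Finset.univ.filter (fun q : Finset (Fin n) × Finset (Fin n) × Finset (Fin n) =>
          q.1.val + q.2.1.val + q.2.2.val = B.val ∧ q.1.min < q.2.1.min ∧ q.2.1.min < q.2.2.min),
        cubic κ (∑ i ∈ q.1, p i) (∑ i ∈ q.2.1, p i) (∑ i ∈ q.2.2, p i) *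
          (markWeight κ p q.1 * (markWeight κ p q.2.1 * markWeight κ p q.2.2)) := by
  classical
  have h1 : (((B.card - 1) / 2 : ℕ) : ℝ) * markWeight κ p B =
      ∑ t ∈ (finite_ternaryTreeSet B).toFinset,
        (t.numVertices : ℝ) * (1 / (t.factorial : ℝ) * t.weight κ p) := by
    rw [markWeight, Finset.mul_sum]
    refine Finset.sum_congr rfl fun t ht => ?_
    have h := t.card_leaves
    rw [(mem_toFinset_ternaryTreeSet.1 ht).1] at h
    have h' : B.card = 2 * t.numVertices + 1 := h
    have h2 : (B.card - 1) / 2 = t.numVertices := by omega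
    rw [h2]
  rw [h1]
  have h2 : ∀ s₁ s₂ s₃ : Finset (TernaryTree (Fin n)), ∀ (a : ℝ) (φ : TernaryTree (Fin n) → ℝ),
      a * ((∑ t ∈ s₁, φ t) * ((∑ t ∈ s₂, φ t) * ∑ t ∈ s₃, φ t)) =
        ∑ t ∈ s₁ ×ˢ s₂ ×ˢ s₃, a * (φ t.1 * (φ t.2.1 * φ t.2.2)) := by
    intro s₁ s₂ s₃ a φ
    rw [← Finset.mul_sum, Finset.sum_product]
    simp only [← Finset.mul_sum, Finset.sum_product, ← Finset.sum_mul]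
  simp only [markWeight, h2]
  rw [Finset.sum_sigma']
  symm
  refine Finset.sum_of_injOn (fun q => TernaryTree.node q.2.1 q.2.2.1 q.2.2.2) ?_ ?_ ?_ ?_
  · rintro ⟨⟨A₁, A₂, A₃⟩, t₁, t₂, t₃⟩ h ⟨⟨A₁', A₂', A₃'⟩, t₁', t₂', t₃'⟩ h' heq
    simp only [Finset.mem_coe, Finset.mem_sigma, Finset.mem_filter, Finset.mem_univ, true_and,
      Finset.mem_product, mem_toFinset_ternaryTreeSet] at h h'
    simp only [TernaryTree.node.injEq] at heq
    obtain ⟨rfl, rfl, rfl⟩ := heq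
    have e1 : A₁ = A₁' := Finset.val_inj.1 (h.2.1.1.symm.trans h'.2.1.1)
    have e2 : A₂ = A₂' := Finset.val_inj.1 (h.2.2.1.1.symm.trans h'.2.2.1.1)
    have e3 : A₃ = A₃' := Finset.val_inj.1 (h.2.2.2.1.symm.trans h'.2.2.2.1)
    rw [e1, e2, e3]
  · rintro ⟨⟨A₁, A₂, A₃⟩, t₁, t₂, t₃⟩ h
    simp only [Finset.mem_coe, Finset.mem_sigma, Finset.mem_filter, Finset.mem_univ, true_and,
      Finset.mem_product, mem_toFinset_ternaryTreeSet] at h ⊢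
    obtain ⟨⟨hs, h12, h23⟩, ⟨l1, s1⟩, ⟨l2, s2⟩, l3, s3⟩ := h
    rw [TernaryTree.min_eq_minLeaf l1, TernaryTree.min_eq_minLeaf l2] at h12
    rw [TernaryTree.min_eq_minLeaf l2, TernaryTree.min_eq_minLeaf l3] at h23
    refine ⟨?_, WithTop.coe_lt_coe.1 h12, WithTop.coe_lt_coe.1 h23, s1, s2, s3⟩
    rw [TernaryTree.leaves, l1, l2, l3, hs]
  · intro t ht hnot
    have ht' := mem_toFinset_ternaryTreeSet.1 ht
    cases t with
    -- A single leaf has no decomposition at the root; its term is killed by the factor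
    -- `numVertices` = 0.
    | leaf i => simp [TernaryTree.numVertices]
    | node t₁ t₂ t₃ =>
      refine (hnot ?_).elim
      obtain ⟨hl, h12, h23, s1, s2, s3⟩ := ht'
      have hnd : (t₁.leaves + t₂.leaves + t₃.leaves).Nodup := by
        have h := B.nodup
        rw [← hl] at h
        exact h
      have n1 : t₁.leaves.Nodup := Multiset.nodup_of_le ((Multiset.le_add_right _ _).trans (Multiset.le_add_right _ _)) hnd
      have n2 : t₂.leaves.Nodup := Multiset.nodup_of_le ((Multiset.le_add_left _ _).trans (Multiset.le_add_right _ _)) hnd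
      have n3 : t₃.leaves.Nodup := Multiset.nodup_of_le (Multiset.le_add_left _ _) hnd
      refine ⟨⟨⟨⟨t₁.leaves, n1⟩, ⟨t₂.leaves, n2⟩, ⟨t₃.leaves, n3⟩⟩, t₁, t₂, t₃⟩, ?_, rfl⟩
      simp only [Finset.mem_coe, Finset.mem_sigma, Finset.mem_filter, Finset.mem_univ, true_and,
        Finset.mem_product, mem_toFinset_ternaryTreeSet]
      refine ⟨⟨hl, ?_, ?_⟩, s1, s2, s3⟩
      · rw [TernaryTree.min_eq_minLeaf (t := t₁) rfl, TernaryTree.min_eq_minLeaf (t := t₂) rfl]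
        exact WithTop.coe_lt_coe.2 h12
      · rw [TernaryTree.min_eq_minLeaf (t := t₂) rfl, TernaryTree.min_eq_minLeaf (t := t₃) rfl]
        exact WithTop.coe_lt_coe.2 h23
  · rintro ⟨⟨A₁, A₂, A₃⟩, t₁, t₂, t₃⟩ h
    simp only [Finset.mem_sigma, Finset.mem_filter, Finset.mem_univ, true_and,
      Finset.mem_product, mem_toFinset_ternaryTreeSet] at h
    obtain ⟨-, ⟨l1, -⟩, ⟨l2, -⟩, l3, -⟩ := h
    simp only [TernaryTree.factorial, TernaryTree.weight, TernaryTree.charge_eq p l1,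
      TernaryTree.charge_eq p l2, TernaryTree.charge_eq p l3, Nat.cast_mul]
    have f1 : (t₁.factorial : ℝ) ≠ 0 := Nat.cast_ne_zero.2 t₁.factorial_ne_zero
    have f2 : (t₂.factorial : ℝ) ≠ 0 := Nat.cast_ne_zero.2 t₂.factorial_ne_zero
    have f3 : (t₃.factorial : ℝ) ≠ 0 := Nat.cast_ne_zero.2 t₃.factorial_ne_zero
    have f0 : (((TernaryTree.node t₁ t₂ t₃).numVertices : ℕ) : ℝ) ≠ 0 := by
      rw [Nat.cast_ne_zero, TernaryTree.numVertices]
      omega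
    -- The factor `numVertices` cancels the root factor of the tree factorial, and what remains is
    -- the product over the three subtrees.
    field_simp

/-- A symmetric function of three variables that vanishes unless the keys of the variables are
distinct, is summed up to a factor by listing the variables by increasing key. -/
theorem sum_eq_six_mul_sum_sorted {α β : Type} [Fintype α] [LinearOrder β] (r : α → β)
    (H : α → α → α → ℝ) (h₁ : ∀ x y z, H x y z = H y x z) (h₂ : ∀ x y z, H x y z = H x z y)
    (h₀ : ∀ x y z, r x = r y → H x y z = 0) :
    ∑ x, ∑ y, ∑ z, H x y z =
      6 * ∑ x, ∑ y, ∑ z, if r x < r y ∧ r y < r z then H x y z else 0 := by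
  -- If the keys are distinct, exactly one of the six orders holds; otherwise both sides vanish.
  have key : ∀ x y z, H x y z =
      (if r x < r y ∧ r y < r z then H x y z else 0) +
      (if r x < r z ∧ r z < r y then H x z y else 0) +
      (if r y < r x ∧ r x < r z then H y x z else 0) +
      (if r y < r z ∧ r z < r x then H y z x else 0) +
      (if r z < r x ∧ r x < r y then H z x y else 0) +
      (if r z < r y ∧ r y < r x then H z y x else 0) := by
    intro x y z
    rw [h₂ x z y, h₁ y x z, h₂ y z x, h₁ y x z, h₁ z x y, h₂ x z y, h₁ z y x, h₂ y z x, h₁ y x z]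
    by_cases hxy : r x = r y
    · simp [h₀ x y z hxy]
    by_cases hxz : r x = r z
    · simp [h₂ x y z, h₀ x z y hxz]
    by_cases hyz : r y = r z
    · simp [h₁ x y z, h₂ y x z, h₀ y z x hyz]
    rcases lt_or_gt_of_ne hxy with a | a <;> rcases lt_or_gt_of_ne hxz with c | c <;>
      rcases lt_or_gt_of_ne hyz with d | d <;>
      first
      | exact absurd (lt_trans a (lt_trans d c)) (lt_irrefl _)
      | exact absurd (lt_trans c (lt_trans d a)) (lt_irrefl _)
      | simp [a, c, d, not_lt_of_gt a, not_lt_of_gt c, not_lt_of_gt d]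
  set G : α → α → α → ℝ := fun x y z => if r x < r y ∧ r y < r z then H x y z else 0 with hG
  have key' : ∀ x y z, H x y z = G x y z + G x z y + G y x z + G y z x + G z x y + G z y x := key
  have s1 : ∑ x, ∑ y, ∑ z, G x z y = ∑ x, ∑ y, ∑ z, G x y z :=
    Finset.sum_congr rfl fun _ _ => Finset.sum_comm
  have s2 : ∑ x, ∑ y, ∑ z, G y x z = ∑ x, ∑ y, ∑ z, G x y z := Finset.sum_comm
  have s3 : ∑ x, ∑ y, ∑ z, G y z x = ∑ x, ∑ y, ∑ z, G x y z := by
    rw [Finset.sum_comm]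
    exact Finset.sum_congr rfl fun _ _ => Finset.sum_comm
  have s4 : ∑ x, ∑ y, ∑ z, G z x y = ∑ x, ∑ y, ∑ z, G x y z := by
    rw [← s2]
    exact Finset.sum_congr rfl fun _ _ => Finset.sum_comm
  have s5 : ∑ x, ∑ y, ∑ z, G z y x = ∑ x, ∑ y, ∑ z, G x y z := by
    rw [← s3]
    exact Finset.sum_congr rfl fun _ _ => Finset.sum_comm
  change _ = 6 * ∑ x, ∑ y, ∑ z, G x y z
  simp only [key', Finset.sum_add_distrib, s1, s2, s3, s4, s5]
  ring

end BPSTree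

namespace BPSTree

/-! ### Odd triples and the recursion for the weights. -/

theorem val_add_add_eq_iff {V : Type} [DecidableEq V] {A₁ A₂ A₃ B : Finset V} :
    A₁.val + A₂.val + A₃.val = B.val ↔
      (Disjoint A₁ A₂ ∧ Disjoint A₁ A₃ ∧ Disjoint A₂ A₃) ∧ A₁ ∪ (A₂ ∪ A₃) = B := by
  constructor
  · intro h
    have hnd := B.nodup
    rw [← h, add_assoc, Multiset.nodup_add, Multiset.nodup_add, Finset.disjoint_val,
      Multiset.disjoint_add_right, Finset.disjoint_val, Finset.disjoint_val] at hnd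
    refine ⟨⟨hnd.2.2.1, hnd.2.2.2, hnd.2.1.2.2⟩, ?_⟩
    ext x
    rw [Finset.mem_union, Finset.mem_union, ← Finset.mem_val (s := B), ← h, Multiset.mem_add,
      Multiset.mem_add, or_assoc]
    rfl
  · rintro ⟨⟨h1, h2, h3⟩, rfl⟩
    have hnd : (A₁.val + A₂.val + A₃.val).Nodup := by
      rw [add_assoc, Multiset.nodup_add, Multiset.nodup_add, Finset.disjoint_val,
        Multiset.disjoint_add_right, Finset.disjoint_val, Finset.disjoint_val]
      exact ⟨A₁.nodup, ⟨A₂.nodup, A₃.nodup, h3⟩, h1, h2⟩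
    refine (Multiset.Nodup.ext hnd (Finset.nodup _)).2 fun x => ?_
    simp only [Finset.mem_val, Finset.mem_union, Multiset.mem_add]
    tauto

/-- The members of the triple are disjoint sets with an odd number of elements. -/
def IsOddTriple {V : Type} (q : Finset V × Finset V × Finset V) : Prop :=
  (Disjoint q.1 q.2.1 ∧ Disjoint q.1 q.2.2 ∧ Disjoint q.2.1 q.2.2) ∧
    Odd q.1.card ∧ Odd q.2.1.card ∧ Odd q.2.2.card

theorem IsOddTriple.ne {V : Type} {q : Finset V × Finset V × Finset V} (hq : IsOddTriple q) :
    q.1 ≠ q.2.1 ∧ q.1 ≠ q.2.2 ∧ q.2.1 ≠ q.2.2 := by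
  obtain ⟨⟨h1, h2, h3⟩, o1, o2, o3⟩ := hq
  have hn : ∀ {A A' : Finset V}, Odd A.card → Disjoint A A' → A ≠ A' := by
    rintro A _ ho hd rfl
    rw [disjoint_self, Finset.bot_eq_empty] at hd
    simp [hd] at ho
  exact ⟨hn o1 h1, hn o1 h2, hn o2 h3⟩

theorem IsOddTriple.card_union {V : Type} [DecidableEq V] {q : Finset V × Finset V × Finset V} (hq : IsOddTriple q) :
    (q.1 ∪ (q.2.1 ∪ q.2.2)).card = q.1.card + (q.2.1.card + q.2.2.card) := by
  rw [Finset.card_union_of_disjoint (Finset.disjoint_union_right.2 ⟨hq.1.1, hq.1.2.1⟩),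
    Finset.card_union_of_disjoint hq.1.2.2]

theorem IsOddTriple.nonempty {V : Type} {q : Finset V × Finset V × Finset V} (hq : IsOddTriple q) :
    q.1.Nonempty ∧ q.2.1.Nonempty ∧ q.2.2.Nonempty :=
  ⟨Finset.card_pos.1 hq.2.1.pos, Finset.card_pos.1 hq.2.2.1.pos, Finset.card_pos.1 hq.2.2.2.pos⟩

theorem card_triple {V : Type} [DecidableEq V] {q : Finset V × Finset V × Finset V} (hq : IsOddTriple q) :
    ({q.1, q.2.1, q.2.2} : Finset (Finset V)).card = 3 := by
  rw [Finset.card_eq_three]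
  exact ⟨_, _, _, hq.ne.1, hq.ne.2.1, hq.ne.2.2, rfl⟩

open Classical in
/-- The recursion for the weights of the marks. -/
theorem markWeight_recursion {n b : ℕ} {κ : Fin b → Fin b → Fin b → ℝ} (hκ : IsSymmetricCubic κ)
    (p : Fin n → Fin b → ℝ) (B : Finset (Fin n)) :
    6 * (((B.card - 1) / 2 : ℕ) : ℝ) * markWeight κ p B =
      ∑ q ∈ Finset.univ.filter (fun q : Finset (Fin n) × Finset (Fin n) × Finset (Fin n) =>
          IsOddTriple q ∧ q.1 ∪ (q.2.1 ∪ q.2.2) = B),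
        (∑ i ∈ q.1, ∑ j ∈ q.2.1, ∑ k ∈ q.2.2, cubic κ (p i) (p j) (p k)) *
          (markWeight κ p q.1 * (markWeight κ p q.2.1 * markWeight κ p q.2.2)) := by
  have hcub : ∀ q : Finset (Fin n) × Finset (Fin n) × Finset (Fin n),
      ∑ i ∈ q.1, ∑ j ∈ q.2.1, ∑ k ∈ q.2.2, cubic κ (p i) (p j) (p k) =
        cubic κ (∑ i ∈ q.1, p i) (∑ i ∈ q.2.1, p i) (∑ i ∈ q.2.2, p i) := by
    intro q
    rw [cubic_sum_left]
    refine Finset.sum_congr rfl fun i _ => ?_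
    rw [cubic_sum_mid hκ]
    exact Finset.sum_congr rfl fun j _ => (cubic_sum_right hκ _ _ _ _).symm
  set h : Finset (Fin n) → Finset (Fin n) → Finset (Fin n) → ℝ := fun A₁ A₂ A₃ =>
    cubic κ (∑ i ∈ A₁, p i) (∑ i ∈ A₂, p i) (∑ i ∈ A₃, p i) *
      (markWeight κ p A₁ * (markWeight κ p A₂ * markWeight κ p A₃)) with hh
  set H : Finset (Fin n) → Finset (Fin n) → Finset (Fin n) → ℝ := fun A₁ A₂ A₃ =>
    if A₁.val + A₂.val + A₃.val = B.val then h A₁ A₂ A₃ else 0 with hH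
  have e1 : ∑ q ∈ Finset.univ.filter (fun q : Finset (Fin n) × Finset (Fin n) × Finset (Fin n) =>
          IsOddTriple q ∧ q.1 ∪ (q.2.1 ∪ q.2.2) = B), h q.1 q.2.1 q.2.2 =
      ∑ A₁, ∑ A₂, ∑ A₃, H A₁ A₂ A₃ := by
    rw [Finset.sum_filter, Fintype.sum_prod_type]
    refine Finset.sum_congr rfl fun A₁ _ => ?_
    rw [Fintype.sum_prod_type]
    refine Finset.sum_congr rfl fun A₂ _ => Finset.sum_congr rfl fun A₃ _ => ?_
    simp only [hH, val_add_add_eq_iff]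
    by_cases hd : (Disjoint A₁ A₂ ∧ Disjoint A₁ A₃ ∧ Disjoint A₂ A₃) ∧ A₁ ∪ (A₂ ∪ A₃) = B
    · rw [if_pos hd]
      split_ifs with ho
      · rfl
      -- A triple with an even member is not an `IsOddTriple`, but its weight is zero, since a
      -- ternary tree has an odd number of leaves.
      · by_cases o1 : Odd A₁.card
        · by_cases o2 : Odd A₂.card
          · have o3 : ¬ Odd A₃.card := fun o3 => ho ⟨⟨hd.1, o1, o2, o3⟩, hd.2⟩
            simp only [hh, markWeight_eq_zero κ p o3, mul_zero]
          · simp only [hh, markWeight_eq_zero κ p o2, mul_zero, zero_mul]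
        · simp only [hh, markWeight_eq_zero κ p o1, mul_zero, zero_mul]
    · rw [if_neg hd, if_neg]
      rintro ⟨⟨h1, -⟩, h2⟩
      exact hd ⟨h1, h2⟩
  have e2 : ∑ q ∈ Finset.univ.filter (fun q : Finset (Fin n) × Finset (Fin n) × Finset (Fin n) =>
          q.1.val + q.2.1.val + q.2.2.val = B.val ∧ q.1.min < q.2.1.min ∧ q.2.1.min < q.2.2.min),
        h q.1 q.2.1 q.2.2 =
      ∑ A₁, ∑ A₂, ∑ A₃, if Finset.min A₁ < Finset.min A₂ ∧ Finset.min A₂ < Finset.min A₃ then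
        H A₁ A₂ A₃ else 0 := by
    rw [Finset.sum_filter, Fintype.sum_prod_type]
    refine Finset.sum_congr rfl fun A₁ _ => ?_
    rw [Fintype.sum_prod_type]
    refine Finset.sum_congr rfl fun A₂ _ => Finset.sum_congr rfl fun A₃ _ => ?_
    simp only [hH, ← ite_and]
    exact if_congr and_comm rfl rfl
  have e3 := card_mul_markWeight κ p B
  rw [e2] at e3
  rw [mul_assoc, e3]
  simp only [hcub]
  rw [e1, sum_eq_six_mul_sum_sorted Finset.min H]
  · intro A₁ A₂ A₃
    simp only [hH, hh]
    rw [add_comm A₁.val, cubic_swap_left hκ]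
    exact if_congr Iff.rfl (by ring) rfl
  · intro A₁ A₂ A₃
    simp only [hH, hh]
    rw [add_right_comm, cubic_swap_right hκ]
    exact if_congr Iff.rfl (by ring) rfl
  · intro A₁ A₂ A₃ hmin
    simp only [hH]
    split_ifs with hs
    · have hd := (val_add_add_eq_iff.1 hs).1.1
      -- Disjoint sets with the same minimum are both empty, and the weight of the empty set is
      -- zero.
      rcases A₁.eq_empty_or_nonempty with h1 | h1
      · simp only [hh, h1, markWeight_eq_zero κ p (A := ∅) (by simp), zero_mul, mul_zero]
      · obtain ⟨a, ha⟩ := Finset.min_of_nonempty h1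
        have h2 := Finset.mem_of_min ha
        have h3 := Finset.mem_of_min (hmin ▸ ha)
        exact (Finset.disjoint_left.1 hd h2 h3).elim
    · rfl

/-! ### Merging and splitting the blocks of odd partitions. -/

section Merging

variable {V : Type}

/-- Two elements are related if the same members of `𝒜` contain them. -/
def blockRel (𝒜 : Finset (Finset V)) : Setoid V where
  r x y := ∀ A ∈ 𝒜, x ∈ A ↔ y ∈ A
  iseqv := ⟨fun _ _ _ => Iff.rfl, fun h A hA => (h A hA).symm,
    fun h h' A hA => (h A hA).trans (h' A hA)⟩

theorem blockRel_apply {𝒜 : Finset (Finset V)} {x y : V} :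
    blockRel 𝒜 x y ↔ ∀ A ∈ 𝒜, x ∈ A ↔ y ∈ A := Iff.rfl

variable [Fintype V] [DecidableEq V]

/-- The partitions of `V` into blocks with an odd number of elements whose number is
`|V| - 2m`. -/
def IsOddPartition (m : ℕ) (𝒜 : Finset (Finset V)) : Prop :=
  ((𝒜 : Set (Finset V)).PairwiseDisjoint id ∧ 𝒜.biUnion id = Finset.univ) ∧
    𝒜.card + 2 * m = Fintype.card V ∧ ∀ A ∈ 𝒜, Odd A.card

/-- The three members of `𝒜` are joined into one. -/
def mergeBlocks (q : Finset V × Finset V × Finset V) (𝒜 : Finset (Finset V)) :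
    Finset (Finset V) :=
  insert (q.1 ∪ (q.2.1 ∪ q.2.2)) (𝒜 \ {q.1, q.2.1, q.2.2})

theorem IsOddPartition.exists_mem {m : ℕ} {𝒜 : Finset (Finset V)} (h : IsOddPartition m 𝒜) (x : V) :
    ∃ A ∈ 𝒜, x ∈ A := by
  have h1 := Finset.mem_univ x
  rw [← h.1.2, Finset.mem_biUnion] at h1
  exact h1

theorem IsOddPartition.eq_of_mem {m : ℕ} {𝒜 : Finset (Finset V)} (h : IsOddPartition m 𝒜)
    {A A' : Finset V} (hA : A ∈ 𝒜) (hA' : A' ∈ 𝒜) {x : V} (hx : x ∈ A) (hx' : x ∈ A') :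
    A = A' := by
  by_contra hne
  exact Finset.disjoint_left.1 (h.1.1 hA hA' hne) hx hx'

theorem IsOddPartition.rel_iff {m : ℕ} {𝒜 : Finset (Finset V)} (h : IsOddPartition m 𝒜)
    {A A' : Finset V} (hA : A ∈ 𝒜) (hA' : A' ∈ 𝒜) {x y : V} (hx : x ∈ A) (hy : y ∈ A') :
    blockRel 𝒜 x y ↔ A = A' := by
  rw [blockRel_apply]
  constructor
  · exact fun hr => h.eq_of_mem hA hA' ((hr A hA).1 hx |> fun _ => hx) ((hr A' hA').2 hy)
  · rintro rfl B hB
    exact ⟨fun hxB => h.eq_of_mem hB hA hxB hx ▸ hy, fun hyB => h.eq_of_mem hB hA hyB hy ▸ hx⟩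

/-- A partition that contains the union of the triple does not contain its members, and the other
way round. -/
theorem IsOddPartition.union_notMem {m : ℕ} {𝒜 : Finset (Finset V)} (h : IsOddPartition m 𝒜)
    {q : Finset V × Finset V × Finset V} (hq : IsOddTriple q) (h1 : q.1 ∈ 𝒜) :
    q.1 ∪ (q.2.1 ∪ q.2.2) ∉ 𝒜 := by
  intro hU
  obtain ⟨x, hx⟩ := hq.nonempty.1
  obtain ⟨y, hy⟩ := hq.nonempty.2.1
  have h2 := h.eq_of_mem h1 hU hx (by simp [hx])
  have h3 : y ∈ q.1 := by rw [h2]; simp [hy]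
  exact Finset.disjoint_left.1 hq.1.1 h3 hy

theorem IsOddPartition.notMem_of_union_mem {m : ℕ} {𝒜 : Finset (Finset V)}
    (h : IsOddPartition m 𝒜) {q : Finset V × Finset V × Finset V} (hq : IsOddTriple q)
    (hU : q.1 ∪ (q.2.1 ∪ q.2.2) ∈ 𝒜) : q.1 ∉ 𝒜 ∧ q.2.1 ∉ 𝒜 ∧ q.2.2 ∉ 𝒜 := by
  obtain ⟨x, hx⟩ := hq.nonempty.1
  obtain ⟨y, hy⟩ := hq.nonempty.2.1
  obtain ⟨z, hz⟩ := hq.nonempty.2.2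
  refine ⟨fun h1 => h.union_notMem hq h1 hU, fun h1 => ?_, fun h1 => ?_⟩
  · have h2 := h.eq_of_mem h1 hU hy (by simp [hy])
    exact Finset.disjoint_left.1 hq.1.1 hx (by rw [h2]; simp [hx])
  · have h2 := h.eq_of_mem h1 hU hz (by simp [hz])
    exact Finset.disjoint_left.1 hq.1.2.1 hx (by rw [h2]; simp [hx])

end Merging

end BPSTree

namespace BPSTree

section Merging

variable {V : Type} [Fintype V] [DecidableEq V]

theorem IsOddPartition.mergeBlocks {m : ℕ} {𝒜 : Finset (Finset V)} (h : IsOddPartition m 𝒜)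
    {q : Finset V × Finset V × Finset V} (hq : IsOddTriple q) (h1 : q.1 ∈ 𝒜) (h2 : q.2.1 ∈ 𝒜)
    (h3 : q.2.2 ∈ 𝒜) : IsOddPartition (m + 1) (mergeBlocks q 𝒜) := by
  have hsub : ({q.1, q.2.1, q.2.2} : Finset (Finset V)) ⊆ 𝒜 := by
    intro A hA
    simp only [Finset.mem_insert, Finset.mem_singleton] at hA
    rcases hA with rfl | rfl | rfl <;> assumption
  have hc := Finset.card_sdiff_add_card_eq_card hsub
  rw [card_triple hq] at hc
  refine ⟨⟨?_, ?_⟩, ?_, ?_⟩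
  · rw [BPSTree.mergeBlocks, Finset.coe_insert]
    refine Set.PairwiseDisjoint.insert (h.1.1.subset (by simp)) ?_
    intro A hA _
    simp only [Finset.coe_sdiff, Set.mem_sdiff, Finset.mem_coe, Finset.mem_insert,
      Finset.mem_singleton, not_or] at hA
    simp only [id_eq, Finset.disjoint_union_left]
    exact ⟨h.1.1 h1 hA.1 (Ne.symm hA.2.1), h.1.1 h2 hA.1 (Ne.symm hA.2.2.1),
      h.1.1 h3 hA.1 (Ne.symm hA.2.2.2)⟩
  · refine Finset.eq_univ_of_forall fun x => ?_
    obtain ⟨A, hA, hx⟩ := h.exists_mem x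
    rw [Finset.mem_biUnion]
    by_cases hAq : A ∈ ({q.1, q.2.1, q.2.2} : Finset (Finset V))
    · refine ⟨_, Finset.mem_insert_self _ _, ?_⟩
      simp only [Finset.mem_insert, Finset.mem_singleton] at hAq
      simp only [id_eq, Finset.mem_union]
      rcases hAq with rfl | rfl | rfl <;> simp [hx]
    · exact ⟨A, Finset.mem_insert_of_mem (Finset.mem_sdiff.2 ⟨hA, hAq⟩), hx⟩
  · rw [BPSTree.mergeBlocks, Finset.card_insert_of_notMem
      fun hU => h.union_notMem hq h1 (Finset.mem_sdiff.1 hU).1]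
    have := h.2.1
    omega
  · intro A hA
    rcases Finset.mem_insert.1 hA with rfl | hA
    · rw [hq.card_union]
      exact hq.2.1.add_even (hq.2.2.1.add_odd hq.2.2.2)
    · exact h.2.2 A (Finset.mem_sdiff.1 hA).1

/-- The union of the triple is split into its three members. -/
def splitBlocks (q : Finset V × Finset V × Finset V) (𝒜 : Finset (Finset V)) :
    Finset (Finset V) :=
  𝒜.erase (q.1 ∪ (q.2.1 ∪ q.2.2)) ∪ {q.1, q.2.1, q.2.2}

theorem IsOddPartition.disjoint_triple {m : ℕ} {𝒜 : Finset (Finset V)}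
    (h : IsOddPartition m 𝒜) {q : Finset V × Finset V × Finset V} (hq : IsOddTriple q)
    (hU : q.1 ∪ (q.2.1 ∪ q.2.2) ∈ 𝒜) : Disjoint 𝒜 {q.1, q.2.1, q.2.2} := by
  obtain ⟨h1, h2, h3⟩ := h.notMem_of_union_mem hq hU
  simp [h1, h2, h3]

theorem IsOddPartition.splitBlocks {m : ℕ} {𝒜 : Finset (Finset V)} (h : IsOddPartition (m + 1) 𝒜)
    {q : Finset V × Finset V × Finset V} (hq : IsOddTriple q)
    (hU : q.1 ∪ (q.2.1 ∪ q.2.2) ∈ 𝒜) : IsOddPartition m (splitBlocks q 𝒜) := by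
  have hdis : Disjoint (𝒜.erase (q.1 ∪ (q.2.1 ∪ q.2.2))) {q.1, q.2.1, q.2.2} :=
    (h.disjoint_triple hq hU).mono_left (Finset.erase_subset _ _)
  refine ⟨⟨?_, ?_⟩, ?_, ?_⟩
  · rw [BPSTree.splitBlocks, Finset.coe_union, Set.pairwiseDisjoint_union]
    refine ⟨h.1.1.subset (by simp), ?_, ?_⟩
    · obtain ⟨d1, d2, d3⟩ := hq.1
      intro A hA A' hA' hne
      simp only [Finset.coe_insert, Finset.coe_singleton, Set.mem_insert_iff,
        Set.mem_singleton_iff] at hA hA'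
      simp only [Function.onFun, id_eq]
      rcases hA with rfl | rfl | rfl <;> rcases hA' with rfl | rfl | rfl <;>
        first
        | exact absurd rfl hne
        | assumption
        | (rw [disjoint_comm]; assumption)
    · intro A hA A' hA' _
      have hd := h.1.1 (Finset.mem_of_mem_erase hA) hU (Finset.ne_of_mem_erase hA)
      simp only [Function.onFun, id_eq, Finset.disjoint_union_right] at hd
      simp only [Finset.coe_insert, Finset.coe_singleton, Set.mem_insert_iff,
        Set.mem_singleton_iff] at hA'
      rcases hA' with rfl | rfl | rfl
      exacts [hd.1, hd.2.1, hd.2.2]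
  · refine Finset.eq_univ_of_forall fun x => ?_
    obtain ⟨A, hA, hx⟩ := h.exists_mem x
    simp only [Finset.mem_biUnion, BPSTree.splitBlocks, Finset.mem_union, Finset.mem_erase,
      Finset.mem_insert, Finset.mem_singleton]
    by_cases hAU : A = q.1 ∪ (q.2.1 ∪ q.2.2)
    · rw [hAU] at hx
      simp only [Finset.mem_union] at hx
      rcases hx with hx | hx | hx
      · exact ⟨q.1, by simp, hx⟩
      · exact ⟨q.2.1, by simp, hx⟩
      · exact ⟨q.2.2, by simp, hx⟩
    · exact ⟨A, Or.inl ⟨hAU, hA⟩, hx⟩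
  · rw [BPSTree.splitBlocks, Finset.card_union_of_disjoint hdis, card_triple hq]
    have h1 := Finset.card_erase_add_one hU
    have h2 := h.2.1
    omega
  · intro A hA
    rcases Finset.mem_union.1 hA with hA | hA
    · exact h.2.2 A (Finset.mem_of_mem_erase hA)
    · simp only [Finset.mem_insert, Finset.mem_singleton] at hA
      rcases hA with rfl | rfl | rfl
      exacts [hq.2.1, hq.2.2.1, hq.2.2.2]

theorem IsOddPartition.erase_mergeBlocks {m : ℕ} {𝒜 : Finset (Finset V)} (h : IsOddPartition m 𝒜)
    {q : Finset V × Finset V × Finset V} (hq : IsOddTriple q) (h1 : q.1 ∈ 𝒜) :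
    (BPSTree.mergeBlocks q 𝒜).erase (q.1 ∪ (q.2.1 ∪ q.2.2)) = 𝒜 \ {q.1, q.2.1, q.2.2} :=
  Finset.erase_insert fun hU => h.union_notMem hq h1 (Finset.mem_sdiff.1 hU).1

theorem IsOddPartition.splitBlocks_mergeBlocks {m : ℕ} {𝒜 : Finset (Finset V)}
    (h : IsOddPartition m 𝒜) {q : Finset V × Finset V × Finset V} (hq : IsOddTriple q)
    (h1 : q.1 ∈ 𝒜) (h2 : q.2.1 ∈ 𝒜) (h3 : q.2.2 ∈ 𝒜) :
    BPSTree.splitBlocks q (BPSTree.mergeBlocks q 𝒜) = 𝒜 := by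
  rw [BPSTree.splitBlocks, h.erase_mergeBlocks hq h1]
  refine Finset.sdiff_union_of_subset ?_
  intro A hA
  simp only [Finset.mem_insert, Finset.mem_singleton] at hA
  rcases hA with rfl | rfl | rfl <;> assumption

theorem IsOddPartition.mergeBlocks_splitBlocks {m : ℕ} {𝒜 : Finset (Finset V)}
    (h : IsOddPartition m 𝒜) {q : Finset V × Finset V × Finset V} (hq : IsOddTriple q)
    (hU : q.1 ∪ (q.2.1 ∪ q.2.2) ∈ 𝒜) :
    BPSTree.mergeBlocks q (BPSTree.splitBlocks q 𝒜) = 𝒜 := by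
  have hdis : Disjoint (𝒜.erase (q.1 ∪ (q.2.1 ∪ q.2.2))) {q.1, q.2.1, q.2.2} :=
    (h.disjoint_triple hq hU).mono_left (Finset.erase_subset _ _)
  rw [BPSTree.splitBlocks, BPSTree.mergeBlocks, Finset.union_sdiff_cancel_right hdis,
    Finset.insert_erase hU]

/-- The contracted relation depends on the blocks of `i`, `j`, `k` only. This allows the sum over
elements to be collected into a sum over triples of blocks. -/
theorem IsOddPartition.joinTriple_blockRel {m : ℕ} {𝒜 : Finset (Finset V)}
    (h : IsOddPartition m 𝒜) {q : Finset V × Finset V × Finset V} (hq : IsOddTriple q)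
    (h1 : q.1 ∈ 𝒜) (h2 : q.2.1 ∈ 𝒜) (h3 : q.2.2 ∈ 𝒜) {i j k : V} (hi : i ∈ q.1) (hj : j ∈ q.2.1)
    (hk : k ∈ q.2.2) :
    joinTriple (blockRel 𝒜) i j k = blockRel (BPSTree.mergeBlocks q 𝒜) := by
  have h' := h.mergeBlocks hq h1 h2 h3
  have hUmem : q.1 ∪ (q.2.1 ∪ q.2.2) ∈ BPSTree.mergeBlocks q 𝒜 := Finset.mem_insert_self _ _
  have hU : ∀ x ∈ q.1 ∪ (q.2.1 ∪ q.2.2), joinTriple (blockRel 𝒜) i j k i x := by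
    intro x hx
    simp only [Finset.mem_union] at hx
    have hle := le_joinTriple (blockRel 𝒜) i j k
    rcases hx with hx | hx | hx
    · exact hle ((h.rel_iff h1 h1 hi hx).2 rfl)
    · exact Setoid.trans' _ (joinTriple_rel_left _ _ _ _) (hle ((h.rel_iff h2 h2 hj hx).2 rfl))
    · exact Setoid.trans' _ (joinTriple_rel_right _ _ _ _) (hle ((h.rel_iff h3 h3 hk hx).2 rfl))
  refine le_antisymm (joinTriple_le_iff.2 ⟨?_, ?_, ?_⟩) ?_
  · intro x y hxy A hA
    rcases Finset.mem_insert.1 hA with rfl | hA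
    · simp only [Finset.mem_union, hxy _ h1, hxy _ h2, hxy _ h3]
    · exact hxy A (Finset.mem_sdiff.1 hA).1
  · exact (h'.rel_iff hUmem hUmem (by simp [hi]) (by simp [hj])).2 rfl
  · exact (h'.rel_iff hUmem hUmem (by simp [hi]) (by simp [hk])).2 rfl
  · intro x y hxy
    obtain ⟨A, hA, hx⟩ := h'.exists_mem x
    have hy := (hxy A hA).1 hx
    rcases Finset.mem_insert.1 hA with rfl | hA
    · exact Setoid.trans' _ (Setoid.symm' _ (hU x hx)) (hU y hy)
    · have hA' := (Finset.mem_sdiff.1 hA).1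
      exact le_joinTriple _ _ _ _ ((h.rel_iff hA' hA' hx hy).2 rfl)

theorem IsOddPartition.sum_eq {m : ℕ} {𝒜 : Finset (Finset V)} (h : IsOddPartition m 𝒜)
    {M : Type} [AddCommMonoid M] (f : V → M) : ∑ x, f x = ∑ A ∈ 𝒜, ∑ x ∈ A, f x := by
  rw [← h.1.2, Finset.sum_biUnion h.1.1]
  rfl

/-- The number of marks is additive over the blocks; it distributes the factor m+1 of `sum_mergeSum`
over the blocks that may have arisen last. -/
theorem IsOddPartition.sum_card {m : ℕ} {𝒜 : Finset (Finset V)} (h : IsOddPartition m 𝒜) :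
    ∑ A ∈ 𝒜, (A.card - 1) / 2 = m := by
  have h1 := h.sum_eq fun _ => 1
  simp only [Finset.sum_const, smul_eq_mul, mul_one, Finset.card_univ] at h1
  have h2 : ∑ A ∈ 𝒜, A.card = 2 * (∑ A ∈ 𝒜, (A.card - 1) / 2) + 𝒜.card := by
    rw [Finset.mul_sum, Finset.card_eq_sum_ones, ← Finset.sum_add_distrib]
    refine Finset.sum_congr rfl fun A hA => ?_
    obtain ⟨a, ha⟩ := h.2.2 A hA
    omega
  have h3 := h.2.1
  omega

open Classical in
/-- The sum over the ways of joining three classes of `P`. -/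
noncomputable def mergeSum {N : Type} [AddCommGroup N] [Module ℝ N] (τ : V → V → V → ℝ)
    (f : Setoid V → N) (P : Setoid V) : N :=
  ∑ i, ∑ j, ∑ k, if Separated P i j k then τ i j k • f (joinTriple P i j k) else 0

/-- The sum of `τ` over the members of the triple. -/
def tripleSum (τ : V → V → V → ℝ) (q : Finset V × Finset V × Finset V) : ℝ :=
  ∑ i ∈ q.1, ∑ j ∈ q.2.1, ∑ k ∈ q.2.2, τ i j k

open Classical in
theorem mergeSum_blockRel {N : Type} [AddCommGroup N] [Module ℝ N] (τ : V → V → V → ℝ)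
    (f : Setoid V → N) {m : ℕ} {𝒜 : Finset (Finset V)} (h : IsOddPartition m 𝒜) :
    mergeSum τ f (blockRel 𝒜) =
      ∑ q ∈ Finset.univ.filter (fun q : Finset V × Finset V × Finset V =>
        IsOddTriple q ∧ q.1 ∈ 𝒜 ∧ q.2.1 ∈ 𝒜 ∧ q.2.2 ∈ 𝒜),
        tripleSum τ q • f (blockRel (BPSTree.mergeBlocks q 𝒜)) := by
  have e1 : mergeSum τ f (blockRel 𝒜) = ∑ A₁ ∈ 𝒜, ∑ A₂ ∈ 𝒜, ∑ A₃ ∈ 𝒜,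
      ∑ i ∈ A₁, ∑ j ∈ A₂, ∑ k ∈ A₃, if Separated (blockRel 𝒜) i j k then
        τ i j k • f (joinTriple (blockRel 𝒜) i j k) else 0 := by
    simp only [mergeSum, h.sum_eq]
    refine Finset.sum_congr rfl fun A₁ _ => ?_
    rw [Finset.sum_comm]
    refine Finset.sum_congr rfl fun A₂ _ => ?_
    simp only [Finset.sum_comm (s := A₂)]
    rw [Finset.sum_comm]
  have e2 : (Finset.univ.filter fun q : Finset V × Finset V × Finset V =>
        IsOddTriple q ∧ q.1 ∈ 𝒜 ∧ q.2.1 ∈ 𝒜 ∧ q.2.2 ∈ 𝒜) =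
      (𝒜 ×ˢ 𝒜 ×ˢ 𝒜).filter IsOddTriple := by
    ext q
    simp only [Finset.mem_filter, Finset.mem_univ, true_and, Finset.mem_product]
    tauto
  rw [e1, e2, Finset.sum_filter, Finset.sum_product]
  refine Finset.sum_congr rfl fun A₁ h1 => ?_
  rw [Finset.sum_product]
  refine Finset.sum_congr rfl fun A₂ h2 => Finset.sum_congr rfl fun A₃ h3 => ?_
  have hsep : ∀ i ∈ A₁, ∀ j ∈ A₂, ∀ k ∈ A₃,
      (Separated (blockRel 𝒜) i j k ↔ IsOddTriple (A₁, A₂, A₃)) := by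
    intro i hi j hj k hk
    rw [Separated, h.rel_iff h1 h2 hi hj, h.rel_iff h2 h3 hj hk, h.rel_iff h3 h1 hk hi]
    constructor
    · rintro ⟨n1, n2, n3⟩
      exact ⟨⟨h.1.1 h1 h2 n1, h.1.1 h1 h3 (Ne.symm n3), h.1.1 h2 h3 n2⟩, h.2.2 _ h1, h.2.2 _ h2,
        h.2.2 _ h3⟩
    · intro hq
      exact ⟨hq.ne.1, hq.ne.2.2, hq.ne.2.1.symm⟩
  split_ifs with hq
  · rw [tripleSum]
    simp only [Finset.sum_smul]
    refine Finset.sum_congr rfl fun i hi => Finset.sum_congr rfl fun j hj =>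
      Finset.sum_congr rfl fun k hk => ?_
    rw [if_pos ((hsep i hi j hj k hk).2 hq), h.joinTriple_blockRel hq h1 h2 h3 hi hj hk]
  · refine Finset.sum_eq_zero fun i hi => Finset.sum_eq_zero fun j hj =>
      Finset.sum_eq_zero fun k hk => if_neg fun hs => hq ((hsep i hi j hj k hk).1 hs)

open Classical in
/-- Joining three classes once more in all possible ways, in terms of weights that satisfy the
recursion. -/
theorem sum_mergeSum {N : Type} [AddCommGroup N] [Module ℝ N] (τ : V → V → V → ℝ)
    {ω : Finset V → ℝ}
    (hω : ∀ B, 6 * (((B.card - 1) / 2 : ℕ) : ℝ) * ω B =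
      ∑ q ∈ Finset.univ.filter (fun q : Finset V × Finset V × Finset V =>
        IsOddTriple q ∧ q.1 ∪ (q.2.1 ∪ q.2.2) = B),
        tripleSum τ q * (ω q.1 * (ω q.2.1 * ω q.2.2)))
    (f : Setoid V → N) (m : ℕ) :
    ∑ 𝒜 ∈ Finset.univ.filter (IsOddPartition m), (∏ A ∈ 𝒜, ω A) • mergeSum τ f (blockRel 𝒜) =
      (6 * ((m + 1 : ℕ) : ℝ)) • ∑ 𝒜 ∈ Finset.univ.filter (IsOddPartition (m + 1)),
        (∏ A ∈ 𝒜, ω A) • f (blockRel 𝒜) := by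
  have hL : ∀ 𝒜 ∈ Finset.univ.filter (IsOddPartition (V := V) m),
      (∏ A ∈ 𝒜, ω A) • mergeSum τ f (blockRel 𝒜) =
      ∑ q ∈ Finset.univ.filter (fun q : Finset V × Finset V × Finset V =>
        IsOddTriple q ∧ q.1 ∈ 𝒜 ∧ q.2.1 ∈ 𝒜 ∧ q.2.2 ∈ 𝒜),
        (tripleSum τ q * (∏ A ∈ 𝒜, ω A)) • f (blockRel (BPSTree.mergeBlocks q 𝒜)) := by
    intro 𝒜 h𝒜
    rw [mergeSum_blockRel τ f (Finset.mem_filter.1 h𝒜).2, Finset.smul_sum]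
    refine Finset.sum_congr rfl fun q _ => ?_
    rw [smul_smul, mul_comm]
  have hR : ∀ 𝒜 ∈ Finset.univ.filter (IsOddPartition (V := V) (m + 1)),
      (6 * ((m + 1 : ℕ) : ℝ)) • ((∏ A ∈ 𝒜, ω A) • f (blockRel 𝒜)) =
      ∑ q ∈ Finset.univ.filter (fun q : Finset V × Finset V × Finset V =>
        IsOddTriple q ∧ q.1 ∪ (q.2.1 ∪ q.2.2) ∈ 𝒜),
        (tripleSum τ q * (ω q.1 * (ω q.2.1 * ω q.2.2)) *
          ∏ A ∈ 𝒜.erase (q.1 ∪ (q.2.1 ∪ q.2.2)), ω A) • f (blockRel 𝒜) := by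
    intro 𝒜 h𝒜
    have h := (Finset.mem_filter.1 h𝒜).2
    rw [smul_smul, ← Finset.sum_smul]
    congr 1
    -- Write m+1 as the sum of the marks of the blocks `B` and apply the recursion to each `B`: this
    -- splits one block in all possible ways.
    rw [← h.sum_card, Nat.cast_sum, Finset.mul_sum, Finset.sum_mul,
      ← Finset.sum_fiberwise_of_maps_to (t := 𝒜) 
        (g := fun q : Finset V × Finset V × Finset V => q.1 ∪ (q.2.1 ∪ q.2.2)) fun q hq => (Finset.mem_filter.1 hq).2.2]
    refine Finset.sum_congr rfl fun B hB => ?_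
    rw [← Finset.mul_prod_erase 𝒜 ω hB, ← mul_assoc, hω, Finset.sum_mul, Finset.filter_filter]
    refine Finset.sum_congr ?_ fun q hq => ?_
    · ext q
      simp only [Finset.mem_filter, Finset.mem_univ, true_and]
      constructor
      · rintro ⟨h1, h2⟩
        exact ⟨⟨h1, h2 ▸ hB⟩, h2⟩
      · rintro ⟨⟨h1, _⟩, h2⟩
        exact ⟨h1, h2⟩
    · rw [(Finset.mem_filter.1 hq).2.2]
  -- With the triple summed outermost, merging and splitting are inverse bijections between
  -- partitions that contain its three members and partitions that contain their union.
  rw [Finset.smul_sum, Finset.sum_congr rfl hL, Finset.sum_congr rfl hR,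
    Finset.sum_comm' (t' := Finset.univ.filter IsOddTriple)
      (s' := fun q => Finset.univ.filter fun 𝒜 => IsOddPartition m 𝒜 ∧
        q.1 ∈ 𝒜 ∧ q.2.1 ∈ 𝒜 ∧ q.2.2 ∈ 𝒜)
      (by intro 𝒜 q; simp only [Finset.mem_filter, Finset.mem_univ, true_and]; tauto),
    Finset.sum_comm' (t' := Finset.univ.filter IsOddTriple)
      (s' := fun q => Finset.univ.filter fun 𝒜 => IsOddPartition (m + 1) 𝒜 ∧
        q.1 ∪ (q.2.1 ∪ q.2.2) ∈ 𝒜)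
      (by intro 𝒜 q; simp only [Finset.mem_filter, Finset.mem_univ, true_and]; tauto)]
  refine Finset.sum_congr rfl fun q hq => ?_
  have hq' := (Finset.mem_filter.1 hq).2
  refine Finset.sum_bij' (fun 𝒜 _ => BPSTree.mergeBlocks q 𝒜) (fun 𝒜 _ => BPSTree.splitBlocks q 𝒜)
    ?_ ?_ ?_ ?_ ?_
  · intro 𝒜 h𝒜
    obtain ⟨h, h1, h2, h3⟩ := (Finset.mem_filter.1 h𝒜).2
    exact Finset.mem_filter.2 ⟨Finset.mem_univ _, h.mergeBlocks hq' h1 h2 h3,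
      Finset.mem_insert_self _ _⟩
  · intro 𝒜 h𝒜
    obtain ⟨h, hU⟩ := (Finset.mem_filter.1 h𝒜).2
    refine Finset.mem_filter.2 ⟨Finset.mem_univ _, h.splitBlocks hq' hU, ?_, ?_, ?_⟩ <;>
      simp [BPSTree.splitBlocks]
  · intro 𝒜 h𝒜
    obtain ⟨h, h1, h2, h3⟩ := (Finset.mem_filter.1 h𝒜).2
    exact h.splitBlocks_mergeBlocks hq' h1 h2 h3
  · intro 𝒜 h𝒜
    obtain ⟨h, hU⟩ := (Finset.mem_filter.1 h𝒜).2
    exact h.mergeBlocks_splitBlocks hq' hU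
  · intro 𝒜 h𝒜
    obtain ⟨h, h1, h2, h3⟩ := (Finset.mem_filter.1 h𝒜).2
    rw [h.erase_mergeBlocks hq' h1]
    have hsub : ({q.1, q.2.1, q.2.2} : Finset (Finset V)) ⊆ 𝒜 := by
      intro A hA
      simp only [Finset.mem_insert, Finset.mem_singleton] at hA
      rcases hA with rfl | rfl | rfl <;> assumption
    rw [← Finset.prod_sdiff hsub, Finset.prod_insert (by simp [hq'.ne]),
      Finset.prod_insert (by simp [hq'.ne]), Finset.prod_singleton]
    congr 1
    ring

end Merging

end BPSTree

namespace BPSTree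

/-! ### Iterated merging, starting from the singletons. -/

section Iterate

variable {V : Type} [Fintype V] [DecidableEq V] {N : Type} [AddCommGroup N] [Module ℝ N]

theorem IsOddPartition.card_eq_one {𝒜 : Finset (Finset V)} (h : IsOddPartition 0 𝒜)
    {A : Finset V} (hA : A ∈ 𝒜) : A.card = 1 := by
  have h1 := Finset.sum_eq_zero_iff.1 h.sum_card A hA
  obtain ⟨a, ha⟩ := h.2.2 A hA
  omega

theorem isOddPartition_zero_iff {𝒜 : Finset (Finset V)} :
    IsOddPartition 0 𝒜 ↔ 𝒜 = Finset.univ.image fun x => {x} := by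
  constructor
  · intro h
    ext A
    simp only [Finset.mem_image, Finset.mem_univ, true_and]
    constructor
    · intro hA
      obtain ⟨x, rfl⟩ := Finset.card_eq_one.1 (h.card_eq_one hA)
      exact ⟨x, rfl⟩
    · rintro ⟨x, rfl⟩
      obtain ⟨A, hA, hx⟩ := h.exists_mem x
      obtain ⟨y, rfl⟩ := Finset.card_eq_one.1 (h.card_eq_one hA)
      rwa [Finset.mem_singleton.1 hx]
  · rintro rfl
    refine ⟨⟨?_, ?_⟩, ?_, ?_⟩
    · intro A hA A' hA' hne
      simp only [Finset.coe_image, Finset.coe_univ, Set.image_univ, Set.mem_range] at hA hA'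
      obtain ⟨x, rfl⟩ := hA
      obtain ⟨y, rfl⟩ := hA'
      simp only [Function.onFun, id_eq, Finset.disjoint_singleton]
      rintro rfl
      exact hne rfl
    · ext x
      simp
    · rw [Finset.card_image_of_injective _ Finset.singleton_injective, Finset.card_univ]
      rfl
    · intro A hA
      simp only [Finset.mem_image, Finset.mem_univ, true_and] at hA
      obtain ⟨x, rfl⟩ := hA
      simp

theorem blockRel_singletons :
    blockRel (Finset.univ.image fun x : V => ({x} : Finset V)) = ⊥ := by
  refine le_bot_iff.1 fun x y hxy => ?_
  have h := (hxy {x} (by simp)).1 (Finset.mem_singleton_self x)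
  exact (Finset.mem_singleton.1 h).symm

theorem map_mergeSum {M : Type} [AddCommGroup M] [Module ℝ M] (L : N →ₗ[ℝ] M) (τ : V → V → V → ℝ)
    (f : Setoid V → N) (P : Setoid V) : L (mergeSum τ f P) = mergeSum τ (fun Q => L (f Q)) P := by
  simp only [mergeSum, map_sum, apply_ite L, map_smul, map_zero]

/-- `mergeSum` acts on the equivalence relation and `L` on the values, so they commute. -/
theorem map_iterate_mergeSum (L : N →ₗ[ℝ] N) (τ : V → V → V → ℝ) (m : ℕ) (f : Setoid V → N)
    (P : Setoid V) : L ((mergeSum τ)^[m] f P) = (mergeSum τ)^[m] (fun Q => L (f Q)) P := by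
  induction m generalizing f with
  | zero => rfl
  | succ m ih =>
    rw [Function.iterate_succ_apply, Function.iterate_succ_apply, ih]
    exact congrArg (fun h => (mergeSum τ)^[m] h P) (funext fun Q => map_mergeSum L τ f Q)

/-- If a linear map joins three classes, then its powers do so repeatedly. -/
theorem iterate_eq_iterate_mergeSum {L : N →ₗ[ℝ] N} {τ : V → V → V → ℝ} {f : Setoid V → N} {a : ℝ}
    (hL : ∀ P, L (f P) = a • mergeSum τ f P) (m : ℕ) (P : Setoid V) :
    (L ^ m) (f P) = a ^ m • (mergeSum τ)^[m] f P := by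
  induction m with
  | zero => simp
  | succ m ih =>
    have h := map_iterate_mergeSum (a • LinearMap.id) τ m (mergeSum τ f) P
    simp only [LinearMap.smul_apply, LinearMap.id_apply] at h
    rw [pow_succ', Module.End.mul_apply, ih, map_smul, map_iterate_mergeSum, funext hL,
      Function.iterate_succ_apply, pow_succ, ← smul_smul, h]

-- Each merger from m to m+1 marks contributes 6(m+1) by `sum_mergeSum`; the product of these
-- factors is 6^m m!.
open Classical in
theorem iterate_mergeSum_bot (τ : V → V → V → ℝ) {ω : Finset V → ℝ} (hω₁ : ∀ x, ω {x} = 1)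
    (hω : ∀ B, 6 * (((B.card - 1) / 2 : ℕ) : ℝ) * ω B =
      ∑ q ∈ Finset.univ.filter (fun q : Finset V × Finset V × Finset V =>
        IsOddTriple q ∧ q.1 ∪ (q.2.1 ∪ q.2.2) = B),
        tripleSum τ q * (ω q.1 * (ω q.2.1 * ω q.2.2)))
    (f : Setoid V → N) (m : ℕ) :
    (mergeSum τ)^[m] f ⊥ = (6 ^ m * (m.factorial : ℝ)) •
      ∑ 𝒜 ∈ Finset.univ.filter (IsOddPartition m), (∏ A ∈ 𝒜, ω A) • f (blockRel 𝒜) := by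
  induction m generalizing f with
  | zero =>
    have h : Finset.univ.filter (IsOddPartition (V := V) 0) =
        {Finset.univ.image fun x : V => ({x} : Finset V)} := by
      ext 𝒜
      simp [isOddPartition_zero_iff]
    rw [h, Finset.sum_singleton, blockRel_singletons,
      Finset.prod_image fun x _ y _ hxy => Finset.singleton_injective hxy]
    simp [hω₁]
  | succ m ih =>
    rw [Function.iterate_succ_apply, ih, sum_mergeSum τ hω, smul_smul]
    congr 1
    rw [Nat.factorial_succ]
    push_cast
    ring

end Iterate

theorem polyFun_forestSum {n b : ℕ} {κ : Fin b → Fin b → Fin b → ℝ} (hκ : IsSymmetricCubic κ)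
    (p : Fin n → Fin b → ℝ) (x : Space n b) (z : Fin n → Fin n → Space n b) (c : Fin n → ℝ)
    (o : Sym2 (Fin n) → Fin n × Fin n) (P : Setoid (Fin n)) :
    polyFun κ p x (forestSum c (fun i j => linPoly (coords (z i j))) o P) =
      forestSum c (fun i j => bilin κ p (z i j) x) o P := by
  simp only [forestSum, edgeWt, map_sum, map_prod, map_smul, polyFun_linPoly hκ]

/-! ### Odd partitions as `Finpartition`s and as fibers of a map. -/

section Parts

variable {n : ℕ}

open Classical in
theorem sum_isOddPartition {M : Type} [AddCommMonoid M] (m : ℕ)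
    (F : Finset (Finset (Fin n)) → M) :
    ∑ 𝒜 ∈ Finset.univ.filter (IsOddPartition m), F 𝒜 = ∑ π ∈ markedVertexSets n m, F π.parts := by
  symm
  refine Finset.sum_bij (fun π _ => π.parts) ?_ ?_ ?_ fun _ _ => rfl
  · intro π hπ
    obtain ⟨h1, h2⟩ := (Finset.mem_filter.1 hπ).2
    refine Finset.mem_filter.2 ⟨Finset.mem_univ _, ⟨π.disjoint, π.biUnion_parts⟩, ?_, h2⟩
    rw [h1, Fintype.card_fin]
  · exact fun π _ π' _ h => Finpartition.ext h
  · intro 𝒜 h𝒜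
    have h := (Finset.mem_filter.1 h𝒜).2
    refine ⟨⟨𝒜, Finset.supIndep_iff_pairwiseDisjoint.2 h.1.1, ?_, ?_⟩, ?_, rfl⟩
    · rw [Finset.sup_eq_biUnion]
      exact h.1.2
    · intro h0
      have := h.2.2 _ h0
      simp at this
    · refine Finset.mem_filter.2 ⟨Finset.mem_univ _, ?_, h.2.2⟩
      have := h.2.1
      rwa [Fintype.card_fin] at this

theorem isOddPartition_parts {m : ℕ} {π : Finpartition (Finset.univ : Finset (Fin n))}
    (hπ : π ∈ markedVertexSets n m) : IsOddPartition m π.parts := by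
  obtain ⟨h1, h2⟩ := (Finset.mem_filter.1 hπ).2
  exact ⟨⟨π.disjoint, π.biUnion_parts⟩, by rw [h1, Fintype.card_fin], h2⟩

/-- The part of a partition that contains an element. -/
def partMap (π : Finpartition (Finset.univ : Finset (Fin n))) (i : Fin n) : π.parts :=
  ⟨π.part i, π.part_mem.2 (Finset.mem_univ i)⟩

theorem partMap_eq_iff {π : Finpartition (Finset.univ : Finset (Fin n))} {i : Fin n}
    {A : π.parts} : partMap π i = A ↔ i ∈ (A : Finset (Fin n)) := by
  rw [Subtype.ext_iff]
  exact π.part_eq_iff_mem A.2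

theorem filter_partMap (π : Finpartition (Finset.univ : Finset (Fin n))) (A : π.parts) :
    Finset.univ.filter (fun i => partMap π i = A) = (A : Finset (Fin n)) := by
  ext i
  simp [partMap_eq_iff]

theorem partMap_surjective (π : Finpartition (Finset.univ : Finset (Fin n))) :
    Function.Surjective (partMap π) := fun A => by
  obtain ⟨i, hi⟩ := π.nonempty_of_mem_parts A.2
  exact ⟨i, partMap_eq_iff.2 hi⟩

theorem blockRel_parts {m : ℕ} {π : Finpartition (Finset.univ : Finset (Fin n))}
    (hπ : π ∈ markedVertexSets n m) : blockRel π.parts = Setoid.ker (partMap π) := by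
  ext x y
  have hx : x ∈ (partMap π x : Finset (Fin n)) := partMap_eq_iff.1 rfl
  have hy : y ∈ (partMap π y : Finset (Fin n)) := partMap_eq_iff.1 rfl
  rw [(isOddPartition_parts hπ).rel_iff (partMap π x).2 (partMap π y).2 hx hy, ← Subtype.ext_iff]
  rfl

end Parts

end BPSTree

namespace BPSTree

variable {n b : ℕ} {κ : Fin b → Fin b → Fin b → ℝ}

/-! ### Pairings at the point attached to the charges. -/

section Charges

theorem bilin_single (p : Fin n → Fin b → ℝ) (i : Fin n) (a : Fin b → ℝ) (hκ : IsSymmetricCubic κ)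
    (x : Space n b) : bilin κ p (Pi.single i a) x = cubic κ (p i) a (x i) := by
  rw [bilin, Finset.sum_eq_single i]
  · rw [Pi.single_eq_same]
  · intro j _ hj
    rw [Pi.single_eq_of_ne hj, ← zero_smul ℝ (0 : Fin b → ℝ), cubic_smul_mid hκ, zero_mul]
  · simp

theorem vVec_eq (p : Fin n → Fin b → ℝ) (i j : Fin n) :
    vVec p i j = Pi.single i (p j) - Pi.single j (p i) := by
  ext k a
  simp only [vVec, Pi.sub_apply, Pi.single_apply]
  split_ifs <;> simp

theorem uVec_eq (κ : Fin b → Fin b → Fin b → ℝ) (p : Fin n → Fin b → ℝ) (t : Fin b → ℝ)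
    (i j : Fin n) : uVec κ p t i j =
      Pi.single i (cubic κ (p j) t t • t) - Pi.single j (cubic κ (p i) t t • t) := by
  ext k a
  simp only [uVec, Pi.sub_apply, Pi.single_apply]
  split_ifs <;> simp

theorem bilin_vVec (hκ : IsSymmetricCubic κ) (p : Fin n → Fin b → ℝ) (i j : Fin n)
    (x : Space n b) : bilin κ p (vVec p i j) x =
      cubic κ (p i) (p j) (x i) - cubic κ (p j) (p i) (x j) := by
  rw [vVec_eq, ← bilinMap_apply hκ, map_sub, LinearMap.sub_apply, bilinMap_apply, bilinMap_apply,
    bilin_single p i _ hκ, bilin_single p j _ hκ]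

theorem bilin_uVec (hκ : IsSymmetricCubic κ) (p : Fin n → Fin b → ℝ) (t : Fin b → ℝ) (i j : Fin n)
    (x : Space n b) : bilin κ p (uVec κ p t i j) x =
      cubic κ (p j) t t * cubic κ (p i) t (x i) - cubic κ (p i) t t * cubic κ (p j) t (x j) := by
  rw [uVec_eq, ← bilinMap_apply hκ, map_sub, LinearMap.sub_apply, bilinMap_apply, bilinMap_apply,
    bilin_single p i _ hκ, bilin_single p j _ hκ, cubic_smul_mid hκ, cubic_smul_mid hκ]

theorem vVec_antisymm (p : Fin n → Fin b → ℝ) (i j : Fin n) : vVec p i j = -vVec p j i := by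
  rw [vVec_eq, vVec_eq, neg_sub]

theorem pairingData (hκ : IsSymmetricCubic κ) (p : Fin n → Fin b → ℝ) :
    PairingData (gram κ p) (fun i j => coords (vVec p i j))
      (fun i j k => cubic κ (p i) (p j) (p k)) where
  gram_comm := gram_comm hκ p
  pairing i j k l := by
    have h0 : ∀ a c : Fin b → ℝ, cubic κ a c 0 = 0 := fun a c => by
      rw [← zero_smul ℝ (0 : Fin b → ℝ), cubic_smul_right hκ, zero_mul]
    have hsub : ∀ a c d e : Fin b → ℝ, cubic κ a c (d - e) = cubic κ a c d - cubic κ a c e := by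
      intro a c d e
      rw [eq_sub_iff_add_eq, ← cubic_add_right hκ, sub_add_cancel]
    rw [gramForm_coords hκ, bilin_vVec hκ, vVec_eq]
    simp only [Pi.sub_apply, Pi.single_apply, hsub, apply_ite (cubic κ (p i) (p j)),
      apply_ite (cubic κ (p j) (p i)), h0]
    ring
  rotate i j k := by
    rw [cubic_swap_right hκ (p j), cubic_swap_left hκ (p j)]

theorem cubic_eq_dotProduct (hκ : IsSymmetricCubic κ) (k l y : Fin b → ℝ) :
    cubic κ k l y = l ⬝ᵥ (quadForm κ k *ᵥ y) := by
  rw [cubic_swap_left hκ, cubic_swap_right hκ]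
  simp only [cubic, dotProduct, Matrix.mulVec, quadForm, Matrix.of_apply, Finset.mul_sum,
    Finset.sum_mul]
  exact Finset.sum_congr rfl fun _ _ => Finset.sum_congr rfl fun _ _ =>
    Finset.sum_congr rfl fun _ _ => by ring

/-- The matrix of `p i` cancels its inverse in the charge point. For l = t the bracket is the
imaginary part of the central charge, which is how the stability parameters enter. -/
theorem cubic_chargePoint (hκ : IsSymmetricCubic κ) (bf : Fin b → ℝ) {p : Fin n → Fin b → ℝ}
    (q : Fin n → Fin b → ℝ) (τ₂ : ℝ) {i : Fin n} (hdet : (quadForm κ (p i)).det ≠ 0)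
    (l : Fin b → ℝ) : cubic κ (p i) l (chargePoint κ bf p q τ₂ i) =
      Real.sqrt (2 * τ₂) * ((∑ a, q i a * l a) + cubic κ (p i) bf l) := by
  have h1 : chargePoint κ bf p q τ₂ i =
      Real.sqrt (2 * τ₂) • ((quadForm κ (p i))⁻¹ *ᵥ q i + bf) := rfl
  rw [h1, cubic_smul_right hκ, cubic_add_right hκ, cubic_eq_dotProduct hκ _ l, Matrix.mulVec_mulVec,
    Matrix.mul_nonsing_inv _ (isUnit_iff_ne_zero.2 hdet), Matrix.one_mulVec, dotProduct_comm,
    cubic_swap_right hκ _ l]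
  rfl

/-- The two contributions of the B-field are both (p_i p_j β) and cancel. -/
theorem bilin_vVec_chargePoint (hκ : IsSymmetricCubic κ) (bf : Fin b → ℝ) {p : Fin n → Fin b → ℝ}
    (q : Fin n → Fin b → ℝ) (τ₂ : ℝ) (hdet : ∀ i, (quadForm κ (p i)).det ≠ 0) (i j : Fin n) :
    bilin κ p (vVec p i j) (chargePoint κ bf p q τ₂) =
      Real.sqrt (2 * τ₂) * dsz (p i) (q i) (p j) (q j) := by
  rw [bilin_vVec hκ, cubic_chargePoint hκ bf q τ₂ (hdet i), cubic_chargePoint hκ bf q τ₂ (hdet j),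
    cubic_swap_right hκ (p i) bf, cubic_swap_left hκ (p i), cubic_swap_right hκ (p j) bf, dsz,
    Finset.sum_sub_distrib]
  ring

theorem imZZ_eq (κ : Fin b → Fin b → Fin b → ℝ) (bf t p₁ q₁ p₂ q₂ : Fin b → ℝ) :
    imZZ κ bf t p₁ q₁ p₂ q₂ =
      (1 / 2) * (cubic κ p₁ t t * ((∑ a, q₂ a * t a) + cubic κ p₂ bf t) -
        cubic κ p₂ t t * ((∑ a, q₁ a * t a) + cubic κ p₁ bf t)) := by
  simp only [imZZ, centralCharge, Complex.mul_im, Complex.conj_re, Complex.conj_im]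
  ring

theorem imZZ_antisymm (κ : Fin b → Fin b → Fin b → ℝ) (bf t p₁ q₁ p₂ q₂ : Fin b → ℝ) :
    imZZ κ bf t p₁ q₁ p₂ q₂ = -imZZ κ bf t p₂ q₂ p₁ q₁ := by
  rw [imZZ_eq, imZZ_eq]
  ring

theorem stab_eq_sum (κ : Fin b → Fin b → Fin b → ℝ) (bf t : Fin b → ℝ) (p q : Fin n → Fin b → ℝ)
    (i : Fin n) : stab κ bf t p q i = ∑ j, imZZ κ bf t (p i) (q i) (p j) (q j) := by
  simp only [stab, imZZ_eq, cubic_sum_left, Finset.sum_apply, Finset.sum_mul]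
  rw [Finset.sum_comm, ← Finset.sum_add_distrib, Finset.mul_sum, ← Finset.sum_sub_distrib,
    Finset.mul_sum]

theorem bilin_uVec_chargePoint (hκ : IsSymmetricCubic κ) (bf : Fin b → ℝ) {p : Fin n → Fin b → ℝ}
    (q : Fin n → Fin b → ℝ) (t : Fin b → ℝ) (τ₂ : ℝ) (hdet : ∀ i, (quadForm κ (p i)).det ≠ 0)
    (i j : Fin n) : bilin κ p (uVec κ p t i j) (chargePoint κ bf p q τ₂) =
      -(2 * Real.sqrt (2 * τ₂)) * imZZ κ bf t (p i) (q i) (p j) (q j) := by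
  rw [bilin_uVec hκ, cubic_chargePoint hκ bf q τ₂ (hdet i), cubic_chargePoint hκ bf q τ₂ (hdet j),
    imZZ_eq]
  ring

theorem sum_sum_eq_zero_of_antisymm {V : Type} (I : Finset V) {a : V → V → ℝ}
    (ha : ∀ i j, a i j = -a j i) : ∑ i ∈ I, ∑ j ∈ I, a i j = 0 := by
  have h : ∑ i ∈ I, ∑ j ∈ I, a i j = -∑ i ∈ I, ∑ j ∈ I, a i j := by
    conv_lhs => rw [Finset.sum_comm]
    simp only [← Finset.sum_neg_distrib]
    exact Finset.sum_congr rfl fun i _ => Finset.sum_congr rfl fun j _ => ha j i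
  linarith

/-- Pairs inside `I` cancel by antisymmetry. For the full set this gives total sum zero. -/
theorem sum_stab (κ : Fin b → Fin b → Fin b → ℝ) (bf t : Fin b → ℝ) (p q : Fin n → Fin b → ℝ)
    (I : Finset (Fin n)) : ∑ i ∈ I, stab κ bf t p q i =
      ∑ i ∈ I, ∑ j ∈ Iᶜ, imZZ κ bf t (p i) (q i) (p j) (q j) := by
  have h := sum_sum_eq_zero_of_antisymm I
    (a := fun i j => imZZ κ bf t (p i) (q i) (p j) (q j)) fun i j => imZZ_antisymm ..
  simp only [stab_eq_sum, ← Finset.sum_add_sum_compl I, Finset.sum_add_distrib, h, zero_add]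

theorem bilin_uSet_chargePoint (hκ : IsSymmetricCubic κ) (bf : Fin b → ℝ) {p : Fin n → Fin b → ℝ}
    (q : Fin n → Fin b → ℝ) (t : Fin b → ℝ) (τ₂ : ℝ) (hdet : ∀ i, (quadForm κ (p i)).det ≠ 0)
    (I : Finset (Fin n)) : bilin κ p (uSet κ p t I) (chargePoint κ bf p q τ₂) =
      -(2 * Real.sqrt (2 * τ₂)) * ∑ i ∈ I, stab κ bf t p q i := by
  rw [sum_stab, uSet, ← bilinMap_apply hκ]
  simp only [map_sum, LinearMap.sum_apply, bilinMap_apply, Finset.mul_sum,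
    bilin_uVec_chargePoint hκ bf q t τ₂ hdet]

theorem isGenericZeroSum_stab {bf t : Fin b → ℝ} {p q : Fin n → Fin b → ℝ}
    (h : ∀ I : Finset (Fin n), IsProper I → ∑ i ∈ I, stab κ bf t p q i ≠ 0) :
    IsGenericZeroSum (stab κ bf t p q) := by
  refine ⟨?_, fun I h1 h2 => h I ⟨h1, h2⟩⟩
  rw [sum_stab]
  simp

theorem dsz_sum_sum (p q : Fin n → Fin b → ℝ) (A B : Finset (Fin n)) :
    dsz (∑ i ∈ A, p i) (∑ i ∈ A, q i) (∑ i ∈ B, p i) (∑ i ∈ B, q i) =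
      ∑ i ∈ A, ∑ j ∈ B, dsz (p i) (q i) (p j) (q j) := by
  simp only [dsz, Finset.sum_apply, Finset.sum_mul_sum, Finset.sum_sub_distrib]
  congr 1
  · rw [Finset.sum_comm]
    exact Finset.sum_congr rfl fun _ _ => Finset.sum_comm
  · rw [Finset.sum_comm]
    rw [Finset.sum_comm (s := A)]
    refine Finset.sum_congr rfl fun _ _ => ?_
    rw [Finset.sum_comm]

end Charges

/-! ### Evaluation of the limit as a sum over marked trees. -/

section Evaluation

theorem polyFun_heat (p : Fin n → Fin b → ℝ) (x : Space n b) (N : ℕ)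
    (f : MvPolynomial (Fin n × Fin b) ℝ) :
    polyFun κ p x (heat (gram κ p) N f) = ∑ m ∈ Finset.range N,
      ((m.factorial : ℝ) * (4 * Real.pi) ^ m)⁻¹ * polyFun κ p x ((lap (gram κ p) ^ m) f) := by
  simp only [heat, map_sum, map_smul, smul_eq_mul, Module.End.pow_apply]

open Classical in
theorem forestSum_bot [NeZero n] {R : Type} [CommRing R] [Algebra ℝ R] {c : Fin n → ℝ}
    (hc : ∑ i, c i = 0) {w : Fin n → Fin n → R} (hw : ∀ i j, w i j = -w j i)
    {o₀ : Sym2 (Fin n) → Fin n × Fin n} (ho₀ : IsOrientation o₀)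
    {o : SimpleGraph (Fin n) → Sym2 (Fin n) → Fin n × Fin n} (ho : ∀ T, IsOrientation (o T)) :
    forestSum c w o₀ ⊥ = ∑ T ∈ trees (Fin n), ∏ e ∈ T.edgeFinset,
      Real.sign (∑ i ∈ side T e (o T e).1, c i) • w (o T e).1 (o T e).2 := by
  have hker : Setoid.ker (id : Fin n → Fin n) = ⊥ := Setoid.ker_eq_bot_iff.2 Function.injective_id
  rw [← hker, forestSum_ker Function.surjective_id c hw ho₀ ho]
  refine Finset.sum_congr rfl fun T hT => Finset.prod_congr rfl fun e he => ?_
  have he' : s((o T e).1, (o T e).2) ∈ T.edgeSet := by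
    rw [ho T e]
    exact SimpleGraph.mem_edgeFinset.1 he
  have hs := side_compl (mem_trees.1 hT) he'
  rw [ho T e] at hs
  have hside : ∀ A, sideSum id c T e A = ∑ i ∈ side T e A, c i := by
    intro A
    refine Finset.sum_congr rfl fun B _ => ?_
    simp [Finset.sum_filter]
  -- The two sides have opposite sums, so the sign of the difference is the sign of the source side.
  rw [hside, hside, ← hs, sign_sub_comm, sign_sub_of_add_eq_zero
    (by rw [add_comm, Finset.sum_add_sum_compl, hc]), neg_neg]
  simp [Finset.sum_filter]

end Evaluation

end BPSTree

namespace BPSTree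

variable {n b : ℕ} {κ : Fin b → Fin b → Fin b → ℝ}

theorem sign_mul_of_neg {r : ℝ} (hr : r < 0) (a : ℝ) : Real.sign (r * a) = -Real.sign a := by
  rw [real_sign_eq_coe, sign_mul, sign_neg hr, real_sign_eq_coe]
  simp

/-- The limit at a point where the signs are those of the sums of a generic `c`. -/
theorem limitKernel_eq [NeZero n] (p : Fin n → Fin b → ℝ)
    (t : Fin b → ℝ) {o : SimpleGraph (Fin n) → Sym2 (Fin n) → Fin n × Fin n}
    (ho : ∀ T, IsOrientation (o T)) {o₀ : Sym2 (Fin n) → Fin n × Fin n} (ho₀ : IsOrientation o₀)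
    (N : ℕ) {x : Space n b} {c : Fin n → ℝ} (hc : ∑ i, c i = 0) {r : ℝ} (hr : r < 0)
    (hx : ∀ I, bilin κ p (uSet κ p t I) x = r * ∑ i ∈ I, c i) :
    limitKernel κ p t o N x = 1 / (2 ^ (n - 1) * (n.factorial : ℝ)) * ((-1) ^ (n - 1) *
      polyFun κ p x (heat (gram κ p) N
        (forestSum c (fun i j => linPoly (coords (vVec p i j))) o₀ ⊥))) := by
  classical
  have hw : ∀ i j, linPoly (coords (vVec p i j)) = -linPoly (coords (vVec p j i)) := by
    intro i j
    rw [vVec_antisymm, ← linPoly_neg]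
    rfl
  rw [limitKernel, forestSum_bot hc hw ho₀ ho]
  congr 1
  have hheat : ∀ f, polyFun κ p x (heat (gram κ p) N f) = (∑ m ∈ Finset.range N,
      ((m.factorial : ℝ) * (4 * Real.pi) ^ m)⁻¹ •
        ((polyFun κ p x).toLinearMap ∘ₗ (lap (gram κ p) ^ m))) f := by
    intro f
    simp [polyFun_heat]
  rw [hheat, map_sum, Finset.mul_sum]
  refine Finset.sum_congr rfl fun T hT => ?_
  have hcard : T.edgeFinset.card = n - 1 := by
    have h := (mem_trees.1 hT).card_edgeFinset
    rw [Fintype.card_fin] at h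
    omega
  -- The negative factor `r` flips the sign at each of the n-1 edges.
  have hsign : ∏ e ∈ T.edgeFinset, Real.sign (bilin κ p (uSet κ p t (side T e (o T e).1)) x) =
      (-1) ^ (n - 1) * ∏ e ∈ T.edgeFinset, Real.sign (∑ i ∈ side T e (o T e).1, c i) := by
    simp only [hx, sign_mul_of_neg hr, Finset.prod_neg, hcard]
  rw [hsign, hheat, mul_assoc]
  congr 1
  rw [Finset.prod_smul, map_smul, smul_eq_mul, edgePoly]

theorem edgeDSZ_eq {π : Finpartition (Finset.univ : Finset (Fin n))} (p q : Fin n → Fin b → ℝ)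
    (o : Sym2 π.parts → π.parts × π.parts) (e : Sym2 π.parts) :
    edgeDSZ p q o e = ∑ i ∈ ((o e).1 : Finset (Fin n)), ∑ j ∈ ((o e).2 : Finset (Fin n)),
      dsz (p i) (q i) (p j) (q j) :=
  dsz_sum_sum p q _ _

theorem dsz_antisymm (p q p' q' : Fin b → ℝ) : dsz p q p' q' = -dsz p' q' p q := by
  simp only [dsz, ← Finset.sum_neg_distrib, neg_sub]

theorem sumOver_eq {π : Finpartition (Finset.univ : Finset (Fin n))} {M : Type} [AddCommMonoid M]
    (W : Finset π.parts) (f : Fin n → M) :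
    sumOver W f = ∑ i ∈ Finset.univ.filter (fun i => partMap π i ∈ W), f i := by
  rw [sumOver, ← Finset.sum_fiberwise_eq_sum_filter]
  simp only [filter_partMap]

theorem sideSum_partMap {π : Finpartition (Finset.univ : Finset (Fin n))} (c : Fin n → ℝ)
    (T : SimpleGraph π.parts) (e : Sym2 π.parts) (A : π.parts) :
    sideSum (partMap π) c T e A = sumOver (side T e A) c := by
  simp only [sideSum, filter_partMap, sumOver]

theorem sumOver_compl {π : Finpartition (Finset.univ : Finset (Fin n))} {M : Type}
    [AddCommMonoid M] (W : Finset π.parts) (f : Fin n → M) :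
    sumOver Wᶜ f = ∑ i ∈ (Finset.univ.filter (fun i => partMap π i ∈ W))ᶜ, f i := by
  rw [sumOver_eq]
  refine Finset.sum_congr ?_ fun _ _ => rfl
  ext i
  simp

theorem side_fst_compl {π : Finpartition (Finset.univ : Finset (Fin n))}
    {o : Sym2 π.parts → π.parts × π.parts} (ho : IsOrientation o) {T : SimpleGraph π.parts}
    (hT : T ∈ trees π.parts) {e : Sym2 π.parts} (he : e ∈ T.edgeSet) :
    (side T e (o e).1)ᶜ = side T e (o e).2 := by
  have h := side_compl (mem_trees.1 hT) (i := (o e).1) (j := (o e).2) (by rwa [ho e])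
  rwa [ho e] at h

theorem edgeStab_eq {bf t : Fin b → ℝ} {p q : Fin n → Fin b → ℝ}
    {π : Finpartition (Finset.univ : Finset (Fin n))} {o : Sym2 π.parts → π.parts × π.parts}
    (ho : IsOrientation o) {T : SimpleGraph π.parts} (hT : T ∈ trees π.parts) {e : Sym2 π.parts}
    (he : e ∈ T.edgeSet) :
    edgeStab (stab κ bf t p q) o T e = sumOver (side T e (o e).1) fun i =>
      sumOver (side T e (o e).2) fun j => imZZ κ bf t (p i) (q i) (p j) (q j) := by
  rw [edgeStab, ← side_fst_compl ho hT he]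
  simp only [sumOver_compl]
  rw [sumOver_eq, sumOver_eq, sum_stab]

open Classical in
/-- The sum over the trees on the parts of a partition. -/
theorem forestSum_parts [NeZero n] {m : ℕ} {π : Finpartition (Finset.univ : Finset (Fin n))}
    (hπ : π ∈ markedVertexSets n m) {c : Fin n → ℝ} (hc : ∑ i, c i = 0) (p q : Fin n → Fin b → ℝ)
    (r : ℝ) {o₀ : Sym2 (Fin n) → Fin n × Fin n} (ho₀ : IsOrientation o₀)
    {o : SimpleGraph π.parts → Sym2 π.parts → π.parts × π.parts} (ho : ∀ T, IsOrientation (o T)) :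
    forestSum c (fun i j => r * dsz (p i) (q i) (p j) (q j)) o₀ (blockRel π.parts) =
      r ^ (n - 1 - 2 * m) * ∑ T ∈ trees π.parts, ∏ e ∈ T.edgeFinset,
        edgeDSZ p q (o T) e * Real.sign (edgeStab c (o T) T e) := by
  rw [blockRel_parts hπ, forestSum_ker (partMap_surjective π) c
    (fun i j => by rw [dsz_antisymm, mul_neg]) ho₀ ho, Finset.mul_sum]
  refine Finset.sum_congr rfl fun T hT => ?_
  -- A tree on n-2m parts; each of its edges contributes one factor `r`.
  have hcard : T.edgeFinset.card = n - 1 - 2 * m := by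
    have h := (mem_trees.1 hT).card_edgeFinset
    have h1 := (Finset.mem_filter.1 hπ).2.1
    rw [Fintype.card_coe] at h
    omega
  rw [← hcard, ← Finset.prod_const, ← Finset.prod_mul_distrib]
  refine Finset.prod_congr rfl fun e he => ?_
  have hs := side_fst_compl (ho T) hT (SimpleGraph.mem_edgeFinset.1 he)
  have hsum : sumOver (side T e (o T e).2) c + sumOver (side T e (o T e).1) c = 0 := by
    rw [← hs, sumOver_compl, sumOver_eq, add_comm, Finset.sum_add_sum_compl, hc]
  rw [sideSum_partMap, sideSum_partMap, sign_sub_comm, sign_sub_of_add_eq_zero hsum, neg_neg,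
    filter_partMap, filter_partMap, edgeDSZ_eq, edgeStab, smul_eq_mul]
  simp only [← Finset.mul_sum]
  ring

theorem markedVertexSets_eq_empty [NeZero n] {m : ℕ} (hm : (n - 1) / 2 < m) :
    markedVertexSets n m = ∅ := by
  refine Finset.filter_eq_empty_iff.2 fun π _ h => ?_
  have h1 : 0 < π.parts.card :=
    Finset.card_pos.2 (π.parts_nonempty (Finset.univ_nonempty (α := Fin n)).ne_empty)
  have h2 := h.1
  omega

/-- The repeated Laplace operator on the tree sum. -/
theorem polyFun_lap_forestSum [NeZero n] (hκ : IsSymmetricCubic κ) (p q : Fin n → Fin b → ℝ)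
    {x : Space n b} {r : ℝ}
    (hx : ∀ i j, bilin κ p (vVec p i j) x = r * dsz (p i) (q i) (p j) (q j))
    {c : Fin n → ℝ} (hc : IsGenericZeroSum c) {o₀ : Sym2 (Fin n) → Fin n × Fin n}
    (ho₀ : IsOrientation o₀)
    {o : (π : Finpartition (Finset.univ : Finset (Fin n))) → SimpleGraph π.parts →
      Sym2 π.parts → π.parts × π.parts}
    (ho : ∀ π T, IsOrientation (o π T)) (m : ℕ) :
    polyFun κ p x ((lap (gram κ p) ^ m)
      (forestSum c (fun i j => linPoly (coords (vVec p i j))) o₀ ⊥)) =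
      (-2) ^ m * (m.factorial : ℝ) * (r ^ (n - 1 - 2 * m) * markedTreeSum κ p q c o m) := by
  classical
  set τ : Fin n → Fin n → Fin n → ℝ := fun i j k => cubic κ (p i) (p j) (p k) with hτ
  set f : Setoid (Fin n) → MvPolynomial (Fin n × Fin b) ℝ := fun P =>
    forestSum c (fun i j => linPoly (coords (vVec p i j))) o₀ P with hf
  have hL : ∀ P, lap (gram κ p) (f P) = (-(1 / 3) : ℝ) • mergeSum τ f P := by
    intro P
    have h : (3 : ℝ) • lap (gram κ p) (f P) = -mergeSum τ f P :=
      lap_forestSum (pairingData hκ p) ho₀ hc P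
    rw [neg_smul, ← smul_neg, ← h, smul_smul]
    norm_num
  have h1 := iterate_eq_iterate_mergeSum hL m ⊥
  rw [iterate_mergeSum_bot τ (markWeight_singleton κ p) (markWeight_recursion hκ p),
    sum_isOddPartition m fun 𝒜 => (∏ A ∈ 𝒜, markWeight κ p A) • f (blockRel 𝒜), smul_smul] at h1
  change polyFun κ p x ((lap (gram κ p) ^ m) (f ⊥)) = _
  rw [h1, map_smul, map_sum, smul_eq_mul, markedTreeSum]
  congr 1
  -- Here (-1/3)·6 = -2.
  · rw [← mul_assoc, ← mul_pow]
    norm_num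
  · rw [Finset.mul_sum]
    refine Finset.sum_congr rfl fun π hπ => ?_
    rw [map_smul, smul_eq_mul, polyFun_forestSum hκ]
    simp only [hx]
    rw [forestSum_parts hπ hc.1 p q r ho₀ (ho π), Finset.prod_coe_sort, ← Finset.mul_sum]
    ring

/-- The limit at a point attached to charges. -/
theorem limitKernel_eq_markedTreeSum [NeZero n] (hκ : IsSymmetricCubic κ)
    (p q : Fin n → Fin b → ℝ) (t : Fin b → ℝ)
    {o : SimpleGraph (Fin n) → Sym2 (Fin n) → Fin n × Fin n} (ho : ∀ T, IsOrientation (o T))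
    {x : Space n b} {s τ₂ : ℝ} (hs : 0 < s) (hτ : s ^ 2 = 2 * τ₂)
    (hx : ∀ i j, bilin κ p (vVec p i j) x = s * dsz (p i) (q i) (p j) (q j))
    {c : Fin n → ℝ} (hc : IsGenericZeroSum c) {r : ℝ} (hr : r < 0)
    (hu : ∀ I, bilin κ p (uSet κ p t I) x = r * ∑ i ∈ I, c i)
    {o' : (π : Finpartition (Finset.univ : Finset (Fin n))) → SimpleGraph π.parts →
      Sym2 π.parts → π.parts × π.parts}
    (ho' : ∀ π T, IsOrientation (o' π T)) :
    limitKernel κ p t o n x / s ^ (n - 1) = (-1) ^ (n - 1) / (2 ^ (n - 1) * (n.factorial : ℝ)) *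
      ∑ m ∈ Finset.range ((n - 1) / 2 + 1),
        (-1 : ℝ) ^ m / (4 * Real.pi * τ₂) ^ m * markedTreeSum κ p q c o' m := by
  have hsub : Finset.range ((n - 1) / 2 + 1) ⊆ Finset.range n := by
    have := NeZero.pos n
    exact Finset.range_subset_range.2 (by omega)
  have hτ₂ : 0 < τ₂ := by nlinarith [pow_pos hs 2]
  rw [limitKernel_eq p t ho (ho ⊥) n hc.1 hr hu, polyFun_heat]
  simp only [polyFun_lap_forestSum hκ p q hx hc (ho ⊥) ho']
  -- The truncation at `n` includes values of m for which there are no n-2m ≥ 1 parts; they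
  -- contribute zero.
  rw [← Finset.sum_subset hsub]
  · rw [mul_div_assoc, mul_div_assoc, Finset.sum_div, ← mul_assoc, one_div_mul_eq_div]
    congr 1
    refine Finset.sum_congr rfl fun m hm => ?_
    have hm' := Finset.mem_range.1 hm
    -- The 2m factors s = √(2τ₂) not used by edges become (2τ₂)^m, which together with (-2)^m/(4π)^m
    -- gives (-1)^m/(4πτ₂)^m.
    have hpow : s ^ (n - 1) = s ^ (n - 1 - 2 * m) * (2 * τ₂) ^ m := by
      rw [← hτ, ← pow_mul, ← pow_add]
      congr 1
      omega
    have h1 : (-2 : ℝ) ^ m = (-1) ^ m * 2 ^ m := by rw [← mul_pow]; norm_num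
    have hfac : (m.factorial : ℝ) ≠ 0 := Nat.cast_ne_zero.2 m.factorial_ne_zero
    have hs' := hs.ne'
    have hπ := Real.pi_ne_zero
    have h4 : (4 : ℝ) ^ m = 2 ^ m * 2 ^ m := by rw [← mul_pow]; norm_num
    rw [hpow, h1, mul_pow, mul_pow, mul_pow, mul_pow, h4]
    field_simp
  · intro m _ hm
    rw [Finset.mem_range, not_lt] at hm
    rw [markedTreeSum, markedVertexSets_eq_empty (by omega)]
    simp

end BPSTree

theorem proposition3 (n b : ℕ) (hn : 1 ≤ n)
    (κ : Fin b → Fin b → Fin b → ℝ) (hκ : BPSTree.IsSymmetricCubic κ)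
    (t : Fin b → ℝ) (p : Fin n → Fin b → ℝ)
    (hp : ∀ i, 0 < BPSTree.cubic κ (p i) t t)
    (o : SimpleGraph (Fin n) → Sym2 (Fin n) → Fin n × Fin n)
    (ho : ∀ T, BPSTree.IsOrientation (o T))
    (o' : (π : Finpartition (Finset.univ : Finset (Fin n))) → SimpleGraph π.parts →
      Sym2 π.parts → π.parts × π.parts)
    (ho' : ∀ π T, BPSTree.IsOrientation (o' π T)) :
    (∃ Φ₀ : BPSTree.Space n b → ℝ,
      BPSTree.IsLargeLimit κ p t (BPSTree.treeKernel κ p t o) Φ₀) ∧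
    ∀ Φ₀ : BPSTree.Space n b → ℝ,
      BPSTree.IsLargeLimit κ p t (BPSTree.treeKernel κ p t o) Φ₀ →
      ∀ (bf : Fin b → ℝ) (q : Fin n → Fin b → ℝ) (g : Fin n → Fin n → ℤ) (τ₂ : ℝ),
        0 < τ₂ →
        (∀ i, (BPSTree.quadForm κ (p i)).det ≠ 0) →
        (∀ i j, (g i j : ℝ) = BPSTree.dsz (p i) (q i) (p j) (q j)) →
        (∀ I : Finset (Fin n), BPSTree.IsProper I →
          ∑ i ∈ I, BPSTree.stab κ bf t p q i ≠ 0) →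
        BPSTree.rescaledLimit g τ₂ Φ₀ (BPSTree.chargePoint κ bf p q τ₂) =
            (-1 : ℝ) ^ ((n : ℤ) - 1 + ∑ i, ∑ j ∈ Finset.Ioi i, g i j) /
                (2 ^ (n - 1) * (n.factorial : ℝ)) *
              ∑ m ∈ Finset.range ((n - 1) / 2 + 1),
                (-1 : ℝ) ^ m / (4 * Real.pi * τ₂) ^ m *
                  BPSTree.markedTreeSum κ p q (BPSTree.stab κ bf t p q) o' m ∧
          ∀ m, ∀ π ∈ BPSTree.markedVertexSets n m, ∀ T ∈ BPSTree.trees π.parts,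
            ∀ e ∈ T.edgeSet,
              BPSTree.edgeStab (BPSTree.stab κ bf t p q) (o' π T) T e =
                BPSTree.sumOver (BPSTree.side T e (o' π T e).1) fun i =>
                  BPSTree.sumOver (BPSTree.side T e (o' π T e).2) fun j =>
                    BPSTree.imZZ κ bf t (p i) (q i) (p j) (q j) := by
  have hlim := BPSTree.isLargeLimit_limitKernel hκ hp ho (N := n) le_rfl
  refine ⟨⟨_, hlim⟩, fun Φ₀ h₀ bf q g τ₂ hτ hdet _ hgen => ⟨?_, fun m π _ T hT e he =>
    BPSTree.edgeStab_eq (ho' π T) hT he⟩⟩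
  have : NeZero n := ⟨by omega⟩
  have hs : 0 < Real.sqrt (2 * τ₂) := Real.sqrt_pos.2 (by linarith)
  have hr : -(2 * Real.sqrt (2 * τ₂)) < 0 := by linarith
  have hu := BPSTree.bilin_uSet_chargePoint hκ bf q t τ₂ hdet
  -- Genericity of the c's puts the charge point off all walls, so an arbitrary limit Φ₀ agrees
  -- there with `limitKernel`.
  have hoff : BPSTree.OffWalls κ p t (BPSTree.chargePoint κ bf p q τ₂) := by
    intro I hI
    rw [hu]
    exact mul_ne_zero hr.ne (hgen I hI)
  have hkey := BPSTree.limitKernel_eq_markedTreeSum hκ p q t ho hs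
    (Real.sq_sqrt (by linarith)) (BPSTree.bilin_vVec_chargePoint hκ bf q τ₂ hdet)
    (BPSTree.isGenericZeroSum_stab hgen) hr hu ho'
  have hz : (-1 : ℝ) ^ ((n : ℤ) - 1) = (-1) ^ (n - 1) := by
    rw [show (n : ℤ) - 1 = ((n - 1 : ℕ) : ℤ) by omega, zpow_natCast]
  rw [BPSTree.rescaledLimit, BPSTree.IsLargeLimit.eq_of_offWalls hκ hn hp h₀ hlim hoff,
    zpow_add₀ (by norm_num), hz, div_mul_eq_mul_div, mul_div_assoc, hkey]
  ring
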